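/- **Setting.** Fix cost weights $q,r>0$, a regularization $\lambda>0$, numbers $0<\underline a\le\bar a$, $0<\underline b\le\bar b$, and a noise law $\mathcal D$ on $\mathbb R$ with mean $0$, variance $1$, $\mathbb E_{w\sim\mathcal D}e^{gw}\le e^{g^2\alpha^2/2}$ for all $g\in\mathbb R$ (some $\alpha>0$), and a density bounded by a constant $B_P$. Fix also $c_0>0$ and $k_0\in\mathbb N$. The horizon is $T=2^{12m}$, $m\in\mathbb N$. Put $\nu_T=T^{-1/4}$, $T_s=2^s/\nu_T^2=2^s\sqrt T$ and $s_e=\log_2(T\nu_T^2)-1$. A *problem at horizon $T$* consists of the following. * True dynamics $\theta^*=(a^*,b^*)\in[\underline a,\bar a]\times[\underline b,\bar b]$; the system is $x_0=0$, $x_{t+1}=a^*x_t+b^*u_t+w_t$ with $w_t$ i.i.d. from $\mathcal D$. * Boundaries (which may depend on $T$) with $-\log^2T\le D_L<0<D_U\le\log^2T$, $D_U-D_L\ge 1/\log T$, and $D_U\ge c_0/\log^{k_0}T$. * A controller $C^{\mathrm{init}}$ with $D_L+\frac{b^*}{\log T}\le a^*x+b^*C^{\mathrm{init}}(x)\le D_U-\frac{b^*}{\log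 T}$ for all $x\in[D_L+F_{\mathcal D}^{-1}(T^{-4}),\,D_U+F_{\mathcal D}^{-1}(1-T^{-4})]$, where $F_{\mathcal D}^{-1}(p)=\inf\{x: F_{\mathcal D}(x)\ge p\}$. * For every $\theta=(a,b)$ a baseline class $\{C_K^\theta: K\in[K_L^\theta,K_U^\theta]\}$ of stationary deterministic controllers, obtained from controllers $\tilde C_K^\theta$ by truncation: $C_K^\theta(x)=\tilde C_K^\theta(x)$ if $D_L\le ax+b\tilde C_K^\theta(x)\le D_U$, $C_K^\theta(x)=(D_U-ax)/b$ if $ax+b\tilde C_K^\theta(x)>D_U$, and $C_K^\theta(x)=(D_L-ax)/b$ if $ax+b\tilde C_K^\theta(x)<D_L$. For $b>0$ and $1\le t\le T$, $K_{\mathrm{opt}}(\theta,t)$ is a minimizer over $K\in[K_L^\theta,K_U^\theta]$ of the expected average cost $\mathbb E\big[\frac1t\big(qx_t^2+\sum_{i<t}(qx_i^2+ru_i^2)\big)\big]$ of $C_K^\theta$ under dynamics $\theta$ from $x_0=0$. All these maps are measurable (for $K_{\mathrm{opt}}$: $(\theta,x)\mapsto \tilde C^\theta_{K_{\mathrm{opt}}(\theta,t)}(x)$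 is jointly measurable for each $t$). Write $P(\theta,K,z)=\sup\{x: ax+bC_K^\theta(x)\le z\}\in[-\infty,\infty]$, $z_t=(x_t,u_t)^\top$, $V_t=\lambda I+\sum_{i<t}z_iz_i^\top$, let $Z_t$ be the matrix with rows $z_0^\top,\dots,z_{t-1}^\top$, $X_t=(x_1,\dots,x_t)^\top$, and $$B_t=\alpha\sqrt{\log\det V_t+\log\lambda^2+2\log T^2}+\sqrt\lambda(\bar a^2+\bar b^2).$$ **Algorithm.** For $t<\sqrt T$ use $u_t=C^{\mathrm{init}}(x_t)+\phi_t/\log T$ with i.i.d. uniform signs $\phi_t\in\{\pm1\}$ independent of the noise. Then, for $s=0,\dots,s_e$, put $$\epsilon_s=B_{T_s}\sqrt{\frac{\max(V_{T_s}^{22},V_{T_s}^{11})}{V_{T_s}^{11}V_{T_s}^{22}-(V_{T_s}^{12})^2}},\qquad \hat\theta_s^{\mathrm{pre}}=(Z_{T_s}^\top Z_{T_s}+\lambda I)^{-1}Z_{T_s}^\top X_{T_s},$$ let $\hat\theta_s$ be any minimizer (chosen measurably from the history $x_0,u_0,\dots,x_{T_s}$) of $\theta'\mapsto\inf_{\|\theta-\hat\theta_s^{\mathrm{pre}}\|_\infty\le\epsilon_s}P(\theta,K_{\mathrm{opt}}(\theta',T_s),D_U)$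 over $\|\theta'-\hat\theta_s^{\mathrm{pre}}\|_\infty\le\epsilon_s$, and for $T_s\le t<2T_s$ use $$u_t=\max\big(\min\big(C^{\hat\theta_s}_{K_{\mathrm{opt}}(\hat\theta_s,T_s)}(x_t),\,u_t^{\mathrm{safeU}}\big),\,u_t^{\mathrm{safeL}}\big),$$ where $u_t^{\mathrm{safeU}}$ is the largest $u$ with $ax_t+bu\le D_U$, and $u_t^{\mathrm{safeL}}$ the smallest $u$ with $ax_t+bu\ge D_L$, for all $(a,b)$ with $\|(a,b)-\hat\theta_s^{\mathrm{pre}}\|_\infty\le\epsilon_s$. **Events.** For $c>0$ let $E=E(c)$ be the event that $D_L\le a^*x_t+b^*u_t\le D_U$ and $|w_t|\le\log^2T$ for all $t<T$, and $\|\theta^*-\hat\theta^{\mathrm{pre}}_s\|_\infty\le\epsilon_s\le c\,\nu_T$ for all $0\le s\le s_e$. Let $G_i=(x_0,u_0,\dots,x_{i-1},u_{i-1})$ and, for $\gamma>0$, $$S'_t=\big\{\sqrt T\le i<t:\ u_i=u_i^{\mathrm{safeU}}\ \text{ and }\ \mathbb P(u_i=u_i^{\mathrm{safeU}}\mid G_i,E)\ge\gamma\big\}.$$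 **Claim.** There are constants $M_1,k_1$, depending only on the data fixed at the beginning, such that 1. $\mathbb P\big(\max_{0\le s\le s_e}\epsilon_s\le M_1\log^{k_1}(T)\,\nu_T\big)\ge 1-o_T(1/T^2)$; and 2. for all $M_2\ge M_1$, $k_2\ge k_1$ and every constant $\gamma>0$, if $E=E(c_T)$ with $c_T=M_2\log^{k_2}T$, then with probability $1-o_T(1/T)$ $$\max_{0\le s\le s_e}\epsilon_s\sqrt{|S'_{T_s}|}=\tilde O_T(1),$$ that is, there are $M,k$ such that $\mathbb P\big(\max_{s}\epsilon_s\sqrt{|S'_{T_s}|}\le M\log^kT\big)\ge1-o_T(1/T)$. Here $M,k$ and the $o_T$ rates depend only on the data fixed at the beginning and on $M_2,k_2,\gamma$: for all sufficiently large $T$ the bounds hold uniformly over all problems at horizon $T$ (in particular over $\theta^*$, $C^{\mathrm{init}}$, the boundaries and the baseline class). -/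

import Mathlib

open MeasureTheory ProbabilityTheory Filter Topology
open scoped ENNReal

universe v

namespace SafeLQR

noncomputable section

/-- The fixed (horizon independent, known) data: the cost weights `q, r`, the regularization
`lam`, the initial uncertainty set `[aLo, aHi] × [bLo, bHi]`, and the noise distribution `noise`
with its subgaussian parameter `alpha` and the bound `BP` on its density. -/
structure Spec where
  q : ℝ
  r : ℝ
  lam : ℝ
  aLo : ℝ
  aHi : ℝ
  bLo : ℝ
  bHi : ℝ
  alpha : ℝ
  BP : ℝ
  noise : Measure ℝ
  q_pos : 0 < q
  r_pos : 0 < r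
  lam_pos : 0 < lam
  aLo_pos : 0 < aLo
  aLo_le : aLo ≤ aHi
  bLo_pos : 0 < bLo
  bLo_le : bLo ≤ bHi
  alpha_pos : 0 < alpha
  prob : IsProbabilityMeasure noise
  mean_zero : ∫ x, x ∂noise = 0
  var_one : ∫ x, x ^ 2 ∂noise = 1
  subgaussian : ∀ g : ℝ, Integrable (fun x => Real.exp (g * x)) noise ∧
    ∫ x, Real.exp (g * x) ∂noise ≤ Real.exp (g ^ 2 * alpha ^ 2 / 2)
  bounded_density : ∃ f : ℝ → ℝ≥0∞, Measurable f ∧ (∀ x, f x ≤ ENNReal.ofReal BP) ∧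
    noise = volume.withDensity f

/-- The (generalized inverse) quantile function `F⁻¹` of a distribution on the line. -/
def quantile (μ : Measure ℝ) (p : ℝ) : ℝ := sInf {x : ℝ | p ≤ cdf μ x}

/-! ### Costs of stationary controllers -/

/-- Positions under dynamics `θ = (a, b)`, a stationary deterministic controller `C`, the starting
position `x0`, and the noise sequence `w`. -/
def pos (θ : ℝ × ℝ) (C : ℝ → ℝ) (x0 : ℝ) (w : ℕ → ℝ) : ℕ → ℝ
  | 0 => x0
  | t + 1 => θ.1 * pos θ C x0 w t + θ.2 * C (pos θ C x0 w t) + w t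

/-- The average cost `J(θ, C, t, x0, w)`. -/
def cost (S : Spec) (θ : ℝ × ℝ) (C : ℝ → ℝ) (t : ℕ) (x0 : ℝ) (w : ℕ → ℝ) : ℝ :=
  (1 / (t : ℝ)) * (S.q * pos θ C x0 w t ^ 2 +
    ∑ i ∈ Finset.range t, (S.q * pos θ C x0 w i ^ 2 + S.r * C (pos θ C x0 w i) ^ 2))

/-- The expected average cost `J*(θ, C, t)` from the starting position `0`, for i.i.d. noise. -/
def expectedCost (S : Spec) (θ : ℝ × ℝ) (C : ℝ → ℝ) (t : ℕ) : ℝ :=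
  haveI := S.prob
  ∫ w, cost S θ C t 0 w ∂(Measure.infinitePi (fun _ : ℕ => S.noise))

/-- The truncation of a controller `C` that makes it safe for the dynamics `θ = (a, b)` and the
boundaries `DL, DU`. -/
def truncate (DL DU : ℝ) (θ : ℝ × ℝ) (C : ℝ → ℝ) (x : ℝ) : ℝ :=
  if DU < θ.1 * x + θ.2 * C x then (DU - θ.1 * x) / θ.2
  else if θ.1 * x + θ.2 * C x < DL then (DL - θ.1 * x) / θ.2
  else C x

/-! ### Horizons -/

/-- The admissible horizons: `log₂ (T ^ (1/12))` is an integer. -/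
def Admissible (T : ℕ) : Prop := ∃ m : ℕ, T = 2 ^ (12 * m)

/-- `ν_T = T ^ (-1/4)`. -/
def nu (T : ℕ) : ℝ := (T : ℝ) ^ (-(1 / 4) : ℝ)

/-- The length `1 / ν_T² = √T` of the warm-up phase (an exact square root if `T` is admissible). -/
def warm (T : ℕ) : ℕ := Nat.sqrt T

/-- The number `log₂ (T ν_T²) = s_e + 1` of rounds (an exact logarithm if `T` is admissible). -/
def rounds (T : ℕ) : ℕ := Nat.log 2 (Nat.sqrt T)

/-- `T_s = 2 ^ s / ν_T²`, the starting time and the length of round `s`. -/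
def start (T s : ℕ) : ℕ := 2 ^ s * warm T

/-! ### The problem at horizon `T` -/

/-- A safe LQR problem at horizon `T`: the true dynamics, the boundaries, the initial controller,
and the baseline class. The baseline class for `θ` consists of the truncations of the controllers
`Ctil θ K` with `K ∈ [KL θ, KU θ]`, and `Kopt θ t` is an optimal parameter for horizon `t`. -/
structure Problem (S : Spec) (T : ℕ) where
  thetaStar : ℝ × ℝ
  DL : ℝ
  DU : ℝ
  Cinit : ℝ → ℝ
  Ctil : ℝ × ℝ → ℝ → ℝ → ℝ
  KL : ℝ × ℝ → ℝ
  KU : ℝ × ℝ → ℝ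
  Kopt : ℝ × ℝ → ℕ → ℝ
  a_mem : thetaStar.1 ∈ Set.Icc S.aLo S.aHi
  b_mem : thetaStar.2 ∈ Set.Icc S.bLo S.bHi
  DL_ge : -(Real.log T) ^ 2 ≤ DL
  DL_neg : DL < 0
  DU_pos : 0 < DU
  DU_le : DU ≤ (Real.log T) ^ 2
  gap : 1 / Real.log T ≤ DU - DL
  Cinit_meas : Measurable Cinit
  Cinit_safe : ∀ x : ℝ, DL + quantile S.noise (1 / (T : ℝ) ^ 4) ≤ x →
    x ≤ DU + quantile S.noise (1 - 1 / (T : ℝ) ^ 4) →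
    DL + thetaStar.2 / Real.log T ≤ thetaStar.1 * x + thetaStar.2 * Cinit x ∧
    thetaStar.1 * x + thetaStar.2 * Cinit x ≤ DU - thetaStar.2 / Real.log T
  Ctil_meas : ∀ θ K, Measurable (Ctil θ K)
  Kopt_meas : ∀ t : ℕ, Measurable (fun p : (ℝ × ℝ) × ℝ => Ctil p.1 (Kopt p.1 t) p.2)
  Kopt_mem : ∀ θ : ℝ × ℝ, 0 < θ.2 → ∀ t : ℕ, 1 ≤ t → t ≤ T → Kopt θ t ∈ Set.Icc (KL θ) (KU θ)
  Kopt_min : ∀ θ : ℝ × ℝ, 0 < θ.2 → ∀ t : ℕ, 1 ≤ t → t ≤ T → ∀ K ∈ Set.Icc (KL θ) (KU θ),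
    expectedCost S θ (truncate DL DU θ (Ctil θ (Kopt θ t))) t ≤
      expectedCost S θ (truncate DL DU θ (Ctil θ K)) t

variable {S : Spec} {T : ℕ}

/-- The controller `C_K^θ` of the baseline class. -/
def Problem.ctrl (p : Problem S T) (θ : ℝ × ℝ) (K : ℝ) : ℝ → ℝ :=
  truncate p.DL p.DU θ (p.Ctil θ K)

/-- `P(θ, K, z)`: the largest `x` with `a x + b C_K^θ(x) ≤ z`, in the extended reals. -/
def Problem.P (p : Problem S T) (θ : ℝ × ℝ) (K z : ℝ) : EReal :=
  sSup ((fun x : ℝ => (x : EReal)) '' {x : ℝ | θ.1 * x + θ.2 * p.ctrl θ K x ≤ z})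

/-! ### Regularized least squares (functions of the observed positions and controls) -/

/-- `Z_t`, with the rows `(x_i, u_i)`, `i < t`. -/
def Zmat (x u : ℕ → ℝ) (t : ℕ) : Matrix (Fin t) (Fin 2) ℝ :=
  Matrix.of fun i => ![x i, u i]

/-- `X_t = (x_1, …, x_t)`. -/
def Xvec (x : ℕ → ℝ) (t : ℕ) : Fin t → ℝ := fun i => x (i + 1)

/-- `V_t = λ I + ∑_{i < t} z_i z_iᵀ` with `z_i = (x_i, u_i)`. -/
def Vmat (S : Spec) (x u : ℕ → ℝ) (t : ℕ) : Matrix (Fin 2) (Fin 2) ℝ :=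
  S.lam • 1 + ∑ i ∈ Finset.range t, Matrix.vecMulVec ![x i, u i] ![x i, u i]

/-- The estimate `(Z_tᵀ Z_t + λ I)⁻¹ Z_tᵀ X_t`. -/
def thetaPre (S : Spec) (x u : ℕ → ℝ) (t : ℕ) : ℝ × ℝ :=
  let v : Fin 2 → ℝ := Matrix.mulVec
    (((Zmat x u t).transpose * Zmat x u t + S.lam • (1 : Matrix (Fin 2) (Fin 2) ℝ))⁻¹)
    (Matrix.mulVec (Zmat x u t).transpose (Xvec x t))
  (v 0, v 1)

/-- The confidence factor `B_t` (at horizon `T`). -/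
def Bconf (S : Spec) (T : ℕ) (x u : ℕ → ℝ) (t : ℕ) : ℝ :=
  S.alpha * Real.sqrt (Real.log (Vmat S x u t).det + Real.log (S.lam ^ 2) +
    2 * Real.log ((T : ℝ) ^ 2)) + Real.sqrt S.lam * (S.aHi ^ 2 + S.bHi ^ 2)

/-- The uncertainty radius; `ε_s` is its value at `t = T_s`. -/
def radius (S : Spec) (T : ℕ) (x u : ℕ → ℝ) (t : ℕ) : ℝ :=
  Bconf S T x u t * Real.sqrt (max (Vmat S x u t 1 1) (Vmat S x u t 0 0) /
    (Vmat S x u t 0 0 * Vmat S x u t 1 1 - (Vmat S x u t 0 1) ^ 2))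

/-- The uncertainty set `{θ : ‖θ - c‖_∞ ≤ e}` (the norm of `ℝ × ℝ` is the sup norm). -/
def box (c : ℝ × ℝ) (e : ℝ) : Set (ℝ × ℝ) := {θ | ‖θ - c‖ ≤ e}

/-- The largest control `u` with `max_{θ ∈ box c e} (a x + b u) ≤ DU`. -/
def safeU (DU : ℝ) (c : ℝ × ℝ) (e x : ℝ) : ℝ :=
  sSup {u : ℝ | ∀ θ ∈ box c e, θ.1 * x + θ.2 * u ≤ DU}

/-- The smallest control `u` with `min_{θ ∈ box c e} (a x + b u) ≥ DL`. -/
def safeL (DL : ℝ) (c : ℝ × ℝ) (e x : ℝ) : ℝ :=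
  sInf {u : ℝ | ∀ θ ∈ box c e, DL ≤ θ.1 * x + θ.2 * u}

/-! ### The algorithm -/

section Run

variable {Ω : Type*}

/-- `ε_s` along the trajectory `(x, u)`. -/
def eps (S : Spec) (T : ℕ) (x u : ℕ → Ω → ℝ) (s : ℕ) (ω : Ω) : ℝ :=
  radius S T (fun t => x t ω) (fun t => u t ω) (start T s)

/-- The estimate `θ̂_s^pre` along the trajectory `(x, u)`. -/
def est (S : Spec) (T : ℕ) (x u : ℕ → Ω → ℝ) (s : ℕ) (ω : Ω) : ℝ × ℝ :=
  thetaPre S (fun t => x t ω) (fun t => u t ω) (start T s)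

/-- The control `u_t^safeU` in round `s`. -/
def Problem.ctrlU (p : Problem S T) (x u : ℕ → Ω → ℝ) (s t : ℕ) (ω : Ω) : ℝ :=
  safeU p.DU (est S T x u s ω) (eps S T x u s ω) (x t ω)

/-- The control `u_t^safeL` in round `s`. -/
def Problem.ctrlL (p : Problem S T) (x u : ℕ → Ω → ℝ) (s t : ℕ) (ω : Ω) : ℝ :=
  safeL p.DL (est S T x u s ω) (eps S T x u s ω) (x t ω)

/-- The function of `θ'` that is minimized over `box c e` in the choice of `θ̂_s`. -/
def Problem.objective (p : Problem S T) (s : ℕ) (c : ℝ × ℝ) (e : ℝ) (θ' : ℝ × ℝ) : EReal :=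
  ⨅ θ ∈ box c e, p.P θ (p.Kopt θ' (start T s)) p.DU

/-- The σ-algebra generated by `G_i = (x_0, u_0, …, x_{i-1}, u_{i-1})`. -/
def sigmaG (x u : ℕ → Ω → ℝ) (i : ℕ) : MeasurableSpace Ω :=
  MeasurableSpace.comap (fun ω (j : Fin i) => (x j ω, u j ω)) inferInstance

/-- The σ-algebra generated by `H_i = (x_0, u_0, …, x_{i-1}, u_{i-1}, x_i)`. -/
def sigmaH (x u : ℕ → Ω → ℝ) (i : ℕ) : MeasurableSpace Ω :=
  sigmaG x u i ⊔ MeasurableSpace.comap (x i) inferInstance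

variable [MeasurableSpace Ω]

/-- `(x, u)` are the positions and controls of the algorithm (safe certainty equivalence with
warm-up length `√T`) on the problem `p`, driven by the noise `w` and the exploration signs `φ`;
`θhat s` is the estimate `θ̂_s` whose optimal controller is used in round `s`. -/
structure IsRun (p : Problem S T) (Pr : Measure Ω) (w φ x u : ℕ → Ω → ℝ)
    (θhat : ℕ → Ω → ℝ × ℝ) : Prop where
  w_meas : ∀ t, Measurable (w t)
  φ_meas : ∀ t, Measurable (φ t)
  w_law : ∀ t, Pr.map (w t) = S.noise
  φ_law : ∀ t, Pr.map (φ t) =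
    (1 / 2 : ℝ≥0∞) • Measure.dirac (1 : ℝ) + (1 / 2 : ℝ≥0∞) • Measure.dirac (-1 : ℝ)
  indep : iIndepFun (fun i : ℕ ⊕ ℕ => Sum.elim w φ i) Pr
  x_zero : ∀ ω, x 0 ω = 0
  x_succ : ∀ t < T, ∀ ω,
    x (t + 1) ω = p.thetaStar.1 * x t ω + p.thetaStar.2 * u t ω + w t ω
  warm_up : ∀ t < warm T, ∀ ω, u t ω = p.Cinit (x t ω) + φ t ω / Real.log T
  θhat_meas : ∀ s < rounds T, Measurable[sigmaH x u (start T s)] (θhat s)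
  θhat_mem : ∀ s < rounds T, ∀ ω, θhat s ω ∈ box (est S T x u s ω) (eps S T x u s ω)
  θhat_argmin : ∀ s < rounds T, ∀ ω, ∀ θ' ∈ box (est S T x u s ω) (eps S T x u s ω),
    p.objective s (est S T x u s ω) (eps S T x u s ω) (θhat s ω) ≤
      p.objective s (est S T x u s ω) (eps S T x u s ω) θ'
  exploit : ∀ s < rounds T, ∀ t, start T s ≤ t → t < 2 * start T s → ∀ ω,
    u t ω = max (min (p.ctrl (θhat s ω) (p.Kopt (θhat s ω) (start T s)) (x t ω))
      (p.ctrlU x u s t ω)) (p.ctrlL x u s t ω)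

/-! ### Events and the set `S'` -/

/-- All controls are safe. -/
def Problem.evSafe (p : Problem S T) (x u : ℕ → Ω → ℝ) : Set Ω :=
  {ω | ∀ t < T, p.DL ≤ p.thetaStar.1 * x t ω + p.thetaStar.2 * u t ω ∧
    p.thetaStar.1 * x t ω + p.thetaStar.2 * u t ω ≤ p.DU}

/-- All noise variables are at most `log² T` in magnitude. -/
def evNoise (T : ℕ) (w : ℕ → Ω → ℝ) : Set Ω :=
  {ω | ∀ t < T, |w t ω| ≤ (Real.log T) ^ 2}

/-- All estimates `θ̂_s^pre` are within `ε_s` of the true dynamics. -/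
def Problem.evEst (p : Problem S T) (x u : ℕ → Ω → ℝ) : Set Ω :=
  {ω | ∀ s < rounds T, ‖p.thetaStar - est S T x u s ω‖ ≤ eps S T x u s ω}

/-- `max_s ε_s ≤ c ν_T`. -/
def evEps (S : Spec) (T : ℕ) (x u : ℕ → Ω → ℝ) (c : ℝ) : Set Ω :=
  {ω | ∀ s < rounds T, eps S T x u s ω ≤ c * nu T}

/-- The event `E`, where `c` is the coefficient in the bound `max_s ε_s ≤ c ν_T`. -/
def Problem.evE (p : Problem S T) (w x u : ℕ → Ω → ℝ) (c : ℝ) : Set Ω :=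
  p.evSafe x u ∩ evNoise T w ∩ (p.evEst x u ∩ evEps S T x u c)

/-- The conditional probability `Pr(A | m, E) = Pr(A ∩ E | m) / Pr(E | m)`. -/
def condProb (Pr : Measure Ω) (m : MeasurableSpace Ω) (E A : Set Ω) (ω : Ω) : ℝ :=
  (Pr[(A ∩ E).indicator (fun _ => (1 : ℝ)) | m]) ω / (Pr[E.indicator (fun _ => (1 : ℝ)) | m]) ω

/-- The set `S'_t` of the times `i < t` (of the second phase, where `u_i^safeU` is defined) at
which the safety control `u_i^safeU` is used and, given `G_i` and `E`, had conditional probability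
at least `γ` of being used. -/
def Problem.sPrime (p : Problem S T) (Pr : Measure Ω) (w x u : ℕ → Ω → ℝ) (c γ : ℝ) (t : ℕ)
    (ω : Ω) : Set ℕ :=
  {i | i < t ∧ ∃ s < rounds T, start T s ≤ i ∧ i < 2 * start T s ∧
    u i ω = p.ctrlU x u s i ω ∧
    γ ≤ condProb Pr (sigmaG x u i) (p.evE w x u c) {ω' | u i ω' = p.ctrlU x u s i ω'} ω}

end Run

end

end SafeLQR

namespace SafeLQR

noncomputable section

/-! ### Safe controls for a box of dynamics -/

/-! Write `E` for T^(1/12) and `l` for log T, so that ν_T = E⁻³ and the warm-up has length E⁶. Both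
claims reduce to lower bounds on the quadratic form of V_t in all directions of the plane
(`Excited`). If this form is at least κ on the boundary of the unit square, then max(V¹¹, V²²)/det V
≤ 1/κ (`SqBound.ratio_le`). Since B_t ≤ `l` on trajectories of polylogarithmic size
(`Bconf_bounds`), the radius is then at most `l`/√κ.

First claim. The warm-up alone gives κ of order √T/polylog (`warm_excited`): directions with a
noticeable control component are excited by the random signs, and directions close to the x-axis by
the noise, whose bounded density keeps most positions away from 0. Later rounds only increase V.
Boundedness of the trajectory and accuracy of the estimates are proved together by induction over
the rounds (`traj_core`). Accuracy comes from exponential supermartingales in finitely many grid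
directions and a rounding argument (`sqrt_quad_error_le`).

Second claim. Every likely use of the safety control adds excitation in all directions. When u_i =
u_i^safeU, the point z_i lies on one of four lines determined by the uncertainty box, so for a
direction v the number v·z_i is affine in x_i, which contains the fresh noise w_{i-1}. If the slope
is not tiny, the bounded density makes |v·z_i| < k improbable; if it is tiny, the intercept is
bounded below by a multiple of D_U (`intercept_ge`). A suitable k = 1/polylog makes the bad
probability small compared with γ. Conditioning on the event E costs only a factor 2 in γ
(`likely_spec`), because P(E | G_i) ≥ 1/2 for all i with high probability
(`measureReal_exists_condExp_lt`). Supermartingale bounds then show that, up to logarithmic errors,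
most uses at likely times are good simultaneously for a net of about E directions. If G is the
number of these uses, V_{T_s} has size at least k²G/8 in every direction, while |S'_{T_s}| ≤ G +
`l`; hence ε_s√|S'_{T_s}| is polylogarithmic (`eps_mul_sqrt_le`). -/

theorem mem_box_iff (c : ℝ × ℝ) (e : ℝ) (θ : ℝ × ℝ) :
    θ ∈ box c e ↔ |θ.1 - c.1| ≤ e ∧ |θ.2 - c.2| ≤ e := by
  simp [box, Prod.norm_def, Real.norm_eq_abs]

/-- The maximum of a linear form over a sup-norm ball is its value at the center plus the radius
times the dual ℓ¹ norm, attained at the corner whose signs match those of `x` and `u`. -/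
theorem box_le_iff {e : ℝ} (he : 0 ≤ e) (c : ℝ × ℝ) (x u D : ℝ) :
    (∀ θ ∈ box c e, θ.1 * x + θ.2 * u ≤ D) ↔
      c.1 * x + c.2 * u + e * |x| + e * |u| ≤ D := by
  constructor
  · intro h
    have key : ∀ y : ℝ, ∃ σ : ℝ, |σ| ≤ 1 ∧ σ * y = |y| := fun y => by
      rcases abs_cases y with ⟨h, -⟩ | ⟨h, -⟩
      · exact ⟨1, by simp, by simp [h]⟩
      · exact ⟨-1, by simp, by simp [h]⟩
    obtain ⟨σ, hσ, hx⟩ := key x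
    obtain ⟨τ, hτ, hu⟩ := key u
    have := h (c.1 + e * σ, c.2 + e * τ) ((mem_box_iff _ _ _).2 (by
      simp only [add_sub_cancel_left, abs_mul, abs_of_nonneg he]
      exact ⟨mul_le_of_le_one_right he hσ, mul_le_of_le_one_right he hτ⟩))
    simp only at this
    rw [← hx, ← hu]
    linarith
  · intro h θ hθ
    obtain ⟨h1, h2⟩ := (mem_box_iff _ _ _).1 hθ
    have e1 : (θ.1 - c.1) * x ≤ e * |x| := (le_abs_self _).trans (by
      rw [abs_mul]; exact mul_le_mul_of_nonneg_right h1 (abs_nonneg _))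
    have e2 : (θ.2 - c.2) * u ≤ e * |u| := (le_abs_self _).trans (by
      rw [abs_mul]; exact mul_le_mul_of_nonneg_right h2 (abs_nonneg _))
    linarith

/-- An explicit formula for `safeU`. -/
def safeUform (D : ℝ) (c : ℝ × ℝ) (e x : ℝ) : ℝ :=
  if 0 < c.2 + e then
    if 0 ≤ D - c.1 * x - e * |x| then (D - c.1 * x - e * |x|) / (c.2 + e)
    else if 0 < c.2 - e then (D - c.1 * x - e * |x|) / (c.2 - e) else 0
  else 0

/-- Needed for measurability, so it covers degenerate boxes as well: there the admissible set is
empty or unbounded above, and the real `sSup` has the default value 0. -/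
theorem safeU_eq {e : ℝ} (he : 0 ≤ e) (D : ℝ) (c : ℝ × ℝ) (x : ℝ) :
    safeU D c e x = safeUform D c e x := by
  have hset : {u : ℝ | ∀ θ ∈ box c e, θ.1 * x + θ.2 * u ≤ D} =
      {u | c.2 * u + e * |u| ≤ D - c.1 * x - e * |x|} := by
    ext u
    simp only [Set.mem_ofPred_eq, box_le_iff he]
    constructor <;> intro h <;> linarith
  unfold safeU safeUform
  rw [hset]
  set k := D - c.1 * x - e * |x| with hk
  split_ifs with h1 h2 h3
  · refine IsLUB.csSup_eq (IsGreatest.isLUB ⟨?_, ?_⟩) ⟨k / (c.2 + e), ?_⟩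
    · have : 0 ≤ k / (c.2 + e) := by positivity
      simp only [Set.mem_ofPred_eq, abs_of_nonneg this]
      rw [← add_mul, mul_div_cancel₀ _ h1.ne']
    · intro u hu
      simp only [Set.mem_ofPred_eq] at hu
      rw [le_div_iff₀ h1]
      nlinarith [le_abs_self u]
    · have : 0 ≤ k / (c.2 + e) := by positivity
      simp only [Set.mem_ofPred_eq, abs_of_nonneg this]
      rw [← add_mul, mul_div_cancel₀ _ h1.ne']
  · push Not at h2
    have hneg : k / (c.2 - e) ≤ 0 := div_nonpos_of_nonpos_of_nonneg h2.le h3.le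
    have hmem : k / (c.2 - e) ∈ {u | c.2 * u + e * |u| ≤ k} := by
      simp only [Set.mem_ofPred_eq, abs_of_nonpos hneg]
      have : (c.2 - e) * (k / (c.2 - e)) = k := mul_div_cancel₀ _ h3.ne'
      linarith
    refine IsLUB.csSup_eq (IsGreatest.isLUB ⟨hmem, ?_⟩) ⟨_, hmem⟩
    intro u hu
    simp only [Set.mem_ofPred_eq] at hu
    rw [le_div_iff₀ h3]
    nlinarith [neg_abs_le u]
  · push Not at h2 h3
    rw [show {u : ℝ | c.2 * u + e * |u| ≤ k} = ∅ from ?_, Real.sSup_empty]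
    ext u
    simp only [Set.mem_ofPred_eq, Set.mem_empty_iff_false, iff_false, not_le]
    rcases le_total 0 u with hu | hu
    · rw [abs_of_nonneg hu]; nlinarith
    · rw [abs_of_nonpos hu]; nlinarith
  · push Not at h1
    rcases Set.eq_empty_or_nonempty {u : ℝ | c.2 * u + e * |u| ≤ k} with h0 | ⟨u, hu⟩
    · rw [h0, Real.sSup_empty]
    · simp only [Set.mem_ofPred_eq] at hu
      by_cases hneg : c.2 + e < 0
      · apply Real.sSup_of_not_bddAbove
        rintro ⟨M, hM⟩
        have hp : 0 < -(c.2 + e) := by linarith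
        have h5 : max (M + 1) (max 0 (k / (c.2 + e))) ≤ M := hM (by
          simp only [Set.mem_ofPred_eq]
          set z := max (M + 1) (max 0 (k / (c.2 + e)))
          have hz0 : 0 ≤ z := le_max_of_le_right (le_max_left _ _)
          have hz1 : k / (c.2 + e) ≤ z := le_max_of_le_right (le_max_right _ _)
          rw [abs_of_nonneg hz0]
          rw [div_le_iff_of_neg hneg] at hz1
          linarith)
        have := (le_max_left _ _).trans h5
        linarith
      · have h0 : c.2 + e = 0 := le_antisymm h1 (not_lt.1 hneg)
        have hk0 : 0 ≤ k := by
          have : c.2 = -e := by linarith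
          rw [this] at hu
          nlinarith [le_abs_self u]
        apply Real.sSup_of_not_bddAbove
        rintro ⟨M, hM⟩
        have h5 : max (M + 1) 0 ≤ M := hM (by
          simp only [Set.mem_ofPred_eq]
          rw [abs_of_nonneg (le_max_right _ _), ← add_mul, h0, zero_mul]
          exact hk0)
        have := (le_max_left _ _).trans h5
        linarith

theorem box_neg_iff (c : ℝ × ℝ) (e D x u : ℝ) :
    (∀ θ ∈ box c e, D ≤ θ.1 * x + θ.2 * u) ↔ ∀ θ ∈ box c e, θ.1 * (-x) + θ.2 * (-u) ≤ -D := by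
  refine forall₂_congr fun θ _ => ?_
  constructor <;> intro h <;> linarith

theorem safeL_eq (D : ℝ) (c : ℝ × ℝ) (e x : ℝ) : safeL D c e x = -safeU (-D) c e (-x) := by
  unfold safeL safeU
  rw [Real.sInf_def]
  congr 2
  ext u
  simp only [Set.mem_neg, Set.mem_ofPred_eq, box_neg_iff c e D, neg_neg]

/-- For `e < c.2` the map u ↦ c₂u + e|u| is a strictly increasing bijection of the line, so the
worst-case constraint is tight at the largest admissible control. -/
theorem safeU_spec {e : ℝ} (he : 0 ≤ e) {c : ℝ × ℝ} (hc : e < c.2) (D x : ℝ) :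
    c.1 * x + c.2 * safeU D c e x + e * |x| + e * |safeU D c e x| = D := by
  have h1 : 0 < c.2 + e := by linarith
  have h2 : 0 < c.2 - e := by linarith
  rw [safeU_eq he]
  unfold safeUform
  set k := D - c.1 * x - e * |x| with hk
  rw [if_pos h1]
  split_ifs with h3
  · have h4 : 0 ≤ k / (c.2 + e) := by positivity
    rw [abs_of_nonneg h4]
    have := mul_div_cancel₀ k h1.ne'
    linarith
  · push Not at h3
    have h4 : k / (c.2 - e) ≤ 0 := div_nonpos_of_nonpos_of_nonneg h3.le h2.le
    rw [abs_of_nonpos h4]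
    have := mul_div_cancel₀ k h2.ne'
    linarith

theorem safeL_spec {e : ℝ} (he : 0 ≤ e) {c : ℝ × ℝ} (hc : e < c.2) (D x : ℝ) :
    c.1 * x + c.2 * safeL D c e x - e * |x| - e * |safeL D c e x| = D := by
  have := safeU_spec he hc (-D) (-x)
  rw [safeL_eq, abs_neg]
  rw [abs_neg] at this
  linarith

theorem le_of_le_safeU {e : ℝ} (he : 0 ≤ e) {c : ℝ × ℝ} (hc : e < c.2) {D x u : ℝ}
    (hu : u ≤ safeU D c e x) {θ : ℝ × ℝ} (hθ : θ ∈ box c e) : θ.1 * x + θ.2 * u ≤ D := by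
  have h1 := (box_le_iff he c x (safeU D c e x) D).2 (safeU_spec he hc D x).le θ hθ
  have h2 : 0 ≤ θ.2 := by
    have := (abs_le.1 ((mem_box_iff _ _ _).1 hθ).2).1
    linarith
  nlinarith

theorem ge_of_safeL_le {e : ℝ} (he : 0 ≤ e) {c : ℝ × ℝ} (hc : e < c.2) {D x u : ℝ}
    (hu : safeL D c e x ≤ u) {θ : ℝ × ℝ} (hθ : θ ∈ box c e) : D ≤ θ.1 * x + θ.2 * u := by
  rw [safeL_eq] at hu
  have := le_of_le_safeU he hc (D := -D) (x := -x) (u := -u) (by linarith) hθ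
  linarith

theorem abs_safeU_le {e : ℝ} (he : 0 ≤ e) {c : ℝ × ℝ} (hc : e < c.2) (D x : ℝ) :
    |safeU D c e x| * (c.2 - e) ≤ |D| + (|c.1| + e) * |x| := by
  have h := safeU_spec he hc D x
  set s := safeU D c e x
  have h1 : c.2 * s + e * |s| = D - c.1 * x - e * |x| := by linarith
  have h2 : |(c.2 * s + e * |s|)| ≤ |D| + (|c.1| + e) * |x| := by
    rw [h1]
    calc |(D - c.1 * x - e * |x|)| ≤ |D| + |c.1 * x| + |(e * |x|)| :=
          (abs_sub _ _).trans (add_le_add_left (abs_sub _ _) _)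
      _ = _ := by rw [abs_mul, abs_mul, abs_abs, abs_of_nonneg he]; ring
  refine le_trans ?_ h2
  rcases abs_cases s with ⟨h3, h4⟩ | ⟨h3, h4⟩
  · rw [h3]; refine le_trans ?_ (le_abs_self _); nlinarith
  · rw [h3]; refine le_trans ?_ (neg_le_abs _); nlinarith

/-- Without this the outer maximum in the algorithm could push the control above its upper limit. If
the two controls crossed, the difference of their tight constraints would bound the gap `DU - DL` by
a multiple of `e`. -/
theorem safeL_le_safeU {e : ℝ} (he : 0 ≤ e) {c : ℝ × ℝ} (hc : e < c.2) {DL DU x : ℝ}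
    (h : e * (2 * |x| * (c.2 - e) + |DL| + |DU| + 2 * (|c.1| + e) * |x|) <
      (DU - DL) * (c.2 - e)) : safeL DL c e x ≤ safeU DU c e x := by
  by_contra hlt
  push Not at hlt
  have h1 := safeU_spec he hc DU x
  have h2 := safeL_spec he hc DL x
  have b1 := abs_safeU_le he hc DU x
  have b2 : |safeL DL c e x| * (c.2 - e) ≤ |DL| + (|c.1| + e) * |x| := by
    have := abs_safeU_le he hc (-DL) (-x)
    rwa [abs_neg, abs_neg, ← abs_neg (safeU _ _ _ _), ← safeL_eq] at this
  set s := safeU DU c e x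
  set r := safeL DL c e x
  have hd : 0 < c.2 - e := by linarith
  have h3 : DU - DL ≤ 2 * e * |x| + e * |r| + e * |s| := by
    have : 0 ≤ c.2 * (r - s) := mul_nonneg (by linarith) (by linarith)
    linarith
  have h4 := mul_le_mul_of_nonneg_right h3 hd.le
  have h5 := mul_le_mul_of_nonneg_left b1 he
  have h6 := mul_le_mul_of_nonneg_left b2 he
  linarith

/-- The signs of x and of the control select the corner of the box where the constraint is tight;
each of the four corners gives one line. -/
theorem safeU_branch {e : ℝ} (he : 0 ≤ e) {c : ℝ × ℝ} (hc : e < c.2) (D x : ℝ) :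
    ∃ σ τ : Bool, (c.1 + (if σ then e else -e)) * x +
      (c.2 + (if τ then e else -e)) * safeU D c e x = D := by
  have h := safeU_spec he hc D x
  refine ⟨decide (0 ≤ x), decide (0 ≤ safeU D c e x), ?_⟩
  simp only [decide_eq_true_eq]
  rcases le_or_gt 0 x with h1 | h1 <;> rcases le_or_gt 0 (safeU D c e x) with h2 | h2
  · rw [abs_of_nonneg h1, abs_of_nonneg h2] at h; simp only [h1, h2, if_true]; linarith
  · rw [abs_of_nonneg h1, abs_of_neg h2] at h
    simp only [h1, h2.not_ge, if_true, if_false]; linarith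
  · rw [abs_of_neg h1, abs_of_nonneg h2] at h
    simp only [h1.not_ge, h2, if_true, if_false]; linarith
  · rw [abs_of_neg h1, abs_of_neg h2] at h
    simp only [h1.not_ge, h2.not_ge, if_false]; linarith

/-! ### Two-dimensional quadratic forms -/

/-- The quadratic form with matrix `[[p, q], [q, r]]`. -/
def quad (p q r a b : ℝ) : ℝ := p * a ^ 2 + 2 * q * (a * b) + r * b ^ 2

/-- The quadratic form is at least `κ` on the boundary of the unit square. -/
def SqBound (p q r κ : ℝ) : Prop := ∀ c : ℝ, |c| ≤ 1 → κ ≤ quad p q r 1 c ∧ κ ≤ quad p q r c 1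

/-- Let b be the larger diagonal entry and a the other one. Evaluating the form at the minimizer
-q/b, which lies in [-1, 1], gives the Schur complement a - q²/b ≥ κ. The square is used instead of
the circle because the radius contains exactly max(V¹¹, V²²)/det V. -/
theorem SqBound.facts {p q r κ : ℝ} (hκ : 0 < κ) (h : SqBound p q r κ) :
    κ ≤ p ∧ κ ≤ r ∧ κ * max r p ≤ p * r - q ^ 2 := by
  have h0 := h 0 (by simp)
  simp only [quad] at h0
  have hp : κ ≤ p := by linarith [h0.1]
  have hr : κ ≤ r := by linarith [h0.2]
  refine ⟨hp, hr, ?_⟩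
  -- `det` is nonnegative, since the form is positive at `±1`
  have key : ∀ a b : ℝ, 0 < a → a ≤ b → (∀ c, |c| ≤ 1 → κ ≤ a + 2 * q * c + b * c ^ 2) →
      κ * b ≤ a * b - q ^ 2 := by
    intro a b ha hab hc
    have hb : 0 < b := by linarith
    -- If |q| > b, the form would be negative at one of c = ±1; hence the minimizer is admissible.
    have hq : |q| ≤ b := by
      by_contra hq
      push Not at hq
      rcases le_total 0 q with h1 | h1
      · rw [abs_of_nonneg h1] at hq
        have := hc (-1) (by simp)
        nlinarith
      · rw [abs_of_nonpos h1] at hq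
        have := hc 1 (by simp)
        nlinarith
    have h1 := hc (-(q / b)) (by rw [abs_neg, abs_div, abs_of_pos hb]; exact div_le_one_of_le₀ hq hb.le)
    have h2 : a + 2 * q * (-(q / b)) + b * (-(q / b)) ^ 2 = a - q ^ 2 / b := by
      field_simp; ring
    rw [h2] at h1
    have h3 := mul_le_mul_of_nonneg_right h1 hb.le
    rw [sub_mul, div_mul_cancel₀ _ hb.ne'] at h3
    exact h3
  rcases le_total p r with hpr | hpr
  · rw [max_eq_left hpr]
    exact key p r (by linarith) hpr (fun c hc => by
      have := (h c hc).1; simp only [quad] at this; linarith)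
  · rw [max_eq_right hpr]
    have := key r p (by linarith) hpr (fun c hc => by
      have := (h c hc).2; simp only [quad] at this; linarith)
    linarith

theorem SqBound.det_pos {p q r κ : ℝ} (hκ : 0 < κ) (h : SqBound p q r κ) :
    κ ^ 2 ≤ p * r - q ^ 2 := by
  obtain ⟨h1, -, h3⟩ := h.facts hκ
  have := (le_max_right r p)
  nlinarith

theorem SqBound.ratio_le {p q r κ : ℝ} (hκ : 0 < κ) (h : SqBound p q r κ) :
    max r p / (p * r - q ^ 2) ≤ 1 / κ := by
  obtain ⟨h1, -, h3⟩ := h.facts hκ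
  have := h.det_pos hκ
  rw [div_le_div_iff₀ (by nlinarith [pow_pos hκ 2]) hκ]
  linarith

theorem SqBound.mono {p q r κ κ' : ℝ} (hκ : κ' ≤ κ) (h : SqBound p q r κ) : SqBound p q r κ' :=
  fun c hc => ⟨hκ.trans (h c hc).1, hκ.trans (h c hc).2⟩

theorem quad_nonneg {p q r : ℝ} (hp : 0 < p) (hd : 0 < p * r - q ^ 2) (a b : ℝ) :
    0 ≤ quad p q r a b := by
  have : p * quad p q r a b = (p * a + q * b) ^ 2 + (p * r - q ^ 2) * b ^ 2 := by
    unfold quad; ring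
  have h : 0 ≤ p * quad p q r a b := by rw [this]; positivity
  exact nonneg_of_mul_nonneg_right h hp

/-- Completing the square in either variable. This turns a bound in the V-norm into a sup-norm bound
with precisely the factor that appears in the radius. -/
theorem sq_le_quad {p q r : ℝ} (hp : 0 < p) (hd : 0 < p * r - q ^ 2) (a b : ℝ) :
    max |a| |b| ≤ Real.sqrt (quad p q r a b) * Real.sqrt (max r p / (p * r - q ^ 2)) := by
  rw [← Real.sqrt_mul (quad_nonneg hp hd a b)]
  have e1 : p * quad p q r a b = (p * a + q * b) ^ 2 + (p * r - q ^ 2) * b ^ 2 := by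
    unfold quad; ring
  have e2 : r * quad p q r a b = (r * b + q * a) ^ 2 + (p * r - q ^ 2) * a ^ 2 := by
    unfold quad; ring
  have hQ := quad_nonneg hp hd a b
  refine max_le (Real.abs_le_sqrt ?_) (Real.abs_le_sqrt ?_) <;> rw [← mul_div_assoc, le_div_iff₀ hd]
  · have := mul_le_mul_of_nonneg_left (le_max_left r p) hQ
    nlinarith [sq_nonneg (r * b + q * a)]
  · have := mul_le_mul_of_nonneg_left (le_max_right r p) hQ
    nlinarith [sq_nonneg (p * a + q * b)]

/-- The bilinear form with matrix `[[p, q], [q, r]]`. -/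
def bil (p q r a b c d : ℝ) : ℝ := p * (a * c) + q * (a * d + b * c) + r * (b * d)

/-- Cauchy–Schwarz for the form, from Lagrange's identity. -/
theorem bil_le {p q r : ℝ} (hp : 0 < p) (hd : 0 < p * r - q ^ 2) (a b c d : ℝ) :
    |bil p q r a b c d| ≤ Real.sqrt (quad p q r a b) * Real.sqrt (quad p q r c d) := by
  rw [← Real.sqrt_mul (quad_nonneg hp hd a b)]
  refine Real.abs_le_sqrt ?_
  have : quad p q r a b * quad p q r c d - bil p q r a b c d ^ 2 =
      (p * r - q ^ 2) * (a * d - b * c) ^ 2 := by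
    unfold quad bil; ring
  nlinarith [mul_nonneg hd.le (sq_nonneg (a * d - b * c))]

/-! ### The entries of `V_t` and the normal equations -/

theorem Vmat_apply_zero_zero (S : Spec) (x u : ℕ → ℝ) (t : ℕ) :
    Vmat S x u t 0 0 = S.lam + ∑ i ∈ Finset.range t, x i ^ 2 := by
  simp [Vmat, Matrix.add_apply, Matrix.sum_apply, pow_two]

theorem Vmat_apply_one_one (S : Spec) (x u : ℕ → ℝ) (t : ℕ) :
    Vmat S x u t 1 1 = S.lam + ∑ i ∈ Finset.range t, u i ^ 2 := by
  simp [Vmat, Matrix.add_apply, Matrix.sum_apply, pow_two]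

theorem Vmat_apply_zero_one (S : Spec) (x u : ℕ → ℝ) (t : ℕ) :
    Vmat S x u t 0 1 = ∑ i ∈ Finset.range t, x i * u i := by
  simp [Vmat, Matrix.add_apply, Matrix.sum_apply]

theorem Vmat_apply_one_zero (S : Spec) (x u : ℕ → ℝ) (t : ℕ) :
    Vmat S x u t 1 0 = ∑ i ∈ Finset.range t, x i * u i := by
  simp [Vmat, Matrix.add_apply, Matrix.sum_apply, mul_comm]

/-- `∑_{i < t} (a x_i + b u_i)²`. -/
def qf (x u : ℕ → ℝ) (t : ℕ) (a b : ℝ) : ℝ := ∑ i ∈ Finset.range t, (a * x i + b * u i) ^ 2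

theorem qf_nonneg (x u : ℕ → ℝ) (t : ℕ) (a b : ℝ) : 0 ≤ qf x u t a b :=
  Finset.sum_nonneg fun _ _ => sq_nonneg _

theorem qf_mono (x u : ℕ → ℝ) {s t : ℕ} (h : s ≤ t) (a b : ℝ) : qf x u s a b ≤ qf x u t a b :=
  Finset.sum_le_sum_of_subset_of_nonneg (Finset.range_mono h) fun _ _ _ => sq_nonneg _

/-- The quadratic form of `V_t`. -/
def Vq (S : Spec) (x u : ℕ → ℝ) (t : ℕ) (a b : ℝ) : ℝ :=
  quad (Vmat S x u t 0 0) (Vmat S x u t 0 1) (Vmat S x u t 1 1) a b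

theorem Vq_eq (S : Spec) (x u : ℕ → ℝ) (t : ℕ) (a b : ℝ) :
    Vq S x u t a b = S.lam * (a ^ 2 + b ^ 2) + qf x u t a b := by
  have : qf x u t a b = a ^ 2 * ∑ i ∈ Finset.range t, x i ^ 2 +
      2 * (a * b) * ∑ i ∈ Finset.range t, x i * u i + b ^ 2 * ∑ i ∈ Finset.range t, u i ^ 2 := by
    unfold qf
    rw [Finset.mul_sum, Finset.mul_sum, Finset.mul_sum, ← Finset.sum_add_distrib,
      ← Finset.sum_add_distrib]
    exact Finset.sum_congr rfl fun i _ => by ring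
  rw [this, Vq, quad, Vmat_apply_zero_zero, Vmat_apply_zero_one, Vmat_apply_one_one]
  ring

theorem Vmat_det (S : Spec) (x u : ℕ → ℝ) (t : ℕ) :
    (Vmat S x u t).det = Vmat S x u t 0 0 * Vmat S x u t 1 1 - Vmat S x u t 0 1 ^ 2 := by
  rw [Matrix.det_fin_two, Vmat_apply_one_zero, ← Vmat_apply_zero_one S]; ring

theorem Vmat_zero_zero_pos (S : Spec) (x u : ℕ → ℝ) (t : ℕ) : 0 < Vmat S x u t 0 0 := by
  rw [Vmat_apply_zero_zero]
  have := Finset.sum_nonneg fun i (_ : i ∈ Finset.range t) => sq_nonneg (x i)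
  linarith [S.lam_pos]

theorem Vmat_one_one_pos (S : Spec) (x u : ℕ → ℝ) (t : ℕ) : 0 < Vmat S x u t 1 1 := by
  rw [Vmat_apply_one_one]
  have := Finset.sum_nonneg fun i (_ : i ∈ Finset.range t) => sq_nonneg (u i)
  linarith [S.lam_pos]

theorem Vmat_det_pos (S : Spec) (x u : ℕ → ℝ) (t : ℕ) :
    0 < Vmat S x u t 0 0 * Vmat S x u t 1 1 - Vmat S x u t 0 1 ^ 2 := by
  rw [Vmat_apply_zero_zero, Vmat_apply_zero_one, Vmat_apply_one_one]
  have h1 := Finset.sum_mul_sq_le_sq_mul_sq (Finset.range t) x u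
  have h2 := Finset.sum_nonneg fun i (_ : i ∈ Finset.range t) => sq_nonneg (x i)
  have h3 := Finset.sum_nonneg fun i (_ : i ∈ Finset.range t) => sq_nonneg (u i)
  have := S.lam_pos
  nlinarith [mul_pos this this, mul_nonneg this.le h2, mul_nonneg this.le h3]

theorem Zmat_gram (S : Spec) (x u : ℕ → ℝ) (t : ℕ) :
    (Zmat x u t).transpose * Zmat x u t + S.lam • (1 : Matrix (Fin 2) (Fin 2) ℝ) =
      Vmat S x u t := by
  ext i j
  fin_cases i <;> fin_cases j <;>
  simp [Vmat, Zmat, Matrix.add_apply, Matrix.mul_apply, Matrix.sum_apply,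
    Finset.sum_range, add_comm]

theorem thetaPre_normal (S : Spec) (x u : ℕ → ℝ) (t : ℕ) :
    Vmat S x u t 0 0 * (thetaPre S x u t).1 + Vmat S x u t 0 1 * (thetaPre S x u t).2 =
      ∑ i ∈ Finset.range t, x i * x (i + 1) ∧
    Vmat S x u t 0 1 * (thetaPre S x u t).1 + Vmat S x u t 1 1 * (thetaPre S x u t).2 =
      ∑ i ∈ Finset.range t, u i * x (i + 1) := by
  set v : Fin 2 → ℝ := Matrix.mulVec ((Vmat S x u t)⁻¹)
    (Matrix.mulVec (Zmat x u t).transpose (Xvec x t)) with hv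
  have hth : thetaPre S x u t = (v 0, v 1) := by
    unfold thetaPre
    simp only [Zmat_gram, hv]
  have hdet : IsUnit (Vmat S x u t).det := by
    rw [isUnit_iff_ne_zero, Vmat_det]
    exact (Vmat_det_pos S x u t).ne'
  have hmul : Matrix.mulVec (Vmat S x u t) v =
      Matrix.mulVec (Zmat x u t).transpose (Xvec x t) := by
    rw [hv, Matrix.mulVec_mulVec, Matrix.mul_nonsing_inv _ hdet, Matrix.one_mulVec]
  have h0 := congrFun hmul 0
  have h1 := congrFun hmul 1
  simp only [Matrix.mulVec, dotProduct, Fin.sum_univ_two, Matrix.transpose_apply, Zmat,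
    Matrix.of_apply, Xvec, Matrix.cons_val_zero, Matrix.cons_val_one] at h0 h1
  rw [hth, Finset.sum_range, Finset.sum_range]
  refine ⟨h0, ?_⟩
  rw [Vmat_apply_zero_one, ← Vmat_apply_one_zero S]
  exact h1

/-- Cramer's rule; the explicit fractions make measurability of the estimate evident. -/
theorem thetaPre_eq (S : Spec) (x u : ℕ → ℝ) (t : ℕ) :
    thetaPre S x u t =
      ((Vmat S x u t 1 1 * ∑ i ∈ Finset.range t, x i * x (i + 1) -
          Vmat S x u t 0 1 * ∑ i ∈ Finset.range t, u i * x (i + 1)) /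
        (Vmat S x u t 0 0 * Vmat S x u t 1 1 - Vmat S x u t 0 1 ^ 2),
       (Vmat S x u t 0 0 * ∑ i ∈ Finset.range t, u i * x (i + 1) -
          Vmat S x u t 0 1 * ∑ i ∈ Finset.range t, x i * x (i + 1)) /
        (Vmat S x u t 0 0 * Vmat S x u t 1 1 - Vmat S x u t 0 1 ^ 2)) := by
  obtain ⟨h1, h2⟩ := thetaPre_normal S x u t
  have hd := (Vmat_det_pos S x u t).ne'
  rw [← h1, ← h2]
  refine Prod.ext ?_ ?_ <;> simp only <;> rw [eq_div_iff hd] <;> ring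

/-- The error d satisfies V d = ∑ z_i w_i - λθ, the noise term being the one controlled by
martingale bounds. -/
theorem thetaPre_sub_normal (S : Spec) {x u w : ℕ → ℝ} {t : ℕ} {θ : ℝ × ℝ}
    (hx : ∀ i < t, x (i + 1) = θ.1 * x i + θ.2 * u i + w i) :
    Vmat S x u t 0 0 * (thetaPre S x u t - θ).1 + Vmat S x u t 0 1 * (thetaPre S x u t - θ).2 =
      ∑ i ∈ Finset.range t, x i * w i - S.lam * θ.1 ∧
    Vmat S x u t 0 1 * (thetaPre S x u t - θ).1 + Vmat S x u t 1 1 * (thetaPre S x u t - θ).2 =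
      ∑ i ∈ Finset.range t, u i * w i - S.lam * θ.2 := by
  obtain ⟨h1, h2⟩ := thetaPre_normal S x u t
  have e1 : ∑ i ∈ Finset.range t, x i * x (i + 1) =
      θ.1 * ∑ i ∈ Finset.range t, x i ^ 2 + θ.2 * ∑ i ∈ Finset.range t, x i * u i +
        ∑ i ∈ Finset.range t, x i * w i := by
    rw [Finset.mul_sum, Finset.mul_sum, ← Finset.sum_add_distrib, ← Finset.sum_add_distrib]
    refine Finset.sum_congr rfl fun i hi => ?_
    rw [hx i (Finset.mem_range.1 hi)]; ring
  have e2 : ∑ i ∈ Finset.range t, u i * x (i + 1) =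
      θ.1 * ∑ i ∈ Finset.range t, x i * u i + θ.2 * ∑ i ∈ Finset.range t, u i ^ 2 +
        ∑ i ∈ Finset.range t, u i * w i := by
    rw [Finset.mul_sum, Finset.mul_sum, ← Finset.sum_add_distrib, ← Finset.sum_add_distrib]
    refine Finset.sum_congr rfl fun i hi => ?_
    rw [hx i (Finset.mem_range.1 hi)]; ring
  have e3 := Vmat_apply_zero_zero S x u t
  have e4 := Vmat_apply_zero_one S x u t
  have e5 := Vmat_apply_one_one S x u t
  simp only [Prod.fst_sub, Prod.snd_sub]
  constructor
  · rw [e1, ← e4] at h1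
    have : ∑ i ∈ Finset.range t, x i ^ 2 = Vmat S x u t 0 0 - S.lam := by linarith
    rw [this] at h1
    linarith
  · rw [e2, ← e4] at h2
    have : ∑ i ∈ Finset.range t, u i ^ 2 = Vmat S x u t 1 1 - S.lam := by linarith
    rw [this] at h2
    linarith

/-! ### From finitely many directions to the self-normalized error -/

-- Rescale the error d to a vector v of V-length y and round v to a grid point g at V-distance at
-- most 1. By the normal equations, the grid inequality at g bounds ⟨g, d⟩_V up to the
-- regularization term, while ⟨g, d⟩_V ≥ (y - 1)‖d‖_V. Finitely many deterministic directions thus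
-- control the self-normalized error, although d itself is random.
set_option maxHeartbeats 400000 in
theorem sqrt_quad_error_le {p q r lam α y h τ d₁ d₂ θ₁ θ₂ S₁ S₂ : ℝ} {R : ℕ}
    (hn₁ : p * d₁ + q * d₂ = S₁ - lam * θ₁) (hn₂ : q * d₁ + r * d₂ = S₂ - lam * θ₂)
    (hlam : 0 < lam) (hp : 0 < p) (hr : 0 < r) (hd : 0 < p * r - q ^ 2)
    (hV : ∀ a b, lam * (a ^ 2 + b ^ 2) ≤ quad p q r a b)
    (hτ0 : 0 ≤ τ) (hτ : lam * (θ₁ ^ 2 + θ₂ ^ 2) ≤ τ ^ 2) (hy : 2 ≤ y) (hh : 0 < h)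
    (hspace : h ^ 2 * (2 * (p + r)) ≤ 1)
    (hrange : y * Real.sqrt (max r p / (p * r - q ^ 2)) ≤ R * h)
    (hgrid : ∀ i j : ℤ, |i| ≤ R → |j| ≤ R →
      (i * h) * S₁ + (j * h) * S₂ - α ^ 2 / 2 * quad p q r (i * h) (j * h) ≤ α ^ 2 * y ^ 2 / 2) :
    Real.sqrt (quad p q r d₁ d₂) ≤ α ^ 2 * y + 5 * α ^ 2 + 3 * τ := by
  set n := Real.sqrt (quad p q r d₁ d₂) with hn
  have hn0 : 0 ≤ n := Real.sqrt_nonneg _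
  rcases hn0.eq_or_lt with h0 | hnpos
  · rw [← h0]; positivity
  have hnsq : n ^ 2 = quad p q r d₁ d₂ := Real.sq_sqrt (quad_nonneg hp hd _ _)
  set v₁ := y / n * d₁ with hv₁
  set v₂ := y / n * d₂ with hv₂
  have hyn : 0 < y / n := by positivity
  have hmax := sq_le_quad hp hd d₁ d₂
  rw [← hn] at hmax
  have hRh : ∀ d, |d| ≤ max |d₁| |d₂| → |y / n * d| ≤ R * h := fun d hd' => by
    rw [abs_mul, abs_of_pos hyn]
    calc y / n * |d| ≤ y / n * (n * Real.sqrt (max r p / (p * r - q ^ 2))) :=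
          mul_le_mul_of_nonneg_left (hd'.trans hmax) hyn.le
      _ = y * Real.sqrt (max r p / (p * r - q ^ 2)) := by field_simp
      _ ≤ _ := hrange
  have hfl : ∀ z : ℝ, |z| ≤ R * h → |⌊z / h⌋| ≤ (R : ℤ) ∧ |⌊z / h⌋ * h - z| ≤ h := by
    intro z hz
    obtain ⟨z1, z2⟩ := abs_le.1 hz
    have e : z / h * h = z := div_mul_cancel₀ z hh.ne'
    refine ⟨abs_le.2 ⟨Int.le_floor.2 ?_, ?_⟩, abs_le.2 ⟨?_, ?_⟩⟩
    · push_cast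
      rw [le_div_iff₀ hh]; linarith
    · have : (⌊z / h⌋ : ℝ) ≤ R := (Int.floor_le _).trans (by rw [div_le_iff₀ hh]; exact z2)
      exact_mod_cast this
    · have := Int.lt_floor_add_one (z / h)
      nlinarith
    · have := Int.floor_le (z / h)
      nlinarith
  obtain ⟨hi, hδ₁⟩ := hfl v₁ (hRh d₁ (le_max_left _ _))
  obtain ⟨hj, hδ₂⟩ := hfl v₂ (hRh d₂ (le_max_right _ _))
  have hg := hgrid _ _ hi hj
  set a := (⌊v₁ / h⌋ : ℝ) * h with ha
  set b := (⌊v₂ / h⌋ : ℝ) * h with hb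
  have hq : |2 * q| ≤ p + r := by
    refine abs_le_of_sq_le_sq ?_ (by linarith)
    nlinarith [sq_nonneg (p - r)]
  -- Each coordinate is moved by at most h, and `hspace` makes h² small compared with the trace of
  -- V.
  have hδ : Real.sqrt (quad p q r (a - v₁) (b - v₂)) ≤ 1 := by
    rw [Real.sqrt_le_iff]
    refine ⟨zero_le_one, le_trans ?_ (hspace.trans (by norm_num))⟩
    have s1 : (a - v₁) ^ 2 ≤ h ^ 2 := sq_le_sq' (by linarith [(abs_le.1 hδ₁).1]) (abs_le.1 hδ₁).2
    have s2 : (b - v₂) ^ 2 ≤ h ^ 2 := sq_le_sq' (by linarith [(abs_le.1 hδ₂).1]) (abs_le.1 hδ₂).2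
    have s3 : |(a - v₁) * (b - v₂)| ≤ h ^ 2 := by
      rw [abs_mul, pow_two]; exact mul_le_mul hδ₁ hδ₂ (abs_nonneg _) hh.le
    have s4 : 2 * q * ((a - v₁) * (b - v₂)) ≤ (p + r) * h ^ 2 := (le_abs_self _).trans (by
      rw [abs_mul]; exact mul_le_mul hq s3 (abs_nonneg _) (by linarith))
    have s5 := mul_le_mul_of_nonneg_left s1 hp.le
    have s6 := mul_le_mul_of_nonneg_left s2 hr.le
    unfold quad
    linarith
  have hvn : quad p q r v₁ v₂ = y ^ 2 := by
    have : quad p q r v₁ v₂ = (y / n) ^ 2 * quad p q r d₁ d₂ := by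
      rw [hv₁, hv₂]; unfold quad; ring
    rw [this, ← hnsq]; field_simp
  have hvs : Real.sqrt (quad p q r v₁ v₂) = y := by
    rw [hvn, Real.sqrt_sq (by linarith)]
  have hquad : quad p q r a b ≤ (y + 1) ^ 2 := by
    have h1 : quad p q r a b = quad p q r v₁ v₂ + 2 * bil p q r v₁ v₂ (a - v₁) (b - v₂) +
        quad p q r (a - v₁) (b - v₂) := by unfold quad bil; ring
    have h2 := (abs_le.1 (bil_le hp hd v₁ v₂ (a - v₁) (b - v₂))).2
    rw [hvs] at h2
    have h3 : quad p q r (a - v₁) (b - v₂) ≤ 1 := by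
      simpa using (Real.sqrt_le_iff.1 hδ).2
    have h4 := h2.trans (mul_le_of_le_one_right (by linarith) hδ)
    rw [h1, hvn]
    linarith
  have hbil : (y - 1) * n ≤ bil p q r a b d₁ d₂ := by
    have h1 : bil p q r a b d₁ d₂ = y / n * quad p q r d₁ d₂ +
        bil p q r (a - v₁) (b - v₂) d₁ d₂ := by
      rw [hv₁, hv₂]; unfold quad bil; ring
    have h2 := (abs_le.1 (bil_le hp hd (a - v₁) (b - v₂) d₁ d₂)).1
    rw [← hn] at h2
    have h3 : y / n * quad p q r d₁ d₂ = y * n := by rw [← hnsq]; field_simp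
    have h4 := mul_le_of_le_one_left hn0 hδ
    rw [h1, h3]
    linarith
  have hθ : -((y + 1) * τ) ≤ lam * (a * θ₁ + b * θ₂) := by
    refine (abs_le.1 (abs_le_of_sq_le_sq ?_
      (mul_nonneg (by linarith) hτ0))).1
    have h1 : (a * θ₁ + b * θ₂) ^ 2 ≤ (a ^ 2 + b ^ 2) * (θ₁ ^ 2 + θ₂ ^ 2) := by
      have := sq_nonneg (a * θ₂ - b * θ₁)
      linarith
    calc (lam * (a * θ₁ + b * θ₂)) ^ 2 ≤ (lam * (a ^ 2 + b ^ 2)) * (lam * (θ₁ ^ 2 + θ₂ ^ 2)) := by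
          have := mul_le_mul_of_nonneg_left h1 (sq_nonneg lam)
          linarith
      _ ≤ (y + 1) ^ 2 * τ ^ 2 := mul_le_mul ((hV a b).trans hquad) hτ
          (mul_nonneg hlam.le (add_nonneg (sq_nonneg _) (sq_nonneg _))) (sq_nonneg _)
      _ = _ := by ring
  have hS : a * S₁ + b * S₂ = bil p q r a b d₁ d₂ + lam * (a * θ₁ + b * θ₂) := by
    have e1 : S₁ = p * d₁ + q * d₂ + lam * θ₁ := by linarith
    have e2 : S₂ = q * d₁ + r * d₂ + lam * θ₂ := by linarith
    rw [e1, e2]; unfold bil; ring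
  have hα : 0 ≤ α ^ 2 := sq_nonneg α
  -- Since y ≥ 2, one has y + 1 ≤ 3(y - 1) and y² + y + 1/2 ≤ (y - 1)(y + 5), which explains the
  -- constants 3 and 5.
  have hfin : (y - 1) * n ≤ (y - 1) * (α ^ 2 * y + 5 * α ^ 2 + 3 * τ) := by
    have h1 := mul_le_mul_of_nonneg_left hquad (by positivity : 0 ≤ α ^ 2 / 2)
    have h2 : (y - 1) * n ≤ α ^ 2 * y ^ 2 / 2 + α ^ 2 / 2 * (y + 1) ^ 2 + (y + 1) * τ := by
      linarith
    refine h2.trans ?_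
    nlinarith [mul_nonneg hα (by linarith : 0 ≤ y - 2), mul_nonneg hτ0 (by linarith : 0 ≤ y - 2)]
  exact le_of_mul_le_mul_left hfin (by linarith)

/-! ### Scales -/

/-- The relations between `T = E ^ 12`, the logarithm `l` of `T`, and the derived quantities. -/
structure Scale (T : ℕ) (E l : ℝ) : Prop where
  T_eq : (T : ℝ) = E ^ 12
  warm_eq : (warm T : ℝ) = E ^ 6
  nu_eq : nu T = (E ^ 3)⁻¹
  log_eq : Real.log T = l
  exp_eq : Real.exp l = E ^ 12
  rounds_le : (rounds T : ℝ) ≤ l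
  one_le : 1 ≤ E
  E_nat : ∃ n : ℕ, E = n
  warm_mul : warm T * warm T = T
  pow_rounds : 2 ^ rounds T = warm T

theorem scale_of_pow (m : ℕ) : Scale (2 ^ (12 * m)) (2 ^ m) (Real.log ((2 ^ (12 * m) : ℕ) : ℝ)) := by
  have hsq : (2 : ℕ) ^ (12 * m) = 2 ^ (6 * m) * 2 ^ (6 * m) := by rw [← pow_add]; congr 1; ring
  have hw : warm (2 ^ (12 * m)) = 2 ^ (6 * m) := by rw [warm, hsq, Nat.sqrt_eq]
  have hr : rounds (2 ^ (12 * m)) = 6 * m := by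
    rw [rounds, hsq, Nat.sqrt_eq, Nat.log_pow (by norm_num)]
  have hT : ((2 ^ (12 * m) : ℕ) : ℝ) = ((2 : ℝ) ^ m) ^ 12 := by
    push_cast; rw [← pow_mul]; congr 1; ring
  refine ⟨hT, ?_, ?_, rfl, ?_, ?_, one_le_pow₀ (by norm_num), ⟨2 ^ m, by push_cast; rfl⟩, ?_, ?_⟩
  · rw [hw]; push_cast; rw [← pow_mul]; congr 1; ring
  · rw [nu, hT, ← Real.rpow_natCast, ← Real.rpow_mul (by positivity),
      show ((12 : ℕ) : ℝ) * (-(1 / 4)) = -((3 : ℕ) : ℝ) by norm_num, Real.rpow_neg (by positivity),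
      Real.rpow_natCast]
  · rw [hT, Real.exp_log (by positivity)]
  · rw [hr, hT, Real.log_pow, Real.log_pow]
    push_cast
    -- Only log 2 ≥ 1/2 is used: 6m ≤ 12m log 2.
    have := Real.log_two_gt_d9
    have hm : (0 : ℝ) ≤ m := Nat.cast_nonneg m
    nlinarith
  · rw [hw, ← hsq]
  · rw [hw, hr]

namespace Scale

variable {T : ℕ} {E l : ℝ}

theorem E_pos (h : Scale T E l) : 0 < E := by linarith [h.one_le]

theorem warm_pos (h : Scale T E l) : 0 < warm T := by
  have : (0 : ℝ) < warm T := by rw [h.warm_eq]; have := h.E_pos; positivity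
  exact_mod_cast this

theorem two_start_le (h : Scale T E l) {s : ℕ} (hs : s < rounds T) : 2 * start T s ≤ T := by
  have h1 : 2 ^ (s + 1) ≤ 2 ^ rounds T := Nat.pow_le_pow_right (by norm_num) hs
  calc 2 * start T s = 2 ^ (s + 1) * warm T := by rw [start, pow_succ]; ring
    _ ≤ warm T * warm T := by rw [← h.pow_rounds] at *; exact Nat.mul_le_mul_right _ h1
    _ = T := h.warm_mul

theorem start_lt (h : Scale T E l) {s : ℕ} (hs : s < rounds T) : start T s < T := by
  have h1 := h.two_start_le hs
  have h2 : 0 < start T s := Nat.mul_pos (by positivity) h.warm_pos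
  omega

theorem warm_le_start (T s : ℕ) : warm T ≤ start T s :=
  Nat.le_mul_of_pos_left _ (by positivity)

theorem start_pos (h : Scale T E l) (s : ℕ) : 0 < start T s := h.warm_pos.trans_le (warm_le_start T s)

end Scale

/-- The round to which the time `t` belongs. -/
def roundOf (T t : ℕ) : ℕ := Nat.log 2 (t / warm T)

theorem start_roundOf_le {T t : ℕ} (hw : 0 < warm T) (ht : warm T ≤ t) :
    start T (roundOf T t) ≤ t := by
  have h1 : t / warm T ≠ 0 := (Nat.div_pos ht hw).ne'
  calc start T (roundOf T t) ≤ t / warm T * warm T :=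
        Nat.mul_le_mul_right _ (Nat.pow_log_le_self 2 h1)
    _ ≤ t := Nat.div_mul_le_self _ _

theorem lt_two_start_roundOf {T t : ℕ} (hw : 0 < warm T) : t < 2 * start T (roundOf T t) := by
  have h2 : t / warm T < 2 ^ (roundOf T t + 1) := Nat.lt_pow_succ_log_self (by norm_num) _
  calc t < 2 ^ (roundOf T t + 1) * warm T := (Nat.div_lt_iff_lt_mul hw).1 h2
    _ = 2 * start T (roundOf T t) := by rw [start, pow_succ]; ring

theorem roundOf_lt {T t : ℕ} {E l : ℝ} (h : Scale T E l) (hw : warm T ≤ t) (ht : t < T) :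
    roundOf T t < rounds T := by
  have h1 := start_roundOf_le h.warm_pos hw
  have h2 : 2 ^ roundOf T t * warm T < 2 ^ rounds T * warm T := by
    rw [h.pow_rounds, h.warm_mul]; exact lt_of_le_of_lt h1 ht
  exact (Nat.pow_lt_pow_iff_right (by norm_num)).1 (Nat.lt_of_mul_lt_mul_right h2)

theorem roundOf_eq {T t s : ℕ} (hw : 0 < warm T) (h1 : start T s ≤ t) (h2 : t < 2 * start T s) :
    roundOf T t = s := by
  have h3 : 2 ^ s ≤ t / warm T := (Nat.le_div_iff_mul_le hw).2 h1
  have h4 : t / warm T < 2 ^ (s + 1) := (Nat.div_lt_iff_lt_mul hw).2 (by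
    rw [pow_succ]; unfold start at h2; linarith)
  exact Nat.log_eq_of_pow_le_of_lt_pow h3 h4

/-! ### The noise law -/

theorem Spec.BP_pos (S : Spec) : 0 < S.BP := by
  obtain ⟨f, -, hf, hn⟩ := S.bounded_density
  by_contra h
  push Not at h
  have h0 : f = 0 := by
    ext x
    have := hf x
    rw [ENNReal.ofReal_of_nonpos h] at this
    simpa using this
  have := S.prob.measure_univ
  rw [hn, h0] at this
  simp at this

/-! ### Trajectories of the algorithm -/

/-- The deterministic constraints on a trajectory of the algorithm. -/
structure Traj {S : Spec} {T : ℕ} (p : Problem S T) (x u w φ : ℕ → ℝ) : Prop where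
  x_zero : x 0 = 0
  x_succ : ∀ t < T, x (t + 1) = p.thetaStar.1 * x t + p.thetaStar.2 * u t + w t
  warm_up : ∀ t < warm T, u t = p.Cinit (x t) + φ t / Real.log T
  exploit : ∀ s < rounds T, ∀ t, start T s ≤ t → t < 2 * start T s → ∃ c,
    u t = max (min c (safeU p.DU (thetaPre S x u (start T s)) (radius S T x u (start T s)) (x t)))
      (safeL p.DL (thetaPre S x u (start T s)) (radius S T x u (start T s)) (x t))

/-- The noise is of logarithmic size and lies between its extreme quantiles. -/
structure NoiseOk (S : Spec) (T : ℕ) (w φ : ℕ → ℝ) : Prop where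
  noise_le : ∀ t < T, |w t| ≤ Real.log T ^ 2
  ge_quantile : ∀ t < T, quantile S.noise (1 / (T : ℝ) ^ 4) ≤ w t
  le_quantile : ∀ t < T, w t ≤ quantile S.noise (1 - 1 / (T : ℝ) ^ 4)
  zero_ge : quantile S.noise (1 / (T : ℝ) ^ 4) ≤ 0
  zero_le : 0 ≤ quantile S.noise (1 - 1 / (T : ℝ) ^ 4)
  sign : ∀ t < warm T, φ t = 1 ∨ φ t = -1

/-- The bound `Cu log² T` holds for all controls. -/
def Spec.Cu (S : Spec) : ℝ := (8 + 6 * S.aHi) / S.bLo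

theorem Spec.aHi_pos (S : Spec) : 0 < S.aHi := S.aLo_pos.trans_le S.aLo_le

theorem Spec.bHi_pos (S : Spec) : 0 < S.bHi := S.bLo_pos.trans_le S.bLo_le

theorem Spec.Cu_pos (S : Spec) : 0 < S.Cu := by
  have := S.aHi_pos
  have := S.bLo_pos
  unfold Spec.Cu; positivity

/-- Solving for `b * u` gives |bu| ≤ (4 + 3 aHi)L. The enlarged ranges for `a` and `b` allow
estimated dynamics as well as the true ones. -/
theorem abs_control_le {S : Spec} {T : ℕ} (p : Problem S T) {a b x u L : ℝ}
    (hDL : -L ≤ p.DL) (hDU : p.DU ≤ L) (ha : |a| ≤ S.aHi + 1) (hb : S.bLo / 2 ≤ b)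
    (hx : |x| ≤ 3 * L) (h1 : p.DL ≤ a * x + b * u) (h2 : a * x + b * u ≤ p.DU) :
    |u| ≤ S.Cu * L := by
  have hb0 := S.bLo_pos
  have e1 : |a * x| ≤ (S.aHi + 1) * (3 * L) := by
    rw [abs_mul]
    exact mul_le_mul ha hx (abs_nonneg _) (by linarith [S.aHi_pos])
  have e2 : |b * u| ≤ (4 + 3 * S.aHi) * L := by
    rw [abs_le] at e1 ⊢
    constructor <;> linarith
  rw [abs_mul, abs_of_pos (by linarith)] at e2
  have e3 : S.bLo / 2 * |u| ≤ (4 + 3 * S.aHi) * L :=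
    (mul_le_mul_of_nonneg_right hb (abs_nonneg _)).trans e2
  unfold Spec.Cu
  rw [div_mul_eq_mul_div, le_div_iff₀ hb0]
  linarith

/-! ### Safety and excitation during the warm-up phase -/

section Warm

variable {S : Spec} {T : ℕ} {p : Problem S T} {x u w φ : ℕ → ℝ}

/-- By induction, a safe step followed by noise between the two quantiles lands exactly in the
interval where the initial controller is safe, and its margin b*/log T absorbs the exploration sign.
-/
theorem Traj.warm_range (h : Traj p x u w φ) (hN : NoiseOk S T w φ) (hT : warm T ≤ T)
    (hlog : 0 < Real.log T) {t : ℕ} (ht : t ≤ warm T) :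
    (p.DL + quantile S.noise (1 / (T : ℝ) ^ 4) ≤ x t ∧
      x t ≤ p.DU + quantile S.noise (1 - 1 / (T : ℝ) ^ 4) ∧ |x t| ≤ 2 * Real.log T ^ 2) ∧
    (t < warm T → (p.DL ≤ p.thetaStar.1 * x t + p.thetaStar.2 * u t ∧
      p.thetaStar.1 * x t + p.thetaStar.2 * u t ≤ p.DU) ∧
      (p.DL ≤ p.thetaStar.1 * x t + p.thetaStar.2 * p.Cinit (x t) ∧
      p.thetaStar.1 * x t + p.thetaStar.2 * p.Cinit (x t) ≤ p.DU)) := by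
  have hb : 0 < p.thetaStar.2 / Real.log T :=
    div_pos (S.bLo_pos.trans_le p.b_mem.1) hlog
  have hsafe : ∀ t < warm T, p.DL + quantile S.noise (1 / (T : ℝ) ^ 4) ≤ x t →
      x t ≤ p.DU + quantile S.noise (1 - 1 / (T : ℝ) ^ 4) →
      (p.DL ≤ p.thetaStar.1 * x t + p.thetaStar.2 * u t ∧
      p.thetaStar.1 * x t + p.thetaStar.2 * u t ≤ p.DU) ∧
      (p.DL ≤ p.thetaStar.1 * x t + p.thetaStar.2 * p.Cinit (x t) ∧
      p.thetaStar.1 * x t + p.thetaStar.2 * p.Cinit (x t) ≤ p.DU) := by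
    intro t ht h1 h2
    obtain ⟨c1, c2⟩ := p.Cinit_safe (x t) h1 h2
    rw [h.warm_up t ht, mul_add]
    have : p.thetaStar.2 * (φ t / Real.log T) = p.thetaStar.2 / Real.log T ∨
        p.thetaStar.2 * (φ t / Real.log T) = -(p.thetaStar.2 / Real.log T) := by
      rcases hN.sign t ht with e | e <;> rw [e]
      · left; ring
      · right; ring
    refine ⟨?_, by linarith, by linarith⟩
    rcases this with e | e <;> rw [e] <;> constructor <;> linarith
  have hpos : ∀ t ≤ warm T, p.DL + quantile S.noise (1 / (T : ℝ) ^ 4) ≤ x t ∧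
      x t ≤ p.DU + quantile S.noise (1 - 1 / (T : ℝ) ^ 4) ∧ |x t| ≤ 2 * Real.log T ^ 2 := by
    intro t
    induction t with
    | zero =>
      intro _
      rw [h.x_zero]
      refine ⟨by linarith [p.DL_neg, hN.zero_ge], by linarith [p.DU_pos, hN.zero_le], ?_⟩
      simp only [abs_zero]; positivity
    | succ t ih =>
      intro ht
      obtain ⟨i1, i2, -⟩ := ih (by omega)
      obtain ⟨s1, s2⟩ := (hsafe t (by omega) i1 i2).1
      rw [h.x_succ t (by omega)]
      have e1 := hN.ge_quantile t (by omega)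
      have e2 := hN.le_quantile t (by omega)
      have e3 := abs_le.1 (hN.noise_le t (by omega))
      refine ⟨by linarith, by linarith, abs_le.2 ⟨?_, ?_⟩⟩ <;>
      linarith [p.DL_ge, p.DU_le]
  exact ⟨hpos t ht, fun ht' => hsafe t ht' (hpos t ht).1 (hpos t ht).2.1⟩

theorem abs_thetaStar_le (p : Problem S T) : |p.thetaStar.1| ≤ S.aHi + 1 := by
  rw [abs_of_pos (S.aLo_pos.trans_le p.a_mem.1)]
  linarith [p.a_mem.2]

theorem Traj.warm_control (h : Traj p x u w φ) (hN : NoiseOk S T w φ) (hT : warm T ≤ T)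
    (hlog : 0 < Real.log T) {t : ℕ} (ht : t < warm T) :
    |u t| ≤ S.Cu * Real.log T ^ 2 ∧ |p.Cinit (x t)| ≤ S.Cu * Real.log T ^ 2 := by
  obtain ⟨⟨-, -, h1⟩, h2⟩ := h.warm_range hN hT hlog ht.le
  obtain ⟨⟨s1, s2⟩, s3, s4⟩ := h2 ht
  have hb : S.bLo / 2 ≤ p.thetaStar.2 := by linarith [p.b_mem.1, S.bLo_pos]
  have hx : |x t| ≤ 3 * Real.log T ^ 2 := by nlinarith [sq_nonneg (Real.log T)]
  exact ⟨abs_control_le p p.DL_ge p.DU_le (abs_thetaStar_le p) hb hx s1 s2,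
    abs_control_le p p.DL_ge p.DU_le (abs_thetaStar_le p) hb hx s3 s4⟩

/-- The threshold above which positions count as exciting. -/
def Spec.xthr (S : Spec) : ℝ := 1 / (16 * S.BP)

/-- The constant in the lower bound on the excitation in the warm-up phase. -/
def Spec.kap (S : Spec) : ℝ := min (S.xthr ^ 2 / (8 * S.Cu ^ 2)) (S.xthr ^ 2 / 16)

theorem Spec.xthr_pos (S : Spec) : 0 < S.xthr := by
  have := S.BP_pos
  unfold Spec.xthr; positivity

theorem Spec.kap_pos (S : Spec) : 0 < S.kap := by
  have := S.xthr_pos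
  have := S.Cu_pos
  unfold Spec.kap; positivity

/-- The excitation events of the warm-up phase. -/
structure WarmOk {S : Spec} {T : ℕ} (p : Problem S T) (x φ : ℕ → ℝ) (E l : ℝ) : Prop where
  cross_x : ∀ s : ℝ, (s = 1 / E ^ 3 ∨ s = -(1 / E ^ 3)) →
    ∑ t ∈ Finset.range (warm T), (s * x t * φ t - s ^ 2 * x t ^ 2 / 2) ≤ 5 * l
  cross_c : ∀ s : ℝ, (s = 1 / E ^ 3 ∨ s = -(1 / E ^ 3)) →
    ∑ t ∈ Finset.range (warm T),
      (s * p.Cinit (x t) * φ t - s ^ 2 * p.Cinit (x t) ^ 2 / 2) ≤ 5 * l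
  count : ∑ t ∈ Finset.range (warm T), ((if |x (t + 1)| < S.xthr then (1 : ℝ) else 0) - 1 / 4) ≤ 3 * l

/-- The tilt ±n^(-1/2) balances the two terms: the quadratic compensator becomes at most M²/2, and
dividing by the tilt costs the factor √n = E³. -/
theorem abs_cross_le {n : ℕ} {E l M : ℝ} {g φ : ℕ → ℝ} (hE : 0 < E) (hn : (n : ℝ) = E ^ 6)
    (hg : ∀ t < n, |g t| ≤ M)
    (h : ∀ s : ℝ, (s = 1 / E ^ 3 ∨ s = -(1 / E ^ 3)) →
      ∑ t ∈ Finset.range n, (s * g t * φ t - s ^ 2 * g t ^ 2 / 2) ≤ 5 * l) :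
    |∑ t ∈ Finset.range n, g t * φ t| ≤ E ^ 3 * (5 * l + M ^ 2 / 2) := by
  have hE3 : 0 < E ^ 3 := by positivity
  have hsq : ∑ t ∈ Finset.range n, g t ^ 2 ≤ E ^ 6 * M ^ 2 := by
    rw [← hn]
    calc ∑ t ∈ Finset.range n, g t ^ 2 ≤ ∑ t ∈ Finset.range n, M ^ 2 := by
          refine Finset.sum_le_sum fun t ht => ?_
          have := hg t (Finset.mem_range.1 ht)
          rw [← sq_abs]
          exact pow_le_pow_left₀ (abs_nonneg _) this 2
      _ = n * M ^ 2 := by simp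
  have key : ∀ s : ℝ, (s = 1 / E ^ 3 ∨ s = -(1 / E ^ 3)) →
      s * ∑ t ∈ Finset.range n, g t * φ t ≤ 5 * l + M ^ 2 / 2 := by
    intro s hs
    have h1 := h s hs
    have h2 : ∑ t ∈ Finset.range n, (s * g t * φ t - s ^ 2 * g t ^ 2 / 2) =
        s * ∑ t ∈ Finset.range n, g t * φ t - s ^ 2 / 2 * ∑ t ∈ Finset.range n, g t ^ 2 := by
      rw [Finset.mul_sum, Finset.mul_sum, ← Finset.sum_sub_distrib]
      exact Finset.sum_congr rfl fun _ _ => by ring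
    have hs2 : s ^ 2 = 1 / E ^ 6 := by rcases hs with rfl | rfl <;> ring
    have h3 : s ^ 2 / 2 * ∑ t ∈ Finset.range n, g t ^ 2 ≤ M ^ 2 / 2 := by
      calc s ^ 2 / 2 * ∑ t ∈ Finset.range n, g t ^ 2 ≤ s ^ 2 / 2 * (E ^ 6 * M ^ 2) := by gcongr
        _ = M ^ 2 / 2 := by rw [hs2]; field_simp
    linarith
  have k1 := key _ (Or.inl rfl)
  have k2 := key _ (Or.inr rfl)
  have e : ∀ z : ℝ, z = E ^ 3 * (1 / E ^ 3 * z) := fun z => by field_simp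
  rw [abs_le]
  constructor
  · rw [e (∑ t ∈ Finset.range n, g t * φ t), ← mul_neg]
    exact mul_le_mul_of_nonneg_left (by linarith) hE3.le
  · rw [e (∑ t ∈ Finset.range n, g t * φ t)]
    exact mul_le_mul_of_nonneg_left k1 hE3.le

end Warm

section Warm

variable {S : Spec} {T : ℕ} {p : Problem S T} {x u w φ : ℕ → ℝ} {E l : ℝ}

/-- Expand the square around the unperturbed control. As φ² = 1, the signs contribute exactly n
b²/l²; the square of the unperturbed part is dropped, and only the cross terms are lost. -/
theorem Traj.qf_ge_of_cross (h : Traj p x u w φ) (hN : NoiseOk S T w φ) (hs : Scale T E l)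
    (hl : 0 < l) {X a b : ℝ} (ha : |a| ≤ 1) (hb : |b| ≤ 1)
    (hx : |∑ t ∈ Finset.range (warm T), x t * φ t| ≤ X)
    (hc : |∑ t ∈ Finset.range (warm T), p.Cinit (x t) * φ t| ≤ X) :
    E ^ 6 * b ^ 2 / l ^ 2 - 4 * X / l ≤ qf x u (warm T) a b := by
  have e1 : qf x u (warm T) a b = ∑ t ∈ Finset.range (warm T), (a * x t + b * p.Cinit (x t)) ^ 2 +
      2 * (b / l) * (a * ∑ t ∈ Finset.range (warm T), x t * φ t +
        b * ∑ t ∈ Finset.range (warm T), p.Cinit (x t) * φ t) + E ^ 6 * b ^ 2 / l ^ 2 := by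
    have : E ^ 6 * b ^ 2 / l ^ 2 = ∑ t ∈ Finset.range (warm T), (b / l) ^ 2 := by
      rw [Finset.sum_const, Finset.card_range, nsmul_eq_mul, hs.warm_eq]; ring
    rw [this, qf, Finset.mul_sum, Finset.mul_sum, ← Finset.sum_add_distrib, Finset.mul_sum,
      ← Finset.sum_add_distrib, ← Finset.sum_add_distrib]
    refine Finset.sum_congr rfl fun t ht => ?_
    rw [h.warm_up t (Finset.mem_range.1 ht), hs.log_eq]
    have hφ : φ t ^ 2 = 1 := by
      rcases hN.sign t (Finset.mem_range.1 ht) with e | e <;> rw [e] <;> norm_num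
    calc (a * x t + b * (p.Cinit (x t) + φ t / l)) ^ 2 = (a * x t + b * p.Cinit (x t)) ^ 2 +
        2 * (b / l) * (a * (x t * φ t) + b * (p.Cinit (x t) * φ t)) + (b / l) ^ 2 * φ t ^ 2 := by
          ring
      _ = _ := by rw [hφ]; ring
  have e2 : 0 ≤ ∑ t ∈ Finset.range (warm T), (a * x t + b * p.Cinit (x t)) ^ 2 :=
    Finset.sum_nonneg fun _ _ => sq_nonneg _
  have hX : 0 ≤ X := (abs_nonneg _).trans hx
  have e3 : |2 * (b / l) * (a * ∑ t ∈ Finset.range (warm T), x t * φ t +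
        b * ∑ t ∈ Finset.range (warm T), p.Cinit (x t) * φ t)| ≤ 2 * (1 / l) * (2 * X) := by
    rw [abs_mul]
    refine mul_le_mul ?_ ?_ (abs_nonneg _) (by positivity)
    · rw [abs_mul, abs_div, abs_of_pos hl, abs_two]
      gcongr
    · calc |(a * ∑ t ∈ Finset.range (warm T), x t * φ t +
          b * ∑ t ∈ Finset.range (warm T), p.Cinit (x t) * φ t)| ≤
          1 * X + 1 * X := by
            refine (abs_add_le _ _).trans (add_le_add ?_ ?_) <;> rw [abs_mul] <;>
            exact mul_le_mul (by assumption) (by assumption) (abs_nonneg _) zero_le_one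
        _ = 2 * X := by ring
  have e4 := (abs_le.1 e3).1
  have e5 : 2 * (1 / l) * (2 * X) = 4 * X / l := by ring
  rw [e1]; linarith

/-- For directions so close to the x-axis that the control changes the value by at most h/2, every
position of size at least h contributes h²/4. One unit is lost because the count runs over x₁, …,
x_n and the form over x₀, …, x_{n-1}. -/
theorem qf_ge_of_count {n : ℕ} {l h η U c : ℝ} (hh : 0 < h) (hU : ∀ t < n, |u t| ≤ U)
    (hη : |c| ≤ η) (hηU : η * U ≤ h / 2)
    (hcount : ∑ t ∈ Finset.range n, ((if |x (t + 1)| < h then (1 : ℝ) else 0) - 1 / 4) ≤ l) :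
    h ^ 2 / 4 * (3 / 4 * n - l - 1) ≤ qf x u n 1 c := by
  rcases n with _ | n
  · have : 0 ≤ l := by simpa using hcount
    have h2 := sq_nonneg h
    simp only [qf, Finset.range_zero, Finset.sum_empty, Nat.cast_zero]
    nlinarith
  rw [qf, Finset.sum_range_succ']
  rw [Finset.sum_range_succ, Finset.sum_sub_distrib] at hcount
  simp only [Finset.sum_const, Finset.card_range, nsmul_eq_mul] at hcount
  have h1 : ∑ t ∈ Finset.range n, h ^ 2 / 4 * (1 - (if |x (t + 1)| < h then (1 : ℝ) else 0)) ≤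
      ∑ t ∈ Finset.range n, (1 * x (t + 1) + c * u (t + 1)) ^ 2 := by
    refine Finset.sum_le_sum fun t ht => ?_
    split_ifs with hlt
    · simp only [sub_self, mul_zero]; exact sq_nonneg _
    · push Not at hlt
      have h3 : |c * u (t + 1)| ≤ h / 2 := by
        rw [abs_mul]
        have hut := hU (t + 1) (by have := Finset.mem_range.1 ht; omega)
        exact (mul_le_mul hη hut (abs_nonneg _) ((abs_nonneg _).trans hη)).trans hηU
      have h4 : h / 2 ≤ |(1 * x (t + 1) + c * u (t + 1))| := by
        have := abs_sub_abs_le_abs_sub (x (t + 1)) (-(c * u (t + 1)))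
        rw [abs_neg, sub_neg_eq_add] at this
        rw [one_mul]; linarith
      rw [← sq_abs (1 * x (t + 1) + c * u (t + 1))]
      nlinarith
  rw [← Finset.mul_sum, Finset.sum_sub_distrib] at h1
  simp only [Finset.sum_const, Finset.card_range, nsmul_eq_mul, mul_one] at h1
  have h5 : (0 : ℝ) ≤ if |x (n + 1)| < h then (1 : ℝ) else 0 := by split_ifs <;> norm_num
  push_cast
  have h6 : 3 / 4 * ((n : ℝ) + 1) - l - 1 ≤
      n - ∑ t ∈ Finset.range n, (if |x (t + 1)| < h then (1 : ℝ) else 0) := by linarith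
  have h7 := mul_le_mul_of_nonneg_left h6 (by positivity : 0 ≤ h ^ 2 / 4)
  nlinarith [sq_nonneg (1 * x 0 + c * u 0)]

/-- The excitation of the warm-up phase. -/
def Excited (x u : ℕ → ℝ) (t : ℕ) (κ : ℝ) : Prop :=
  ∀ c : ℝ, |c| ≤ 1 → κ ≤ qf x u t 1 c ∧ κ ≤ qf x u t c 1

theorem Excited.mono {s t : ℕ} {κ : ℝ} (h : Excited x u s κ) (hst : s ≤ t) : Excited x u t κ :=
  fun c hc => ⟨(h c hc).1.trans (qf_mono x u hst _ _), (h c hc).2.trans (qf_mono x u hst _ _)⟩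

theorem Excited.sqBound {t : ℕ} {κ : ℝ} (h : Excited x u t κ) (S : Spec) :
    SqBound (Vmat S x u t 0 0) (Vmat S x u t 0 1) (Vmat S x u t 1 1) κ := by
  intro c hc
  have h1 := Vq_eq S x u t 1 c
  have h2 := Vq_eq S x u t c 1
  unfold Vq at h1 h2
  rw [h1, h2]
  have := S.lam_pos
  constructor
  · refine (h c hc).1.trans (le_add_of_nonneg_left (by positivity))
  · refine (h c hc).2.trans (le_add_of_nonneg_left (by positivity))

theorem warm_excited (S : Spec) : ∃ A : ℝ, ∀ {T : ℕ} {p : Problem S T} {x u w φ : ℕ → ℝ} {E l : ℝ},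
    Traj p x u w φ → NoiseOk S T w φ → Scale T E l → WarmOk p x φ E l → A ≤ l → l ^ 30 ≤ E →
    Excited x u (warm T) (S.kap * E ^ 6 / l ^ 6) := by
  have hX := S.xthr_pos
  have hC := S.Cu_pos
  refine ⟨max (32 * S.Cu ^ 2 / S.xthr ^ 2) (max (S.xthr / (2 * S.Cu)) (max (5 + S.Cu ^ 2) 20)),
    fun {T p x u w φ E l} h hN hs hW hA hE => ?_⟩
  simp only [max_le_iff] at hA
  obtain ⟨hA1, hA2, hA3, hA4⟩ := hA
  have hl : 0 < l := by linarith
  have hl1 : 1 ≤ l := by linarith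
  have hE0 := hs.E_pos
  have hlog : 0 < Real.log T := by rw [hs.log_eq]; exact hl
  have hwT : warm T ≤ T := by
    have := hs.warm_mul; have := hs.warm_pos; nlinarith
  have hlE : ∀ k ≤ 30, l ^ k ≤ E := fun k hk => (pow_le_pow_right₀ hl1 hk).trans hE
  have hbx : ∀ t < warm T, |x t| ≤ 2 * l ^ 2 := fun t ht => by
    have := (h.warm_range hN hwT hlog ht.le).1.2.2
    rwa [hs.log_eq] at this
  have hbu : ∀ t < warm T, |u t| ≤ S.Cu * l ^ 2 := fun t ht => by
    have := (h.warm_control hN hwT hlog ht).1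
    rwa [hs.log_eq] at this
  have hbc : ∀ t < warm T, |p.Cinit (x t)| ≤ S.Cu * l ^ 2 := fun t ht => by
    have := (h.warm_control hN hwT hlog ht).2
    rwa [hs.log_eq] at this
  have hl4 : l ^ 4 * l = l ^ 5 := by ring
  have hl14 : l ≤ l ^ 4 := by nlinarith [pow_le_pow_right₀ hl1 (show 1 ≤ 4 by norm_num)]
  have cx : |∑ t ∈ Finset.range (warm T), x t * φ t| ≤ E ^ 3 * l ^ 5 := by
    refine (abs_cross_le hE0 hs.warm_eq hbx hW.cross_x).trans ?_
    gcongr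
    nlinarith [pow_pos hl 4]
  have cc : |∑ t ∈ Finset.range (warm T), p.Cinit (x t) * φ t| ≤ E ^ 3 * l ^ 5 := by
    refine (abs_cross_le hE0 hs.warm_eq hbc hW.cross_c).trans ?_
    gcongr
    nlinarith [pow_pos hl 4, mul_pos (pow_pos hl 4) (pow_pos hC 2)]
  have hl2 : 0 < l ^ 2 := by positivity
  -- The threshold between the two mechanisms: below it the control term is at most half of `xthr`,
  -- while above it the main term of the signs, of order E⁶/l⁶, still beats their cross terms of
  -- order E³l⁴.
  set η := S.xthr / (2 * S.Cu * l ^ 2) with hη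
  have hη0 : 0 < η := by positivity
  have big : ∀ a b, |a| ≤ 1 → |b| ≤ 1 → η ≤ |b| → S.kap * E ^ 6 / l ^ 6 ≤ qf x u (warm T) a b := by
    intro a b ha hb hηb
    refine le_trans ?_ (h.qf_ge_of_cross hN hs hl ha hb cx cc)
    have h1 : η ^ 2 ≤ b ^ 2 := by
      rw [← sq_abs b]; exact pow_le_pow_left₀ hη0.le hηb 2
    have h2 : S.kap ≤ S.xthr ^ 2 / (8 * S.Cu ^ 2) := min_le_left _ _
    have h3 : S.kap * E ^ 6 / l ^ 6 ≤ S.xthr ^ 2 / (8 * S.Cu ^ 2) * E ^ 6 / l ^ 6 := by gcongr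
    have h4 : E ^ 6 * η ^ 2 / l ^ 2 ≤ E ^ 6 * b ^ 2 / l ^ 2 := by gcongr
    have h5 : E ^ 6 * η ^ 2 / l ^ 2 = 2 * (S.xthr ^ 2 / (8 * S.Cu ^ 2) * E ^ 6 / l ^ 6) := by
      rw [hη]; field_simp; ring
    have h6 : 4 * (E ^ 3 * l ^ 5) / l ≤ S.xthr ^ 2 / (8 * S.Cu ^ 2) * E ^ 6 / l ^ 6 := by
      have h7 : 32 * S.Cu ^ 2 ≤ l * S.xthr ^ 2 := by
        rwa [div_le_iff₀ (by positivity)] at hA1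
      have h8 : l ^ 11 ≤ E ^ 3 := (hlE 11 (by norm_num)).trans
        (le_self_pow₀ hs.one_le (by norm_num))
      rw [div_mul_eq_mul_div, div_div, div_le_div_iff₀ hl (by positivity)]
      have h9 : 32 * S.Cu ^ 2 * (E ^ 3 * l ^ 11) ≤ l * S.xthr ^ 2 * (E ^ 3 * E ^ 3) := by gcongr
      calc 4 * (E ^ 3 * l ^ 5) * (8 * S.Cu ^ 2 * l ^ 6) = 32 * S.Cu ^ 2 * (E ^ 3 * l ^ 11) := by ring
        _ ≤ l * S.xthr ^ 2 * (E ^ 3 * E ^ 3) := h9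
        _ = _ := by ring
    linarith
  have hη1 : η ≤ 1 := by
    rw [hη, div_le_one (by positivity)]
    rw [div_le_iff₀ (by positivity)] at hA2
    nlinarith
  intro c hc
  refine ⟨?_, big c 1 hc (by simp) (by simpa using hη1)⟩
  rcases le_total η |c| with hcase | hcase
  · exact big 1 c (by simp) hc hcase
  · refine le_trans ?_ (qf_ge_of_count hX hbu hcase ?_ hW.count)
    · rw [hs.warm_eq]
      have h2 : S.kap ≤ S.xthr ^ 2 / 16 := min_le_right _ _
      have h3 : S.kap * E ^ 6 / l ^ 6 ≤ S.xthr ^ 2 / 16 * E ^ 6 / l ^ 6 := by gcongr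
      have h4 : S.xthr ^ 2 / 16 * E ^ 6 / l ^ 6 ≤ S.xthr ^ 2 / 16 * E ^ 6 :=
        div_le_self (by positivity) (one_le_pow₀ hl1)
      have h5 : 3 * l + 1 ≤ E ^ 6 / 2 := by
        have h6 : l ^ 2 ≤ E ^ 6 := (hlE 2 (by norm_num)).trans
          (le_self_pow₀ hs.one_le (by norm_num))
        nlinarith
      have h7 : E ^ 6 / 4 ≤ 3 / 4 * E ^ 6 - 3 * l - 1 := by linarith
      have h8 := mul_le_mul_of_nonneg_left h7 (by positivity : 0 ≤ S.xthr ^ 2 / 4)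
      linarith
    · rw [hη]; apply le_of_eq; field_simp

end Warm

/-! ### The radius and the estimate -/

/-- The trajectory is of polylogarithmic size. -/
def Bdd (S : Spec) (x u : ℕ → ℝ) (t : ℕ) (l : ℝ) : Prop :=
  (∀ i ≤ t, |x i| ≤ 3 * l ^ 2) ∧ ∀ i < t, |u i| ≤ S.Cu * l ^ 2

/-- The exponential martingale bounds in the directions of a grid. -/
def GridOk (S : Spec) (E l y : ℝ) (x u w : ℕ → ℝ) (t : ℕ) : Prop :=
  ∀ i j : ℤ, |(i : ℝ)| ≤ E ^ 4 → |(j : ℝ)| ≤ E ^ 4 →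
    ∑ k ∈ Finset.range t, ((i * (1 / (E ^ 6 * l ^ 3)) * x k + j * (1 / (E ^ 6 * l ^ 3)) * u k) * w k -
      S.alpha ^ 2 / 2 * (i * (1 / (E ^ 6 * l ^ 3)) * x k + j * (1 / (E ^ 6 * l ^ 3)) * u k) ^ 2) ≤
      S.alpha ^ 2 * y ^ 2 / 2

/-- The coefficient in the bound for the radii. -/
def Spec.radC (S : Spec) : ℝ := 1 / Real.sqrt S.kap

theorem Spec.radC_pos (S : Spec) : 0 < S.radC := by
  have := S.kap_pos
  unfold Spec.radC; positivity

theorem radius_nonneg (S : Spec) (T : ℕ) (x u : ℕ → ℝ) (t : ℕ) : 0 ≤ radius S T x u t := by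
  have := S.alpha_pos
  unfold radius Bconf; positivity

theorem sum_sq_le {f : ℕ → ℝ} {t T : ℕ} {M : ℝ} (ht : t ≤ T) (h : ∀ i < t, |f i| ≤ M) :
    ∑ i ∈ Finset.range t, f i ^ 2 ≤ T * M ^ 2 := by
  calc ∑ i ∈ Finset.range t, f i ^ 2 ≤ ∑ i ∈ Finset.range t, M ^ 2 := by
        refine Finset.sum_le_sum fun i hi => ?_
        rw [← sq_abs]
        exact pow_le_pow_left₀ (abs_nonneg _) (h i (Finset.mem_range.1 hi)) 2
    _ = t * M ^ 2 := by simp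
    _ ≤ T * M ^ 2 := by gcongr

theorem trace_le (S : Spec) : ∃ A : ℝ, ∀ {T : ℕ} {E l : ℝ} {x u : ℕ → ℝ} {t : ℕ},
    Scale T E l → A ≤ l → t ≤ T → Bdd S x u t l →
    Vmat S x u t 0 0 + Vmat S x u t 1 1 ≤ E ^ 12 * l ^ 5 := by
  refine ⟨max 1 (2 * S.lam + 9 + S.Cu ^ 2), fun {T E l x u t} hs hA ht hB => ?_⟩
  rw [max_le_iff] at hA
  obtain ⟨hA1, hA2⟩ := hA
  have h1 := sum_sq_le ht (fun i hi => hB.1 i hi.le)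
  have h2 := sum_sq_le ht hB.2
  rw [hs.T_eq] at h1 h2
  rw [Vmat_apply_zero_zero, Vmat_apply_one_one]
  have h3 : 1 ≤ E ^ 12 * l ^ 4 := one_le_mul_of_one_le_of_one_le (one_le_pow₀ hs.one_le) (one_le_pow₀ hA1)
  have h4 := S.lam_pos
  have h5 : (2 * S.lam + 9 + S.Cu ^ 2) * (E ^ 12 * l ^ 4) ≤ l * (E ^ 12 * l ^ 4) := by gcongr
  have h6 : 2 * S.lam * 1 ≤ 2 * S.lam * (E ^ 12 * l ^ 4) := by gcongr
  nlinarith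

/-- Above, det V ≤ E³⁶ contributes 3l to the logarithms. Below, the warm-up excitation gives λ² det
V ≥ E⁶, which adds l/2 to the explicit 4l. This extra l/2 is the margin that later absorbs the
constants in the estimation error. -/
theorem Bconf_bounds (S : Spec) : ∃ A : ℝ, ∀ {T : ℕ} {E l : ℝ} {x u : ℕ → ℝ} {t : ℕ},
    Scale T E l → A ≤ l → l ^ 30 ≤ E →
    Excited x u t (S.kap * E ^ 6 / l ^ 6) →
    (t ≤ T → Bdd S x u t l → Bconf S T x u t ≤ l) ∧
    S.alpha * Real.sqrt (9 / 2 * l) ≤ Bconf S T x u t := by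
  obtain ⟨A₀, hA₀⟩ := trace_le S
  have hk := S.kap_pos
  have ha := S.alpha_pos
  have hlam := S.lam_pos
  refine ⟨max A₀ (max 1 (max |Real.log (S.lam ^ 2)| (max (32 * S.alpha ^ 2) (max
    (2 * (Real.sqrt S.lam * (S.aHi ^ 2 + S.bHi ^ 2))) (1 / (S.lam ^ 2 * S.kap ^ 2)))))),
    fun {T E l x u t} hs hA hE hex => ?_⟩
  simp only [max_le_iff] at hA
  obtain ⟨h0, h1, h2, h3, h4, h5⟩ := hA
  have hl : 0 < l := by linarith
  have hE0 := hs.E_pos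
  have hlE : ∀ k ≤ 30, l ^ k ≤ E := fun k hk => (pow_le_pow_right₀ h1 hk).trans hE
  have hlogE : ∀ k : ℕ, Real.log (E ^ (12 * k)) = k * l := fun k => by
    rw [pow_mul, ← hs.exp_eq, ← Real.exp_nat_mul, Real.log_exp]
  have hdet := Vmat_det_pos S x u t
  have hκ : 0 < S.kap * E ^ 6 / l ^ 6 := by positivity
  have hT2 : 2 * Real.log ((T : ℝ) ^ 2) = 4 * l := by
    rw [Real.log_pow, hs.log_eq]; push_cast; ring
  unfold Bconf
  rw [Vmat_det, hT2]
  constructor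
  · intro ht hB
    have htr := hA₀ hs h0 ht hB
    have p0 := Vmat_zero_zero_pos S x u t
    have p1 := Vmat_one_one_pos S x u t
    have hup : Vmat S x u t 0 0 * Vmat S x u t 1 1 - Vmat S x u t 0 1 ^ 2 ≤ E ^ (12 * 3) := by
      have : l ^ 10 ≤ E ^ 12 := (hlE 10 (by norm_num)).trans (le_self_pow₀ hs.one_le (by norm_num))
      calc _ ≤ Vmat S x u t 0 0 * Vmat S x u t 1 1 := by
            linarith [sq_nonneg (Vmat S x u t 0 1)]
        _ ≤ (E ^ 12 * l ^ 5) * (E ^ 12 * l ^ 5) :=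
            mul_le_mul (by linarith) (by linarith) p1.le (by positivity)
        _ = E ^ 24 * l ^ 10 := by ring
        _ ≤ E ^ 24 * E ^ 12 := by gcongr
        _ = _ := by ring
    have hlog := Real.log_le_log hdet hup
    rw [hlogE] at hlog
    push_cast at hlog
    have hs8 : Real.log (Vmat S x u t 0 0 * Vmat S x u t 1 1 - Vmat S x u t 0 1 ^ 2) +
        Real.log (S.lam ^ 2) + 4 * l ≤ 8 * l := by linarith [le_abs_self (Real.log (S.lam ^ 2))]
    have : S.alpha * Real.sqrt (Real.log (Vmat S x u t 0 0 * Vmat S x u t 1 1 -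
        Vmat S x u t 0 1 ^ 2) + Real.log (S.lam ^ 2) + 4 * l) ≤ l / 2 := by
      calc _ ≤ S.alpha * Real.sqrt (8 * l) := by gcongr
        _ = Real.sqrt (S.alpha ^ 2 * (8 * l)) := by
            rw [Real.sqrt_mul (sq_nonneg _), Real.sqrt_sq ha.le]
        _ ≤ l / 2 := by
            rw [Real.sqrt_le_iff]
            constructor
            · positivity
            · nlinarith
    linarith
  · have hlow := (hex.sqBound S).det_pos hκ
    have hlow2 : E ^ 6 ≤ S.lam ^ 2 *
        (Vmat S x u t 0 0 * Vmat S x u t 1 1 - Vmat S x u t 0 1 ^ 2) := by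
      refine le_trans ?_ (mul_le_mul_of_nonneg_left hlow (sq_nonneg _))
      have e1 : S.lam ^ 2 * (S.kap * E ^ 6 / l ^ 6) ^ 2 =
          S.lam ^ 2 * S.kap ^ 2 * E ^ 12 / l ^ 12 := by field_simp
      rw [e1, le_div_iff₀ (by positivity)]
      rw [div_le_iff₀ (by positivity)] at h5
      have h13 : l ^ 13 ≤ E ^ 6 := (hlE 13 (by norm_num)).trans
        (le_self_pow₀ hs.one_le (by norm_num))
      calc E ^ 6 * l ^ 12 = 1 * (E ^ 6 * l ^ 12) := by ring
        _ ≤ l * (S.lam ^ 2 * S.kap ^ 2) * (E ^ 6 * l ^ 12) := by gcongr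
        _ = S.lam ^ 2 * S.kap ^ 2 * E ^ 6 * l ^ 13 := by ring
        _ ≤ S.lam ^ 2 * S.kap ^ 2 * E ^ 6 * E ^ 6 := by gcongr
        _ = _ := by ring
    have hlog := Real.log_le_log (by positivity) hlow2
    rw [Real.log_mul (by positivity) hdet.ne'] at hlog
    have hl6 : Real.log (E ^ 6) = l / 2 := by
      have := hlogE 1
      rw [show E ^ (12 * 1) = (E ^ 6) ^ 2 by ring, Real.log_pow] at this
      push_cast at this; linarith
    rw [hl6] at hlog
    have hge : 9 / 2 * l ≤ Real.log (Vmat S x u t 0 0 * Vmat S x u t 1 1 - Vmat S x u t 0 1 ^ 2) +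
        Real.log (S.lam ^ 2) + 4 * l := by linarith
    calc S.alpha * Real.sqrt (9 / 2 * l) ≤ S.alpha * Real.sqrt (Real.log (Vmat S x u t 0 0 *
          Vmat S x u t 1 1 - Vmat S x u t 0 1 ^ 2) + Real.log (S.lam ^ 2) + 4 * l) := by gcongr
      _ ≤ _ := le_add_of_nonneg_right (by positivity)

theorem sqrt_ratio_le {S : Spec} {x u : ℕ → ℝ} {t : ℕ} {E l : ℝ} (hE : 0 < E) (hl : 0 < l)
    (hex : Excited x u t (S.kap * E ^ 6 / l ^ 6)) :
    Real.sqrt (max (Vmat S x u t 1 1) (Vmat S x u t 0 0) /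
      (Vmat S x u t 0 0 * Vmat S x u t 1 1 - Vmat S x u t 0 1 ^ 2)) ≤ S.radC * l ^ 3 / E ^ 3 := by
  have hk := S.kap_pos
  refine (Real.sqrt_le_sqrt ((hex.sqBound S).ratio_le (by positivity))).trans (le_of_eq ?_)
  have : 1 / (S.kap * E ^ 6 / l ^ 6) = 1 / S.kap * (l ^ 3 / E ^ 3) ^ 2 := by field_simp
  rw [this, Real.sqrt_mul (by positivity), Real.sqrt_sq (by positivity), Real.sqrt_div zero_le_one,
    Real.sqrt_one, Spec.radC]
  ring

/-- The mesh 1/(E⁶l³) is fine enough because the trace of V is at most E¹²l⁵, and E⁴ steps in each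
direction reach far enough because the excitation bounds the sup norm of the relevant vector by
y·polylog/E³. -/
theorem norm_est_sub_le (S : Spec) : ∃ A : ℝ, ∀ {T : ℕ} {E l y : ℝ} {x u w : ℕ → ℝ} {t : ℕ}
    {p : Problem S T}, Scale T E l → A ≤ l → l ^ 30 ≤ E → 2 ≤ y → y ≤ l → t ≤ T → Bdd S x u t l →
    Excited x u t (S.kap * E ^ 6 / l ^ 6) →
    (∀ i < t, x (i + 1) = p.thetaStar.1 * x i + p.thetaStar.2 * u i + w i) →
    GridOk S E l y x u w t →
    ‖p.thetaStar - thetaPre S x u t‖ ≤ (S.alpha ^ 2 * y + 5 * S.alpha ^ 2 +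
      3 * (Real.sqrt S.lam * (S.aHi + S.bHi))) *
      Real.sqrt (max (Vmat S x u t 1 1) (Vmat S x u t 0 0) /
      (Vmat S x u t 0 0 * Vmat S x u t 1 1 - Vmat S x u t 0 1 ^ 2)) := by
  obtain ⟨A₀, hA₀⟩ := trace_le S
  refine ⟨max A₀ (max 2 S.radC), fun {T E l y x u w t p} hs hA hE hy hyl ht hB hex hx hg => ?_⟩
  simp only [max_le_iff] at hA
  obtain ⟨h0, h1, h2⟩ := hA
  have hl : 0 < l := by linarith
  have hE0 := hs.E_pos
  have hlE : ∀ k ≤ 30, l ^ k ≤ E := fun k hk => (pow_le_pow_right₀ (by linarith) hk).trans hE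
  have htr := hA₀ hs h0 ht hB
  obtain ⟨n1, n2⟩ := thetaPre_sub_normal S hx
  have p0 := Vmat_zero_zero_pos S x u t
  have p1 := Vmat_one_one_pos S x u t
  have hdet := Vmat_det_pos S x u t
  have hratio := sqrt_ratio_le (S := S) hE0 hl hex
  have hlam := S.lam_pos
  have haH := S.aHi_pos
  have hbH := S.bHi_pos
  obtain ⟨En, hEn⟩ := hs.E_nat
  have hth1 : p.thetaStar.1 ^ 2 ≤ S.aHi ^ 2 :=
    pow_le_pow_left₀ (S.aLo_pos.le.trans p.a_mem.1) p.a_mem.2 2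
  have hth2 : p.thetaStar.2 ^ 2 ≤ S.bHi ^ 2 :=
    pow_le_pow_left₀ (S.bLo_pos.le.trans p.b_mem.1) p.b_mem.2 2
  set d := thetaPre S x u t - p.thetaStar with hd
  have hmain := sqrt_quad_error_le (α := S.alpha) (y := y) (h := 1 / (E ^ 6 * l ^ 3))
    (τ := Real.sqrt S.lam * (S.aHi + S.bHi)) (R := En ^ 4) n1 n2 hlam p0 p1 hdet
    (fun a b => by
      have := Vq_eq S x u t a b
      unfold Vq at this
      rw [this]
      linarith [qf_nonneg x u t a b]) (by positivity)
    (by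
      rw [mul_pow, Real.sq_sqrt hlam.le]
      refine mul_le_mul_of_nonneg_left ?_ hlam.le
      nlinarith [mul_pos haH hbH]) hy (by positivity)
    (by
      have e1 : (1 / (E ^ 6 * l ^ 3)) ^ 2 * (2 * (E ^ 12 * l ^ 5)) = 2 / l := by field_simp
      calc _ ≤ (1 / (E ^ 6 * l ^ 3)) ^ 2 * (2 * (E ^ 12 * l ^ 5)) := by gcongr
        _ = 2 / l := e1
        _ ≤ 1 := by rw [div_le_one hl]; exact h1)
    (by
      push_cast
      rw [← hEn]
      calc _ ≤ l * (l * l ^ 3 / E ^ 3) := by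
            refine mul_le_mul hyl (hratio.trans ?_) (Real.sqrt_nonneg _) hl.le
            gcongr
        _ ≤ E ^ 4 * (1 / (E ^ 6 * l ^ 3)) := by
            have e1 : E ^ 4 * (1 / (E ^ 6 * l ^ 3)) = 1 / (E ^ 2 * l ^ 3) := by field_simp
            rw [e1, ← mul_div_assoc, div_le_div_iff₀ (by positivity) (by positivity)]
            have := hlE 8 (by norm_num)
            calc l * (l * l ^ 3) * (E ^ 2 * l ^ 3) = E ^ 2 * l ^ 8 := by ring
              _ ≤ E ^ 2 * E := by gcongr
              _ = 1 * E ^ 3 := by ring)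
    (fun i j hi hj => by
      have := hg i j (by rw [hEn]; exact_mod_cast hi) (by rw [hEn]; exact_mod_cast hj)
      refine le_trans ?_ this
      have hV := Vq_eq S x u t (i * (1 / (E ^ 6 * l ^ 3))) (j * (1 / (E ^ 6 * l ^ 3)))
      unfold Vq at hV
      rw [hV]
      rw [Finset.sum_sub_distrib, ← Finset.mul_sum, Finset.mul_sum, Finset.mul_sum,
        ← Finset.sum_add_distrib]
      have e1 : ∑ k ∈ Finset.range t, (i * (1 / (E ^ 6 * l ^ 3)) * (x k * w k) +
          j * (1 / (E ^ 6 * l ^ 3)) * (u k * w k)) = ∑ k ∈ Finset.range t,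
          (i * (1 / (E ^ 6 * l ^ 3)) * x k + j * (1 / (E ^ 6 * l ^ 3)) * u k) * w k :=
        Finset.sum_congr rfl fun _ _ => by ring
      rw [e1, qf]
      have : 0 ≤ S.alpha ^ 2 / 2 * (S.lam * ((i * (1 / (E ^ 6 * l ^ 3))) ^ 2 +
          (j * (1 / (E ^ 6 * l ^ 3))) ^ 2)) := by positivity
      linarith)
  rw [norm_sub_rev, ← hd, Prod.norm_def, Real.norm_eq_abs, Real.norm_eq_abs]
  exact (sq_le_quad p0 hdet d.1 d.2).trans
    (mul_le_mul_of_nonneg_right hmain (Real.sqrt_nonneg _))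

/-! ### Control of the exploitation rounds -/

/-- A small uncertainty box near the initial uncertainty set. -/
structure NiceBox (S : Spec) (c : ℝ × ℝ) (e l : ℝ) : Prop where
  nonneg : 0 ≤ e
  le_half : e ≤ 1 / 2
  le_b : e ≤ S.bLo / 4
  le_pow : e ≤ 1 / l ^ 6
  a_le : |c.1| ≤ S.aHi + 1 / 2
  b_ge : 3 / 4 * S.bLo ≤ c.2
  b_le : c.2 ≤ S.bHi + 1 / 2

theorem NiceBox.lt {S : Spec} {c : ℝ × ℝ} {e l : ℝ} (h : NiceBox S c e l) : e < c.2 := by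
  have := S.bLo_pos
  linarith [h.le_b, h.b_ge]

theorem center_mem_box {c : ℝ × ℝ} {e : ℝ} (he : 0 ≤ e) : c ∈ box c e := by
  simp [box, he]

theorem niceBox_of_close {S : Spec} {T : ℕ} {p : Problem S T} {c : ℝ × ℝ} {e l D : ℝ}
    (he : 0 ≤ e) (heD : e ≤ D) (hc : ‖p.thetaStar - c‖ ≤ D) (hD1 : D ≤ 1 / 2)
    (hD2 : D ≤ S.bLo / 4) (hD3 : D ≤ 1 / l ^ 6) : NiceBox S c e l := by
  rw [Prod.norm_def, max_le_iff, Real.norm_eq_abs, Real.norm_eq_abs, abs_le, abs_le] at hc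
  simp only [Prod.fst_sub, Prod.snd_sub] at hc
  obtain ⟨⟨h1, h2⟩, h3, h4⟩ := hc
  have ha := p.a_mem
  have hb := p.b_mem
  have := S.aLo_pos
  exact ⟨he, heD.trans hD1, heD.trans hD2, heD.trans hD3,
    abs_le.2 ⟨by linarith [ha.1, S.aHi_pos], by linarith [ha.2]⟩, by linarith [hb.1], by linarith [hb.2]⟩

/-- The clipped control is safe for the center of the box, so under the true dynamics the drift
exceeds the boundaries by at most D(|x| + |u|) ≤ l². This leaves room for noise of size l² and
reproduces |x| ≤ 3l² at the next time. Closeness to θ* suffices: θ* need not belong to the box. -/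
theorem NiceBox.step (S : Spec) : ∃ A : ℝ, ∀ {T : ℕ} {p : Problem S T} {c : ℝ × ℝ} {e l D x u c' : ℝ},
    NiceBox S c e l → Real.log T = l → A ≤ l → |x| ≤ 3 * l ^ 2 → ‖p.thetaStar - c‖ ≤ D →
    D ≤ 1 / l ^ 6 → u = max (min c' (safeU p.DU c e x)) (safeL p.DL c e x) →
    (safeL p.DL c e x ≤ u ∧ u ≤ safeU p.DU c e x) ∧ |u| ≤ S.Cu * l ^ 2 ∧
      |p.thetaStar.1 * x + p.thetaStar.2 * u| ≤ 2 * l ^ 2 := by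
  refine ⟨max 1 (max (3 + S.Cu) (4 * (6 * (S.bHi + 1) + 2 + 6 * (S.aHi + 1)) / S.bLo)),
    fun {T p c e l D x u c'} hn hlog hA hx hc hD hu => ?_⟩
  simp only [max_le_iff] at hA
  obtain ⟨hA1, hA2, hA3⟩ := hA
  have hl : 0 < l := by linarith
  have hb := S.bLo_pos
  have hbH := S.bHi_pos
  have haH := S.aHi_pos
  have hDL := p.DL_ge
  have hDU := p.DU_le
  have hgap := p.gap
  rw [hlog] at hDL hDU hgap
  have hd1 : S.bLo / 2 ≤ c.2 - e := by linarith [hn.b_ge, hn.le_b]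
  have hd2 : c.2 - e ≤ S.bHi + 1 := by linarith [hn.b_le, hn.nonneg]
  have hLU : safeL p.DL c e x ≤ safeU p.DU c e x := by
    refine safeL_le_safeU hn.nonneg hn.lt ?_
    have e1 : |p.DL| ≤ l ^ 2 := abs_le.2 ⟨hDL, by linarith [p.DL_neg, sq_nonneg l]⟩
    have e2 : |p.DU| ≤ l ^ 2 := abs_le.2 ⟨by linarith [p.DU_pos, sq_nonneg l], hDU⟩
    have e3 : 2 * |x| * (c.2 - e) ≤ 2 * (3 * l ^ 2) * (S.bHi + 1) :=
      mul_le_mul (by linarith) hd2 (by linarith) (by positivity)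
    have e4 : 2 * (|c.1| + e) * |x| ≤ 2 * (S.aHi + 1) * (3 * l ^ 2) :=
      mul_le_mul (by linarith [hn.a_le, hn.le_half]) hx (abs_nonneg _) (by positivity)
    set K := 6 * (S.bHi + 1) + 2 + 6 * (S.aHi + 1) with hK
    have hK0 : 0 < K := by positivity
    calc e * (2 * |x| * (c.2 - e) + |p.DL| + |p.DU| + 2 * (|c.1| + e) * |x|) ≤
          1 / l ^ 6 * (K * l ^ 2) := by
            refine mul_le_mul hn.le_pow (by rw [hK]; linarith) ?_ (by positivity)
            have : 0 ≤ 2 * |x| * (c.2 - e) := mul_nonneg (by positivity) (by linarith)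
            have := hn.nonneg
            positivity
      _ = K / l ^ 4 := by field_simp
      _ ≤ K / l ^ 2 := by gcongr <;> linarith
      _ < 1 / l * (S.bLo / 2) := by
          rw [div_le_iff₀ hb] at hA3
          rw [div_mul_div_comm, one_mul, div_lt_div_iff₀ (by positivity) (by positivity)]
          nlinarith
      _ ≤ (p.DU - p.DL) * (c.2 - e) := mul_le_mul hgap hd1 (by positivity) (by
          linarith [p.DL_neg, p.DU_pos])
  have hu1 : safeL p.DL c e x ≤ u := hu ▸ le_max_right _ _
  have hu2 : u ≤ safeU p.DU c e x := hu ▸ max_le (min_le_right _ _) hLU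
  have s1 := le_of_le_safeU hn.nonneg hn.lt hu2 (center_mem_box hn.nonneg)
  have s2 := ge_of_safeL_le hn.nonneg hn.lt hu1 (center_mem_box hn.nonneg)
  have hub : |u| ≤ S.Cu * l ^ 2 := abs_control_le p hDL hDU
    (by linarith [hn.a_le]) (by linarith [hn.b_ge]) hx s2 s1
  refine ⟨⟨hu1, hu2⟩, hub, ?_⟩
  rw [Prod.norm_def, max_le_iff, Real.norm_eq_abs, Real.norm_eq_abs] at hc
  simp only [Prod.fst_sub, Prod.snd_sub] at hc
  have hD0 : 0 ≤ D := (abs_nonneg _).trans hc.1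
  have h1 : |(p.thetaStar.1 - c.1) * x| ≤ D * (3 * l ^ 2) := by
    rw [abs_mul]; exact mul_le_mul hc.1 hx (abs_nonneg _) hD0
  have h2 : |(p.thetaStar.2 - c.2) * u| ≤ D * (S.Cu * l ^ 2) := by
    rw [abs_mul]; exact mul_le_mul hc.2 hub (abs_nonneg _) hD0
  have h3 : D * (3 * l ^ 2) + D * (S.Cu * l ^ 2) ≤ l ^ 2 := by
    have h4 : D * (3 + S.Cu) ≤ 1 := by
      calc D * (3 + S.Cu) ≤ 1 / l ^ 6 * l := by
            have := S.Cu_pos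
            gcongr
        _ = 1 / l ^ 5 := by field_simp
        _ ≤ 1 := by rw [div_le_one (by positivity)]; exact one_le_pow₀ hA1
    nlinarith [sq_nonneg l]
  rw [abs_le] at h1 h2 ⊢
  constructor <;> linarith

/-- What is known about a trajectory on the good events. -/
structure CoreOk {S : Spec} {T : ℕ} (p : Problem S T) (x u : ℕ → ℝ) (E l : ℝ) : Prop where
  bdd : ∀ s < rounds T, Bdd S x u (2 * start T s) l
  excited : Excited x u (warm T) (S.kap * E ^ 6 / l ^ 6)
  rad_le : ∀ s < rounds T, radius S T x u (start T s) ≤ S.radC * l ^ 4 / E ^ 3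
  nice : ∀ s < rounds T, NiceBox S (thetaPre S x u (start T s)) (radius S T x u (start T s)) l
  sandwich : ∀ s < rounds T, ∀ t, start T s ≤ t → t < 2 * start T s →
    safeL p.DL (thetaPre S x u (start T s)) (radius S T x u (start T s)) (x t) ≤ u t ∧
    u t ≤ safeU p.DU (thetaPre S x u (start T s)) (radius S T x u (start T s)) (x t)

theorem Bdd.mono {S : Spec} {x u : ℕ → ℝ} {s t : ℕ} {l : ℝ} (h : Bdd S x u t l) (hst : s ≤ t) :
    Bdd S x u s l :=
  ⟨fun i hi => h.1 i (hi.trans hst), fun i hi => h.2 i (hi.trans_le hst)⟩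

/-- A bootstrap over rounds: boundedness up to T_s yields a small radius and an accurate estimate;
these keep the trajectory bounded through the round, hence up to 2T_s = T_{s+1}. The level y may be
crude here, since the argument does not require θ* to lie in the uncertainty sets. -/
theorem traj_core (S : Spec) : ∃ A : ℝ, ∀ {T : ℕ} {p : Problem S T} {x u w φ : ℕ → ℝ} {E l y : ℝ},
    Traj p x u w φ → NoiseOk S T w φ → Scale T E l → WarmOk p x φ E l → A ≤ l → l ^ 30 ≤ E →
    2 ≤ y → y ≤ l → S.alpha ^ 2 * y ≤ l / 2 → (∀ s < rounds T, GridOk S E l y x u w (start T s)) →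
    CoreOk p x u E l := by
  obtain ⟨A₀, hA₀⟩ := warm_excited S
  obtain ⟨A₁, hA₁⟩ := Bconf_bounds S
  obtain ⟨A₂, hA₂⟩ := norm_est_sub_le S
  obtain ⟨A₃, hA₃⟩ := NiceBox.step S
  refine ⟨max A₀ (max A₁ (max A₂ (max A₃ (max 1 (max (2 * (5 * S.alpha ^ 2 +
    3 * (Real.sqrt S.lam * (S.aHi + S.bHi)))) (max S.radC (max 2 (4 / S.bLo)))))))),
    fun {T p x u w φ E l y} h hN hs hW hA hE hy hyl hyα hG => ?_⟩
  simp only [max_le_iff] at hA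
  obtain ⟨a0, a1, a2, a3, h1, h2, h3, h4, h5⟩ := hA
  have hl : 0 < l := by linarith
  have hE0 := hs.E_pos
  have hrC := S.radC_pos
  have hlog : 0 < Real.log T := by rw [hs.log_eq]; exact hl
  have hwT : warm T ≤ T := by
    have := hs.warm_mul; have := hs.warm_pos; nlinarith
  have hex := hA₀ h hN hs hW a0 hE
  set D := S.radC * l ^ 4 / E ^ 3 with hD
  have hDl : D ≤ 1 / l ^ 6 := by
    have e1 : l ^ 11 ≤ E ^ 3 := ((pow_le_pow_right₀ h1 (by norm_num)).trans hE).trans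
      (le_self_pow₀ hs.one_le (by norm_num))
    rw [hD, div_le_div_iff₀ (by positivity) (by positivity)]
    calc S.radC * l ^ 4 * l ^ 6 ≤ l * l ^ 4 * l ^ 6 := by gcongr
      _ = l ^ 11 := by ring
      _ ≤ 1 * E ^ 3 := by linarith
  have hl6 : 1 / l ^ 6 ≤ 1 / l := one_div_le_one_div_of_le hl (le_self_pow₀ h1 (by norm_num))
  have hD1 : D ≤ 1 / 2 := (hDl.trans hl6).trans (one_div_le_one_div_of_le (by norm_num) h4)
  have hD2 : D ≤ S.bLo / 4 := by
    refine (hDl.trans hl6).trans ?_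
    have hb := S.bLo_pos
    rw [div_le_iff₀ hb] at h5
    rw [div_le_div_iff₀ hl (by norm_num)]
    linarith
  have round : ∀ s < rounds T, Bdd S x u (start T s) l →
      (radius S T x u (start T s) ≤ D ∧ ‖p.thetaStar - thetaPre S x u (start T s)‖ ≤ D) := by
    intro s hsr hB
    have hst : start T s ≤ T := (hs.start_lt hsr).le
    have hex' := hex.mono (Scale.warm_le_start T s)
    have hBc := (hA₁ hs a1 hE hex').1 hst hB
    have hrat := sqrt_ratio_le (S := S) hE0 hl hex'
    -- The same D bounds the radius and the estimation error, since both prefactors are at most l.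
    have hDe : D = l * (S.radC * l ^ 3 / E ^ 3) := by rw [hD]; ring
    constructor
    · rw [hDe, radius]
      exact mul_le_mul hBc hrat (Real.sqrt_nonneg _) hl.le
    · have := hA₂ hs a2 hE hy hyl hst hB hex' (fun i hi => h.x_succ i (by omega)) (hG s hsr)
      rw [hDe]
      refine this.trans (mul_le_mul (by linarith) hrat (Real.sqrt_nonneg _) hl.le)
  have nice : ∀ s < rounds T, Bdd S x u (start T s) l →
      NiceBox S (thetaPre S x u (start T s)) (radius S T x u (start T s)) l := fun s hsr hB =>
    niceBox_of_close (radius_nonneg _ _ _ _ _) (round s hsr hB).1 (round s hsr hB).2 hD1 hD2 hDl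
  have stepOk : ∀ s < rounds T, Bdd S x u (start T s) l → ∀ t, start T s ≤ t → t < 2 * start T s →
      |x t| ≤ 3 * l ^ 2 →
      (safeL p.DL (thetaPre S x u (start T s)) (radius S T x u (start T s)) (x t) ≤ u t ∧
      u t ≤ safeU p.DU (thetaPre S x u (start T s)) (radius S T x u (start T s)) (x t)) ∧
      |u t| ≤ S.Cu * l ^ 2 ∧ |p.thetaStar.1 * x t + p.thetaStar.2 * u t| ≤ 2 * l ^ 2 := by
    intro s hsr hB t ht1 ht2 hx
    obtain ⟨c', hc'⟩ := h.exploit s hsr t ht1 ht2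
    exact hA₃ (nice s hsr hB) hs.log_eq a3 hx (round s hsr hB).2 hDl hc'
  have extend : ∀ s < rounds T, Bdd S x u (start T s) l → ∀ t, start T s ≤ t → t ≤ 2 * start T s →
      Bdd S x u t l := by
    intro s hsr hB t ht
    have hT := hs.two_start_le hsr
    induction t, ht using Nat.le_induction with
    | base => exact fun _ => hB
    | succ t ht ih =>
      intro ht2
      have hBt := ih (by omega)
      obtain ⟨-, k2, k3⟩ := stepOk s hsr hB t ht (by omega) (hBt.1 t le_rfl)
      constructor
      · intro i hi
        rcases Nat.lt_or_ge i (t + 1) with hi' | hi'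
        · exact hBt.1 i (by omega)
        · obtain rfl : i = t + 1 := by omega
          rw [h.x_succ t (by omega)]
          have hw := hN.noise_le t (by omega)
          rw [hs.log_eq] at hw
          exact (abs_add_le _ _).trans (by linarith)
      · intro i hi
        rcases Nat.lt_or_ge i t with hi' | hi'
        · exact hBt.2 i hi'
        · obtain rfl : i = t := by omega
          exact k2
  have hB0 : Bdd S x u (start T 0) l := by
    have e : start T 0 = warm T := by simp [start]
    rw [e]
    constructor
    · intro i hi
      have := (h.warm_range hN hwT hlog hi).1.2.2
      rw [hs.log_eq] at this
      nlinarith [sq_nonneg l]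
    · intro i hi
      have := (h.warm_control hN hwT hlog hi).1
      rwa [hs.log_eq] at this
  have hBs : ∀ s < rounds T, Bdd S x u (start T s) l := by
    intro s
    induction s with
    | zero => exact fun _ => hB0
    | succ s ih =>
      intro hsr
      have e : start T (s + 1) = 2 * start T s := by unfold start; rw [pow_succ]; ring
      rw [e]
      exact extend s (by omega) (ih (by omega)) _ (by omega) le_rfl
  refine ⟨fun s hsr => extend s hsr (hBs s hsr) _ (by omega) le_rfl, hex,
    fun s hsr => (round s hsr (hBs s hsr)).1, fun s hsr => nice s hsr (hBs s hsr), ?_⟩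
  intro s hsr t ht1 ht2
  exact (stepOk s hsr (hBs s hsr) t ht1 ht2
    ((extend s hsr (hBs s hsr) t ht1 ht2.le).1 t le_rfl)).1

/-- On the good events with the sharp grid bounds, the true dynamics lie in all uncertainty sets. -/
theorem CoreOk.est_mem (S : Spec) : ∃ A : ℝ, ∀ {T : ℕ} {p : Problem S T} {x u w φ : ℕ → ℝ} {E l : ℝ},
    Traj p x u w φ → CoreOk p x u E l → Scale T E l → A ≤ l → l ^ 30 ≤ E →
    (∀ s < rounds T, GridOk S E l (2 * Real.sqrt l / S.alpha) x u w (start T s)) →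
    ∀ s < rounds T, ‖p.thetaStar - thetaPre S x u (start T s)‖ ≤ radius S T x u (start T s) := by
  obtain ⟨A₁, hA₁⟩ := Bconf_bounds S
  obtain ⟨A₂, hA₂⟩ := norm_est_sub_le S
  have ha := S.alpha_pos
  have hK : 0 ≤ 5 * S.alpha ^ 2 + 3 * (Real.sqrt S.lam * (S.aHi + S.bHi)) := by
    have := S.aHi_pos
    have := S.bHi_pos
    positivity
  set K := 5 * S.alpha ^ 2 + 3 * (Real.sqrt S.lam * (S.aHi + S.bHi)) with hKd
  refine ⟨max A₁ (max A₂ (max 1 (max (S.alpha ^ 2) (max (4 / S.alpha ^ 2)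
    ((10 * K / S.alpha) ^ 2))))), fun {T p x u w φ E l} h hC hs hA hE hG s hsr => ?_⟩
  simp only [max_le_iff] at hA
  obtain ⟨a1, a2, h1, h2, h3, h4⟩ := hA
  have hl : 0 < l := by linarith
  have hst : start T s ≤ T := (hs.start_lt hsr).le
  have hex' := hC.excited.mono (Scale.warm_le_start T s)
  have hB := (hC.bdd s hsr).mono (show start T s ≤ 2 * start T s by omega)
  have hsl : Real.sqrt l ^ 2 = l := Real.sq_sqrt hl.le
  have hsl0 : 0 ≤ Real.sqrt l := Real.sqrt_nonneg l
  have hy : 2 ≤ 2 * Real.sqrt l / S.alpha := by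
    rw [le_div_iff₀ ha]
    have : S.alpha ≤ Real.sqrt l := Real.le_sqrt_of_sq_le h2
    linarith
  have hyl : 2 * Real.sqrt l / S.alpha ≤ l := by
    rw [div_le_iff₀ ha]
    rw [div_le_iff₀ (by positivity)] at h3
    have : 2 ≤ Real.sqrt l * S.alpha := by
      refine le_of_sq_le_sq ?_ (by positivity)
      rw [mul_pow, hsl]; linarith
    nlinarith
  have hmain := hA₂ hs a2 hE hy hyl hst hB hex' (fun i hi => h.x_succ i (by omega)) (hG s hsr)
  refine hmain.trans ?_
  unfold radius
  refine mul_le_mul_of_nonneg_right (le_trans ?_ (hA₁ hs a1 hE hex').2) (Real.sqrt_nonneg _)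
  have e1 : S.alpha ^ 2 * (2 * Real.sqrt l / S.alpha) = S.alpha * (2 * Real.sqrt l) := by
    field_simp
  -- As 2.1² < 9/2, the confidence factor exceeds the leading error 2α√l by at least α√l/10, which
  -- dominates the constant K for large l.
  have e2 : 21 / 10 * Real.sqrt l ≤ Real.sqrt (9 / 2 * l) := by
    refine Real.le_sqrt_of_sq_le ?_
    rw [mul_pow, hsl]; linarith
  have e3 : 10 * K / S.alpha ≤ Real.sqrt l := Real.le_sqrt_of_sq_le h4
  rw [div_le_iff₀ ha] at e3
  have e4 := mul_le_mul_of_nonneg_left e2 ha.le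
  rw [e1]
  linarith

/-- Controls are safe once the true dynamics lie in all uncertainty sets. -/
theorem CoreOk.safe {S : Spec} {T : ℕ} {p : Problem S T} {x u w φ : ℕ → ℝ} {E l : ℝ}
    (hC : CoreOk p x u E l) (h : Traj p x u w φ) (hN : NoiseOk S T w φ) (hs : Scale T E l) (hl : 0 < l)
    (hest : ∀ s < rounds T,
      ‖p.thetaStar - thetaPre S x u (start T s)‖ ≤ radius S T x u (start T s)) {t : ℕ} (ht : t < T) :
    p.DL ≤ p.thetaStar.1 * x t + p.thetaStar.2 * u t ∧
      p.thetaStar.1 * x t + p.thetaStar.2 * u t ≤ p.DU := by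
  rcases Nat.lt_or_ge t (warm T) with hw | hw
  · have hwT : warm T ≤ T := by
      have := hs.warm_mul; have := hs.warm_pos; nlinarith
    exact ((h.warm_range hN hwT (by rw [hs.log_eq]; exact hl) hw.le).2 hw).1
  · have h1 := roundOf_lt hs hw ht
    obtain ⟨s1, s2⟩ := hC.sandwich _ h1 t (start_roundOf_le hs.warm_pos hw)
      (lt_two_start_roundOf hs.warm_pos)
    have hn := hC.nice _ h1
    exact ⟨ge_of_safeL_le hn.nonneg hn.lt s1 (hest _ h1),
      le_of_le_safeU hn.nonneg hn.lt s2 (hest _ h1)⟩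

/-! ### Exponential supermartingales -/

section Tools

variable {Ω : Type*} {m : MeasurableSpace Ω} [mΩ : MeasurableSpace Ω] {P : Measure Ω}

/-- The hypothesis says that E[f | m] ≤ 1, phrased as domination of measures on the σ-algebra m;
integrating an m-measurable function preserves the inequality. -/
theorem lintegral_mul_le_of_setLIntegral_le (hm : m ≤ mΩ) {f Y : Ω → ℝ≥0∞}
    (hf : Measurable f) (hY : Measurable[m] Y)
    (h : ∀ s, MeasurableSet[m] s → ∫⁻ ω in s, f ω ∂P ≤ P s) :
    ∫⁻ ω, f ω * Y ω ∂P ≤ ∫⁻ ω, Y ω ∂P := by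
  have hY' : Measurable Y := hY.mono hm le_rfl
  have e1 : ∫⁻ ω, f ω * Y ω ∂P = ∫⁻ ω, Y ω ∂(P.withDensity f) :=
    (lintegral_withDensity_eq_lintegral_mul P hf hY').symm
  rw [e1, ← lintegral_trim hm hY, ← lintegral_trim hm hY]
  refine lintegral_mono' (Measure.le_iff.2 fun s hs => ?_) le_rfl
  rw [trim_measurableSet_eq hm hs, trim_measurableSet_eq hm hs, withDensity_apply _ (hm _ hs)]
  exact h s hs

/-- The exponential of the partial sums is a supermartingale started at 1; Markov's inequality
finishes. Here `m i` is the information available before `ξ i`. -/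
theorem measureReal_exp_sum_gt_le [IsProbabilityMeasure P] (n : ℕ) {ξ : ℕ → Ω → ℝ}
    {m : ℕ → MeasurableSpace Ω} (hm : ∀ i < n, m i ≤ mΩ)
    (hmeas : ∀ i < n, ∀ j < i, Measurable[m i] (ξ j)) (hmeas' : ∀ i < n, Measurable (ξ i))
    (hstep : ∀ i < n, ∀ s, MeasurableSet[m i] s →
      ∫⁻ ω in s, ENNReal.ofReal (Real.exp (ξ i ω)) ∂P ≤ P s) (L : ℝ) :
    P.real {ω | L < ∑ i ∈ Finset.range n, ξ i ω} ≤ Real.exp (-L) := by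
  have key : ∀ k ≤ n, ∫⁻ ω, ENNReal.ofReal (Real.exp (∑ i ∈ Finset.range k, ξ i ω)) ∂P ≤ 1 := by
    intro k
    induction k with
    | zero => intro _; simp
    | succ k ih =>
      intro hk
      refine le_trans ?_ (ih (by omega))
      have e : ∀ ω, ENNReal.ofReal (Real.exp (∑ i ∈ Finset.range (k + 1), ξ i ω)) =
          ENNReal.ofReal (Real.exp (ξ k ω)) *
            ENNReal.ofReal (Real.exp (∑ i ∈ Finset.range k, ξ i ω)) := fun ω => by
        rw [← ENNReal.ofReal_mul (Real.exp_pos _).le, ← Real.exp_add, Finset.sum_range_succ,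
          add_comm]
      simp_rw [e]
      refine lintegral_mul_le_of_setLIntegral_le (hm k hk) ?_ ?_ (hstep k hk)
      · exact (Real.measurable_exp.comp (hmeas' k hk)).ennreal_ofReal
      · refine Measurable.ennreal_ofReal (Real.measurable_exp.comp ?_)
        exact Finset.measurable_sum _ fun j hj => hmeas k hk j (Finset.mem_range.1 hj)
  have hmm : Measurable fun ω => ENNReal.ofReal (Real.exp (∑ i ∈ Finset.range n, ξ i ω)) :=
    (Real.measurable_exp.comp (Finset.measurable_sum _ fun j hj =>
      hmeas' j (Finset.mem_range.1 hj))).ennreal_ofReal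
  have hmk := meas_ge_le_lintegral_div hmm.aemeasurable (μ := P)
    (ε := ENNReal.ofReal (Real.exp L)) (by simp [Real.exp_pos]) ENNReal.ofReal_ne_top
  have hsub : {ω | L < ∑ i ∈ Finset.range n, ξ i ω} ⊆
      {ω | ENNReal.ofReal (Real.exp L) ≤
        ENNReal.ofReal (Real.exp (∑ i ∈ Finset.range n, ξ i ω))} := fun ω hω =>
    ENNReal.ofReal_le_ofReal (Real.exp_le_exp.2 (le_of_lt hω))
  have h1 : P {ω | L < ∑ i ∈ Finset.range n, ξ i ω} ≤ ENNReal.ofReal (Real.exp (-L)) := by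
    refine (measure_mono hsub).trans (hmk.trans ?_)
    refine (ENNReal.div_le_div_right (key n le_rfl) _).trans (le_of_eq ?_)
    rw [Real.exp_neg, ENNReal.ofReal_inv_of_pos (Real.exp_pos _), one_div]
  exact ENNReal.toReal_le_of_le_ofReal (Real.exp_pos _).le h1

/-- Freezing lemma: conditionally on m, the variable X is a constant and W keeps its law. -/
theorem setLIntegral_indep_le [IsProbabilityMeasure P] (hm : m ≤ mΩ)
    {β : Type*} [MeasurableSpace β] {X : Ω → β} (hX : Measurable[m] X) {W : Ω → ℝ}
    (hW : Measurable W) (hind : Indep m (MeasurableSpace.comap W inferInstance) P)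
    {f : β × ℝ → ℝ≥0∞} (hf : Measurable f) (hle : ∀ b, ∫⁻ w, f (b, w) ∂(P.map W) ≤ 1)
    {s : Set Ω} (hs : MeasurableSet[m] s) : ∫⁻ ω in s, f (X ω, W ω) ∂P ≤ P s := by
  -- The indicator of s is carried along with X, so that one application of Fubini handles the
  -- restriction to s.
  set Y : Ω → ℝ≥0∞ × β := fun ω => (s.indicator 1 ω, X ω) with hY
  have hYm : Measurable[m] Y := Measurable.prodMk
    ((@measurable_const _ _ _ m (1 : ℝ≥0∞)).indicator hs) hX
  have hY' : Measurable Y := hYm.mono hm le_rfl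
  have hYW : IndepFun Y W P := by
    rw [IndepFun_iff_Indep]
    exact indep_of_indep_of_le_left hind hYm.comap_le
  have hprod := (indepFun_iff_map_prod_eq_prod_map_map hY'.aemeasurable hW.aemeasurable).1 hYW
  have hg : Measurable fun z : (ℝ≥0∞ × β) × ℝ => z.1.1 * f (z.1.2, z.2) :=
    (measurable_fst.comp measurable_fst).mul
      (hf.comp ((measurable_snd.comp measurable_fst).prodMk measurable_snd))
  have : IsProbabilityMeasure (P.map W) := Measure.isProbabilityMeasure_map hW.aemeasurable
  calc ∫⁻ ω in s, f (X ω, W ω) ∂P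
      = ∫⁻ ω, (fun z : (ℝ≥0∞ × β) × ℝ => z.1.1 * f (z.1.2, z.2)) (Y ω, W ω) ∂P := by
        rw [← lintegral_indicator (hm _ hs)]
        refine lintegral_congr fun ω => ?_
        by_cases h : ω ∈ s <;> simp [hY, h]
    _ = ∫⁻ z, z.1.1 * f (z.1.2, z.2) ∂((P.map Y).prod (P.map W)) := by
        rw [← hprod, lintegral_map hg (hY'.prodMk hW)]
    _ = ∫⁻ y, ∫⁻ w, y.1 * f (y.2, w) ∂(P.map W) ∂(P.map Y) := by
        rw [lintegral_prod _ hg.aemeasurable]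
    _ ≤ ∫⁻ y, y.1 ∂(P.map Y) := by
        refine lintegral_mono fun y => ?_
        rw [lintegral_const_mul _ (show Measurable fun w => f (y.2, w) from
          hf.comp (measurable_const.prodMk measurable_id))]
        exact mul_le_of_le_one_right zero_le (hle y.2)
    _ = P s := by
        rw [lintegral_map measurable_fst hY']
        simp only [hY]
        rw [lintegral_indicator_one (hm _ hs)]

/-! ### The three exponential moments -/

theorem lintegral_subgaussian_le (S : Spec) (z : ℝ) :
    ∫⁻ w, ENNReal.ofReal (Real.exp (z * w - S.alpha ^ 2 / 2 * z ^ 2)) ∂S.noise ≤ 1 := by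
  obtain ⟨h1, h2⟩ := S.subgaussian z
  have e : ∀ w, Real.exp (z * w - S.alpha ^ 2 / 2 * z ^ 2) =
      Real.exp (z * w) * Real.exp (-(S.alpha ^ 2 / 2 * z ^ 2)) := fun w => by
    rw [← Real.exp_add, sub_eq_add_neg]
  simp_rw [e]
  rw [← ofReal_integral_eq_lintegral_ofReal (h1.mul_const _)
    (Eventually.of_forall fun w => by positivity), integral_mul_const]
  rw [← ENNReal.ofReal_one]
  refine ENNReal.ofReal_le_ofReal ?_
  calc _ ≤ Real.exp (z ^ 2 * S.alpha ^ 2 / 2) * Real.exp (-(S.alpha ^ 2 / 2 * z ^ 2)) := by gcongr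
    _ = 1 := by
      rw [← Real.exp_add, Real.exp_eq_one_iff]; ring

theorem lintegral_sign_le (z : ℝ) :
    ∫⁻ w, ENNReal.ofReal (Real.exp (z * w - z ^ 2 / 2))
      ∂((1 / 2 : ℝ≥0∞) • Measure.dirac (1 : ℝ) + (1 / 2 : ℝ≥0∞) • Measure.dirac (-1 : ℝ)) ≤ 1 := by
  have hm : Measurable fun w : ℝ => ENNReal.ofReal (Real.exp (z * w - z ^ 2 / 2)) := by fun_prop
  rw [lintegral_add_measure, lintegral_smul_measure, lintegral_smul_measure,
    lintegral_dirac' _ hm, lintegral_dirac' _ hm]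
  have h2 : (1 / 2 : ℝ≥0∞) = ENNReal.ofReal (1 / 2) := by
    rw [ENNReal.ofReal_div_of_pos (by norm_num)]; simp
  rw [h2, smul_eq_mul, smul_eq_mul, ← ENNReal.ofReal_mul (by norm_num),
    ← ENNReal.ofReal_mul (by norm_num), ← ENNReal.ofReal_add (by positivity) (by positivity),
    ← ENNReal.ofReal_one]
  refine ENNReal.ofReal_le_ofReal ?_
  have hc := Real.cosh_le_exp_half_sq z
  have e : 1 / 2 * Real.exp (z * 1 - z ^ 2 / 2) + 1 / 2 * Real.exp (z * -1 - z ^ 2 / 2) =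
      Real.cosh z * Real.exp (-(z ^ 2 / 2)) := by
    rw [Real.cosh_eq, sub_eq_add_neg, sub_eq_add_neg, Real.exp_add, Real.exp_add, mul_one,
      mul_neg_one]
    ring
  rw [e]
  calc _ ≤ Real.exp (z ^ 2 / 2) * Real.exp (-(z ^ 2 / 2)) := by gcongr
    _ = 1 := by rw [← Real.exp_add]; simp

/-- The condition confines w to an interval of length 2h/|a|, and the density is at most `BP`. -/
theorem noise_affine_le (S : Spec) {η h a b : ℝ} (hη : 0 < η) (ha : η ≤ |a|) :
    S.noise {w | |a * w + b| < h} ≤ ENNReal.ofReal (2 * S.BP * h / η) := by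
  obtain ⟨f, -, hf, hn⟩ := S.bounded_density
  have ha0 : 0 < |a| := hη.trans_le ha
  have hane : a ≠ 0 := abs_pos.1 ha0
  have hsub : {w | |a * w + b| < h} ⊆ Set.Ioo (-b / a - h / η) (-b / a + h / η) := by
    intro w hw
    have hw' : |a * w + b| < h := hw
    have e : a * w + b = a * (w - -b / a) := by field_simp; ring
    rw [e, abs_mul] at hw'
    have h1 : η * |w - -b / a| < h := lt_of_le_of_lt
      (mul_le_mul_of_nonneg_right ha (abs_nonneg _)) hw'
    have h2 : |w - -b / a| < h / η := by rw [lt_div_iff₀ hη]; linarith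
    rw [abs_lt] at h2
    exact ⟨by linarith [h2.1], by linarith [h2.2]⟩
  refine (measure_mono hsub).trans ?_
  rw [hn, withDensity_apply _ measurableSet_Ioo]
  calc ∫⁻ x in Set.Ioo (-b / a - h / η) (-b / a + h / η), f x
      ≤ ∫⁻ x in Set.Ioo (-b / a - h / η) (-b / a + h / η), ENNReal.ofReal S.BP :=
        lintegral_mono fun x => hf x
    _ = ENNReal.ofReal S.BP * ENNReal.ofReal (-b / a + h / η - (-b / a - h / η)) := by
        rw [setLIntegral_const, Real.volume_Ioo]
    _ = ENNReal.ofReal (2 * S.BP * h / η) := by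
        rw [← ENNReal.ofReal_mul S.BP_pos.le]; congr 1; ring

-- A Bernoulli moment: exp(1_B) ≤ 1 + 2·1_B because e ≤ 3, and 1 + 2ρ ≤ exp(2ρ). The variable J
-- switches the increment on only at selected times.
open Classical in
theorem lintegral_count_le (S : Spec) {η h ρ : ℝ} (hη : 0 < η) (hh : 0 < h)
    (hρ : 2 * S.BP * h / η ≤ ρ) (J a b : ℝ) :
    ∫⁻ w, ENNReal.ofReal (Real.exp (if J = 1 then
      ((if η ≤ |a| ∧ |a * w + b| < h then (1 : ℝ) else 0) - 2 * ρ) else 0)) ∂S.noise ≤ 1 := by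
  have := S.prob
  by_cases hJ : J = 1
  swap
  · simp [hJ]
  have hρ0 : 0 ≤ ρ := le_trans (by have := S.BP_pos; positivity) hρ
  simp only [hJ, if_true]
  have hms : MeasurableSet {w : ℝ | η ≤ |a| ∧ |a * w + b| < h} := by
    have : Measurable fun w : ℝ => |a * w + b| := by fun_prop
    exact (MeasurableSet.const (η ≤ |a|)).inter (measurableSet_lt this measurable_const)
  have hP : S.noise {w : ℝ | η ≤ |a| ∧ |a * w + b| < h} ≤ ENNReal.ofReal ρ := by
    by_cases ha : η ≤ |a|
    · simp only [ha, true_and]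
      exact (noise_affine_le S hη ha).trans (ENNReal.ofReal_le_ofReal hρ)
    · simp [ha]
  have e : ∀ w, ENNReal.ofReal (Real.exp ((if η ≤ |a| ∧ |a * w + b| < h then (1 : ℝ) else 0) -
      2 * ρ)) ≤ ENNReal.ofReal (Real.exp (-(2 * ρ))) + ENNReal.ofReal (2 * Real.exp (-(2 * ρ))) *
      Set.indicator {w : ℝ | η ≤ |a| ∧ |a * w + b| < h} 1 w := by
    intro w
    by_cases hw : η ≤ |a| ∧ |a * w + b| < h
    · rw [if_pos hw, Set.indicator_of_mem (show w ∈ {w : ℝ | η ≤ |a| ∧ |a * w + b| < h} from hw),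
        Pi.one_apply, mul_one, ← ENNReal.ofReal_add (by positivity) (by positivity)]
      refine ENNReal.ofReal_le_ofReal ?_
      rw [sub_eq_add_neg, Real.exp_add]
      have := Real.exp_one_lt_d9
      nlinarith [Real.exp_pos (-(2 * ρ))]
    · rw [if_neg hw, Set.indicator_of_notMem (show w ∉ {w : ℝ | η ≤ |a| ∧ |a * w + b| < h} from hw),
        mul_zero, add_zero, zero_sub]
  refine (lintegral_mono e).trans ?_
  rw [lintegral_add_left measurable_const, lintegral_const, measure_univ, mul_one,
    lintegral_const_mul _ (measurable_one.indicator hms), lintegral_indicator_one hms]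
  calc _ ≤ ENNReal.ofReal (Real.exp (-(2 * ρ))) + ENNReal.ofReal (2 * Real.exp (-(2 * ρ))) *
        ENNReal.ofReal ρ := by gcongr
    _ = ENNReal.ofReal (Real.exp (-(2 * ρ)) * (2 * ρ + 1)) := by
        rw [← ENNReal.ofReal_mul (by positivity), ← ENNReal.ofReal_add (by positivity)
          (by positivity)]
        congr 1; ring
    _ ≤ 1 := by
        rw [← ENNReal.ofReal_one]
        refine ENNReal.ofReal_le_ofReal ?_
        calc _ ≤ Real.exp (-(2 * ρ)) * Real.exp (2 * ρ) := by
              gcongr; exact Real.add_one_le_exp _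
          _ = 1 := by rw [← Real.exp_add]; simp

-- The companion lower-tail moment: on I the set A has conditional probability at least p, and since
-- 1/e ≤ 1/2 the moment is at most exp(p/2)(1 - p/2) ≤ 1.
open Classical in
theorem setLIntegral_lower_le [IsProbabilityMeasure P] (hm : m ≤ mΩ)
    {I A : Set Ω} (hI : MeasurableSet[m] I) (hA : MeasurableSet A) {p : ℝ}
    (hp : ∀ s, MeasurableSet[m] s → p * P.real (s ∩ I) ≤ P.real (s ∩ I ∩ A)) {s : Set Ω}
    (hs : MeasurableSet[m] s) :
    ∫⁻ ω in s, ENNReal.ofReal (Real.exp (if ω ∈ I then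
      (p / 2 - if ω ∈ A then (1 : ℝ) else 0) else 0)) ∂P ≤ P s := by
  have hI' := hm _ hI
  have hs' := hm _ hs
  have e : ∀ ω, ENNReal.ofReal (Real.exp (if ω ∈ I then
      (p / 2 - if ω ∈ A then (1 : ℝ) else 0) else 0)) =
      (Iᶜ).indicator 1 ω + (ENNReal.ofReal (Real.exp (p / 2)) * (I \ A).indicator 1 ω +
        ENNReal.ofReal (Real.exp (p / 2 - 1)) * (I ∩ A).indicator 1 ω) := by
    intro ω
    by_cases h1 : ω ∈ I <;> by_cases h2 : ω ∈ A <;> simp [h1, h2]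
  simp_rw [e]
  rw [lintegral_add_left (measurable_one.indicator hI'.compl),
    lintegral_add_left ((measurable_one.indicator (hI'.diff hA)).const_mul _),
    lintegral_const_mul _ (measurable_one.indicator (hI'.diff hA)),
    lintegral_const_mul _ (measurable_one.indicator (hI'.inter hA)),
    lintegral_indicator_one hI'.compl, lintegral_indicator_one (hI'.diff hA),
    lintegral_indicator_one (hI'.inter hA), Measure.restrict_apply hI'.compl,
    Measure.restrict_apply (hI'.diff hA), Measure.restrict_apply (hI'.inter hA)]
  have r : ∀ t : Set Ω, P t = ENNReal.ofReal (P.real t) := fun t => (ofReal_measureReal).symm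
  rw [r (Iᶜ ∩ s), r (I \ A ∩ s), r (I ∩ A ∩ s), r s, ← ENNReal.ofReal_mul (Real.exp_pos _).le,
    ← ENNReal.ofReal_mul (Real.exp_pos _).le, ← ENNReal.ofReal_add (by positivity) (by positivity),
    ← ENNReal.ofReal_add (by positivity) (by positivity)]
  refine ENNReal.ofReal_le_ofReal ?_
  have h1 : P.real s = P.real (s ∩ I) + P.real (Iᶜ ∩ s) := by
    rw [← measureReal_inter_add_sdiff (μ := P) (s := s) hI', Set.sdiff_eq, Set.inter_comm s Iᶜ]
  have h2 : P.real (s ∩ I) = P.real (I ∩ A ∩ s) + P.real (I \ A ∩ s) := by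
    rw [← measureReal_inter_add_sdiff (μ := P) (s := s ∩ I) hA]
    congr 2 <;> ext ω <;> simp only [Set.mem_inter_iff, Set.mem_sdiff] <;> tauto
  have h3 := hp s hs
  rw [show s ∩ I ∩ A = I ∩ A ∩ s by ext ω; simp only [Set.mem_inter_iff]; tauto] at h3
  have h4 : Real.exp (p / 2 - 1) ≤ Real.exp (p / 2) * (1 / 2) := by
    rw [sub_eq_add_neg, Real.exp_add]
    gcongr
    rw [Real.exp_neg, ← one_div]
    exact one_div_le_one_div_of_le (by norm_num) (by linarith [Real.exp_one_gt_d9])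
  have h5 : Real.exp (p / 2) * P.real (I \ A ∩ s) + Real.exp (p / 2 - 1) * P.real (I ∩ A ∩ s) ≤
      Real.exp (p / 2) * ((1 - p / 2) * P.real (s ∩ I)) := by
    calc _ ≤ Real.exp (p / 2) * P.real (I \ A ∩ s) + Real.exp (p / 2) * (1 / 2) *
          P.real (I ∩ A ∩ s) := by gcongr
      _ = Real.exp (p / 2) * (P.real (s ∩ I) - 1 / 2 * P.real (I ∩ A ∩ s)) := by rw [h2]; ring
      _ ≤ _ := by gcongr; linarith
  have h6 : Real.exp (p / 2) * (1 - p / 2) ≤ 1 := by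
    calc _ ≤ Real.exp (p / 2) * Real.exp (-(p / 2)) := by
          gcongr; have := Real.add_one_le_exp (-(p / 2)); linarith
      _ = 1 := by rw [← Real.exp_add]; simp
  have h7 := mul_le_mul_of_nonneg_right h6 (measureReal_nonneg (μ := P) (s := s ∩ I))
  linarith

/-! ### Conditional probabilities given a likely event -/

theorem measureReal_inter_eq_setIntegral_condExp [IsProbabilityMeasure P]
    (hm : m ≤ mΩ) {B s : Set Ω} (hB : MeasurableSet B) (hs : MeasurableSet[m] s) :
    ∫ ω in s, (P[B.indicator (fun _ => (1 : ℝ)) | m]) ω ∂P = P.real (s ∩ B) := by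
  rw [setIntegral_condExp hm ((integrable_const (1 : ℝ)).indicator hB) hs,
    setIntegral_indicator hB, setIntegral_const, smul_eq_mul, mul_one]

/-- Where the conditional probability of `A` given `E` is at least `γ`, and `E` is conditionally
likely. -/
def likely (P : Measure Ω) (m : MeasurableSpace Ω) (E A : Set Ω) (γ : ℝ) : Set Ω :=
  {ω | γ ≤ @condProb Ω mΩ P m E A ω ∧ 1 / 2 ≤ (P[E.indicator (fun _ => (1 : ℝ)) | m]) ω}

theorem measurableSet_likely (E A : Set Ω) (γ : ℝ) :
    MeasurableSet[m] (likely P m E A γ) := by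
  have h1 : Measurable[m] (P[E.indicator (fun _ => (1 : ℝ)) | m]) :=
    stronglyMeasurable_condExp.measurable
  have h2 : Measurable[m] (P[(A ∩ E).indicator (fun _ => (1 : ℝ)) | m]) :=
    stronglyMeasurable_condExp.measurable
  exact MeasurableSet.inter (measurableSet_le measurable_const (h2.div h1))
    (measurableSet_le measurable_const h1)

/-- P(A | m) ≥ P(A ∩ E | m) ≥ γ P(E | m) ≥ γ/2 on the selected set. This removes the conditioning on
E, an event that depends on the future. -/
theorem likely_spec [IsProbabilityMeasure P] (hm : m ≤ mΩ) {E A : Set Ω}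
    (hE : MeasurableSet E) (hA : MeasurableSet A) {γ : ℝ} (hγ : 0 < γ) (s : Set Ω)
    (hs : MeasurableSet[m] s) :
    γ / 2 * P.real (s ∩ likely P m E A γ) ≤ P.real (s ∩ likely P m E A γ ∩ A) := by
  have hI := measurableSet_likely (m := m) (P := P) E A γ
  have hsI : MeasurableSet[m] (s ∩ likely P m E A γ) := MeasurableSet.inter hs hI
  have h1 := measureReal_inter_eq_setIntegral_condExp (P := P) hm (hA.inter hE) hsI
  have h2 : P.real (s ∩ likely P m E A γ ∩ (A ∩ E)) ≤ P.real (s ∩ likely P m E A γ ∩ A) :=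
    measureReal_mono (Set.inter_subset_inter_right _ Set.inter_subset_left)
  refine le_trans ?_ h2
  rw [← h1]
  calc γ / 2 * P.real (s ∩ likely P m E A γ) = ∫ ω in s ∩ likely P m E A γ, γ / 2 ∂P := by
        rw [setIntegral_const, smul_eq_mul, mul_comm]
    _ ≤ _ := by
        refine setIntegral_mono_on (integrable_const _).integrableOn
          integrable_condExp.integrableOn (hm _ hsI) fun ω hω => ?_
        obtain ⟨k1, k2⟩ := hω.2
        unfold condProb at k1
        rw [le_div_iff₀ (by linarith)] at k1
        nlinarith

/-- Decompose by the first index at which the conditional probability drops below 1/2. On each piece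
Eᶜ has at least half of the mass, and the pieces are disjoint, so no factor n is lost. -/
theorem measureReal_exists_condExp_lt [IsProbabilityMeasure P] {n : ℕ} {m : ℕ → MeasurableSpace Ω}
    (hm : ∀ i < n, m i ≤ mΩ) (hmono : Monotone m) {E : Set Ω} (hE : MeasurableSet E) :
    P.real {ω | ∃ i < n, (P[E.indicator (fun _ => (1 : ℝ)) | m i]) ω < 1 / 2} ≤
      2 * P.real Eᶜ := by
  set g : ℕ → Ω → ℝ := fun i => P[E.indicator (fun _ => (1 : ℝ)) | m i] with hg
  have hgm : ∀ i, Measurable[m i] (g i) := fun i => stronglyMeasurable_condExp.measurable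
  have hgs : ∀ i, MeasurableSet[m i] {ω | g i ω < 1 / 2} := fun i =>
    measurableSet_lt (hgm i) measurable_const
  have hD : ∀ k, {ω | ∃ i < k + 1, g i ω < 1 / 2} =
      {ω | ∃ i < k, g i ω < 1 / 2} ∪ ({ω | g k ω < 1 / 2} \ {ω | ∃ i < k, g i ω < 1 / 2}) := by
    intro k
    rw [Set.union_sdiff_self]
    ext ω
    simp only [Set.mem_ofPred_eq, Set.mem_union, Nat.lt_succ_iff_lt_or_eq]
    constructor
    · rintro ⟨i, hi | rfl, h⟩
      · exact Or.inl ⟨i, hi, h⟩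
      · exact Or.inr h
    · rintro (⟨i, hi, h⟩ | h)
      · exact ⟨i, Or.inl hi, h⟩
      · exact ⟨k, Or.inr rfl, h⟩
  have hDm : ∀ k, MeasurableSet[m k] {ω | ∃ i < k, g i ω < 1 / 2} := by
    intro k
    have : {ω | ∃ i < k, g i ω < 1 / 2} = ⋃ i ∈ Finset.range k, {ω | g i ω < 1 / 2} := by
      ext ω; simp
    rw [this]
    exact Finset.measurableSet_biUnion _ fun i hi => hmono (Finset.mem_range.1 hi).le _ (hgs i)
  have key : ∀ k ≤ n, P.real {ω | ∃ i < k, g i ω < 1 / 2} ≤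
      2 * P.real ({ω | ∃ i < k, g i ω < 1 / 2} ∩ Eᶜ) := by
    intro k
    induction k with
    | zero => intro _; simp
    | succ k ih =>
      intro hk
      have hmk := hm k (by omega)
      have ih := ih (by omega)
      set D := {ω | ∃ i < k, g i ω < 1 / 2} with hDd
      set N := {ω | g k ω < 1 / 2} \ D with hN
      have hNm : MeasurableSet[m k] N := MeasurableSet.diff (hgs k) (hDm k)
      have hdisj : Disjoint D N := Set.disjoint_sdiff_right
      rw [hD k, measureReal_union hdisj (hmk _ hNm), Set.union_inter_distrib_right,
        measureReal_union (hdisj.mono Set.inter_subset_left Set.inter_subset_left)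
          ((hmk _ hNm).inter hE.compl)]
      have h1 : P.real (N ∩ E) ≤ 1 / 2 * P.real N := by
        rw [← measureReal_inter_eq_setIntegral_condExp hmk hE hNm]
        calc _ ≤ ∫ ω in N, (1 / 2 : ℝ) ∂P := by
              refine setIntegral_mono_on integrable_condExp.integrableOn
                (integrable_const _).integrableOn (hmk _ hNm) fun ω hω => ?_
              exact le_of_lt hω.1
          _ = _ := by rw [setIntegral_const, smul_eq_mul, mul_comm]
      have h2 := measureReal_inter_add_sdiff (μ := P) (s := N) hE
      rw [Set.sdiff_eq] at h2
      linarith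
  refine (key n le_rfl).trans ?_
  have := measureReal_mono (μ := P) (Set.inter_subset_right : {ω | ∃ i < n, g i ω < 1 / 2} ∩ Eᶜ ⊆ Eᶜ)
  linarith

theorem measureReal_exists_finset_le [IsProbabilityMeasure P] {ι : Type*} (s : Finset ι)
    {Q : ι → Ω → Prop} {c : ℝ} (h : ∀ i ∈ s, P.real {ω | Q i ω} ≤ c) :
    P.real {ω | ∃ i ∈ s, Q i ω} ≤ s.card * c := by
  have : {ω | ∃ i ∈ s, Q i ω} = ⋃ i ∈ s, {ω | Q i ω} := by ext ω; simp
  rw [this]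
  refine (measureReal_biUnion_finset_le s _).trans ?_
  rw [← nsmul_eq_mul]
  exact Finset.sum_le_card_nsmul _ _ _ h

end Tools

/-! ### Measurability of the quantities of the algorithm -/

section Meas

variable {Ω : Type*} {m : MeasurableSpace Ω} {S : Spec} {T : ℕ} {x u : ℕ → Ω → ℝ} {t : ℕ}

theorem measurable_Vmat (hx : ∀ j < t, Measurable[m] (x j)) (hu : ∀ j < t, Measurable[m] (u j)) :
    Measurable[m] (fun ω => Vmat S (fun t => x t ω) (fun t => u t ω) t 0 0) ∧
    Measurable[m] (fun ω => Vmat S (fun t => x t ω) (fun t => u t ω) t 0 1) ∧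
    Measurable[m] (fun ω => Vmat S (fun t => x t ω) (fun t => u t ω) t 1 1) := by
  simp only [Vmat_apply_zero_zero, Vmat_apply_zero_one, Vmat_apply_one_one]
  refine ⟨measurable_const.add ?_, ?_, measurable_const.add ?_⟩ <;>
  refine Finset.measurable_sum _ fun j hj => ?_
  · exact (hx j (Finset.mem_range.1 hj)).pow_const 2
  · exact (hx j (Finset.mem_range.1 hj)).mul (hu j (Finset.mem_range.1 hj))
  · exact (hu j (Finset.mem_range.1 hj)).pow_const 2

theorem measurable_thetaPre (hx : ∀ j ≤ t, Measurable[m] (x j)) (hu : ∀ j < t, Measurable[m] (u j)) :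
    Measurable[m] (fun ω => thetaPre S (fun t => x t ω) (fun t => u t ω) t) := by
  obtain ⟨h0, h1, h2⟩ := measurable_Vmat (S := S) (fun j hj => hx j (le_of_lt hj)) hu
  have h3 : Measurable[m] fun ω => ∑ i ∈ Finset.range t, x i ω * x (i + 1) ω :=
    Finset.measurable_sum _ fun j hj => (hx j (Finset.mem_range.1 hj).le).mul
      (hx (j + 1) (Finset.mem_range.1 hj))
  have h4 : Measurable[m] fun ω => ∑ i ∈ Finset.range t, u i ω * x (i + 1) ω :=
    Finset.measurable_sum _ fun j hj => (hu j (Finset.mem_range.1 hj)).mul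
      (hx (j + 1) (Finset.mem_range.1 hj))
  simp only [thetaPre_eq]
  have hd := (h0.mul h2).sub (h1.pow_const 2)
  exact (((h2.mul h3).sub (h1.mul h4)).div hd).prodMk (((h0.mul h4).sub (h1.mul h3)).div hd)

theorem measurable_radius (hx : ∀ j < t, Measurable[m] (x j)) (hu : ∀ j < t, Measurable[m] (u j)) :
    Measurable[m] (fun ω => radius S T (fun t => x t ω) (fun t => u t ω) t) := by
  obtain ⟨h0, h1, h2⟩ := measurable_Vmat (S := S) hx hu
  have hd := (h0.mul h2).sub (h1.pow_const 2)
  simp only [radius, Bconf, Vmat_det]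
  refine Measurable.mul (Measurable.add (Measurable.mul measurable_const
    (Measurable.sqrt ?_)) measurable_const) (Measurable.sqrt ?_)
  · exact ((Real.measurable_log.comp hd).add measurable_const).add measurable_const
  · exact (h2.max h0).div hd

theorem measurable_safeU {c : Ω → ℝ × ℝ} {e y : Ω → ℝ} (D : ℝ) (hc : Measurable[m] c)
    (he : Measurable[m] e) (hy : Measurable[m] y) (he0 : ∀ ω, 0 ≤ e ω) :
    Measurable[m] (fun ω => safeU D (c ω) (e ω) (y ω)) := by
  have hc1 : Measurable[m] fun ω => (c ω).1 := measurable_fst.comp hc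
  have hc2 : Measurable[m] fun ω => (c ω).2 := measurable_snd.comp hc
  have hy' : Measurable[m] fun ω => |y ω| := hy.abs
  have hk : Measurable[m] fun ω => D - (c ω).1 * y ω - e ω * |y ω| :=
    (measurable_const.sub (hc1.mul hy)).sub (he.mul hy')
  simp only [fun ω => safeU_eq (he0 ω) D (c ω) (y ω), safeUform]
  exact Measurable.ite (measurableSet_lt measurable_const (hc2.add he))
    (Measurable.ite (measurableSet_le measurable_const hk) (hk.div (hc2.add he))
      (Measurable.ite (measurableSet_lt measurable_const (hc2.sub he)) (hk.div (hc2.sub he))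
        measurable_const)) measurable_const

theorem measurable_safeL {c : Ω → ℝ × ℝ} {e y : Ω → ℝ} (D : ℝ) (hc : Measurable[m] c)
    (he : Measurable[m] e) (hy : Measurable[m] y) (he0 : ∀ ω, 0 ≤ e ω) :
    Measurable[m] (fun ω => safeL D (c ω) (e ω) (y ω)) := by
  simp only [safeL_eq]
  exact (measurable_safeU (-D) hc he hy.neg he0).neg

theorem measurable_ctrl (p : Problem S T) (k : ℕ) {θ : Ω → ℝ × ℝ} {y : Ω → ℝ}
    (hθ : Measurable[m] θ) (hy : Measurable[m] y) :
    Measurable[m] (fun ω => p.ctrl (θ ω) (p.Kopt (θ ω) k) (y ω)) := by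
  have h1 : Measurable[m] fun ω => p.Ctil (θ ω) (p.Kopt (θ ω) k) (y ω) :=
    (p.Kopt_meas k).comp (hθ.prodMk hy)
  have hc1 : Measurable[m] fun ω => (θ ω).1 := measurable_fst.comp hθ
  have hc2 : Measurable[m] fun ω => (θ ω).2 := measurable_snd.comp hθ
  have h2 := (hc1.mul hy).add (hc2.mul h1)
  unfold Problem.ctrl truncate
  exact Measurable.ite (measurableSet_lt measurable_const h2)
    ((measurable_const.sub (hc1.mul hy)).div hc2)
    (Measurable.ite (measurableSet_lt h2 measurable_const)
      ((measurable_const.sub (hc1.mul hy)).div hc2) h1)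

theorem measurable_sigmaG_x {i j : ℕ} (h : j < i) : Measurable[sigmaG x u i] (x j) := by
  have h1 : Measurable[sigmaG x u i] fun ω (j : Fin i) => (x j ω, u j ω) := comap_measurable _
  exact measurable_fst.comp ((measurable_pi_apply (⟨j, h⟩ : Fin i)).comp h1)

theorem measurable_sigmaG_u {i j : ℕ} (h : j < i) : Measurable[sigmaG x u i] (u j) := by
  have h1 : Measurable[sigmaG x u i] fun ω (j : Fin i) => (x j ω, u j ω) := comap_measurable _
  exact measurable_snd.comp ((measurable_pi_apply (⟨j, h⟩ : Fin i)).comp h1)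

theorem sigmaG_le {i : ℕ} (hx : ∀ j < i, Measurable[m] (x j)) (hu : ∀ j < i, Measurable[m] (u j)) :
    sigmaG x u i ≤ m := by
  have : Measurable[m] fun ω (j : Fin i) => (x j ω, u j ω) :=
    measurable_pi_iff.2 fun j => (hx j j.2).prodMk (hu j j.2)
  exact this.comap_le

theorem sigmaG_mono : Monotone (sigmaG x u) := fun _ _ hij =>
  sigmaG_le (fun _ hk => measurable_sigmaG_x (hk.trans_le hij))
    (fun _ hk => measurable_sigmaG_u (hk.trans_le hij))

theorem sigmaH_le {i : ℕ} (hx : ∀ j ≤ i, Measurable[m] (x j)) (hu : ∀ j < i, Measurable[m] (u j)) :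
    sigmaH x u i ≤ m :=
  sup_le (sigmaG_le (fun j hj => hx j hj.le) hu) (hx i le_rfl).comap_le

end Meas

/-! ### The filtrations generated by the noise and the signs -/

/-- The σ-algebra generated by the noise and sign variables with indices in `A`. -/
abbrev sig {Ω : Type*} (w φ : ℕ → Ω → ℝ) (A : Set (ℕ ⊕ ℕ)) : MeasurableSpace Ω :=
  ⨆ i ∈ A, MeasurableSpace.comap (Sum.elim w φ i) inferInstance

/-- What is known before the noise `w t`. -/
def pastW (t : ℕ) : Set (ℕ ⊕ ℕ) := {i | Sum.elim (fun j => j < t) (fun j => j ≤ t) i}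

/-- What is known before the sign `φ t`. -/
def pastS (t : ℕ) : Set (ℕ ⊕ ℕ) := {i | Sum.elim (fun j => j < t) (fun j => j < t) i}

section Sig

variable {Ω : Type*} {w φ : ℕ → Ω → ℝ}

theorem sig_mono {A B : Set (ℕ ⊕ ℕ)} (h : A ⊆ B) : sig w φ A ≤ sig w φ B :=
  biSup_mono h

theorem measurable_sig_inl {A : Set (ℕ ⊕ ℕ)} {t : ℕ} (h : Sum.inl t ∈ A) :
    Measurable[sig w φ A] (w t) :=
  measurable_iff_comap_le.2
    (le_biSup (fun i => MeasurableSpace.comap (Sum.elim w φ i) inferInstance) h)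

theorem measurable_sig_inr {A : Set (ℕ ⊕ ℕ)} {t : ℕ} (h : Sum.inr t ∈ A) :
    Measurable[sig w φ A] (φ t) :=
  measurable_iff_comap_le.2
    (le_biSup (fun i => MeasurableSpace.comap (Sum.elim w φ i) inferInstance) h)

theorem pastS_subset_pastW {s t : ℕ} (h : s ≤ t) : pastS s ⊆ pastW t := by
  rintro (i | i) hi <;> simp only [pastS, pastW, Set.mem_ofPred_eq, Sum.elim_inl, Sum.elim_inr] at * <;>
  omega

theorem pastW_subset_pastS {s t : ℕ} (h : s < t) : pastW s ⊆ pastS t := by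
  rintro (i | i) hi <;> simp only [pastS, pastW, Set.mem_ofPred_eq, Sum.elim_inl, Sum.elim_inr] at * <;>
  omega

theorem pastS_mono {s t : ℕ} (h : s ≤ t) : pastS s ⊆ pastS t := by
  rintro (i | i) hi <;> simp only [pastS, Set.mem_ofPred_eq, Sum.elim_inl, Sum.elim_inr] at * <;>
  omega

theorem pastW_mono {s t : ℕ} (h : s ≤ t) : pastW s ⊆ pastW t := by
  rintro (i | i) hi <;> simp only [pastW, Set.mem_ofPred_eq, Sum.elim_inl, Sum.elim_inr] at * <;>
  omega

end Sig

/-! ### Adaptedness of positions and controls -/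

namespace IsRun

variable {Ω : Type*} [mΩ : MeasurableSpace Ω] {S : Spec} {T : ℕ} {p : Problem S T} {P : Measure Ω}
  {w φ x u : ℕ → Ω → ℝ} {θhat : ℕ → Ω → ℝ × ℝ} {E l : ℝ}

theorem traj (h : IsRun p P w φ x u θhat) (ω : Ω) :
    Traj p (fun t => x t ω) (fun t => u t ω) (fun t => w t ω) (fun t => φ t ω) :=
  ⟨h.x_zero ω, fun t ht => h.x_succ t ht ω, fun t ht => h.warm_up t ht ω,
    fun s hs t h1 h2 => ⟨_, h.exploit s hs t h1 h2 ω⟩⟩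

theorem sig_le (h : IsRun p P w φ x u θhat) (A : Set (ℕ ⊕ ℕ)) : sig w φ A ≤ mΩ := by
  refine iSup₂_le fun i _ => ?_
  rcases i with i | i
  · exact (h.w_meas i).comap_le
  · exact (h.φ_meas i).comap_le

theorem indep_sig (h : IsRun p P w φ x u θhat) {A : Set (ℕ ⊕ ℕ)} {i : ℕ ⊕ ℕ} (hi : i ∉ A) :
    Indep (sig w φ A) (MeasurableSpace.comap (Sum.elim w φ i) inferInstance) P := by
  have h1 := (iIndepFun_iff_iIndep _ _ _).1 h.indep
  have h2 := indep_iSup_of_disjoint (fun i => by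
    rcases i with i | i
    · exact (h.w_meas i).comap_le
    · exact (h.φ_meas i).comap_le) h1 (S := A) (T := {i}) (Set.disjoint_singleton_right.2 hi)
  simpa using h2

theorem indep_w (h : IsRun p P w φ x u θhat) (t : ℕ) :
    Indep (sig w φ (pastW t)) (MeasurableSpace.comap (w t) inferInstance) P :=
  h.indep_sig (i := Sum.inl t) (by simp [pastW])

theorem indep_φ (h : IsRun p P w φ x u θhat) (t : ℕ) :
    Indep (sig w φ (pastS t)) (MeasurableSpace.comap (φ t) inferInstance) P :=
  h.indep_sig (i := Sum.inr t) (by simp [pastS])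

/-- Within one time step the order is position, sign, control, noise. Thus x_t is known before φ_t,
while u_t is known only before w_t. In an exploitation round the box and the chosen estimate depend
on the trajectory up to the start of the round. -/
theorem adapted_aux (h : IsRun p P w φ x u θhat) (hs : Scale T E l) (t : ℕ) :
    (t ≤ T → Measurable[sig w φ (pastS t)] (x t)) ∧
    (t < T → Measurable[sig w φ (pastW t)] (u t)) := by
  induction t using Nat.strong_induction_on with
  | _ t ih =>
  have hx : t ≤ T → Measurable[sig w φ (pastS t)] (x t) := by
    intro ht
    rcases t with _ | t
    · have : x 0 = fun _ => 0 := funext h.x_zero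
      rw [this]; exact measurable_const
    · have : x (t + 1) = fun ω => p.thetaStar.1 * x t ω + p.thetaStar.2 * u t ω + w t ω :=
        funext (h.x_succ t ht)
      rw [this]
      have h1 := ((ih t (by omega)).1 (by omega)).mono (sig_mono (pastS_mono (show t ≤ t + 1 by omega)))
        le_rfl
      have h2 := ((ih t (by omega)).2 (by omega)).mono
        (sig_mono (pastW_subset_pastS (show t < t + 1 by omega))) le_rfl
      have h3 : Measurable[sig w φ (pastS (t + 1))] (w t) :=
        measurable_sig_inl (by simp [pastS])
      exact ((measurable_const.mul h1).add (measurable_const.mul h2)).add h3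
  refine ⟨hx, fun ht => ?_⟩
  have hxW : ∀ j ≤ t, Measurable[sig w φ (pastW t)] (x j) := by
    intro j hj
    rcases hj.lt_or_eq with hj | rfl
    · exact ((ih j hj).1 (by omega)).mono (sig_mono (pastS_subset_pastW hj.le)) le_rfl
    · exact (hx (by omega)).mono (sig_mono (pastS_subset_pastW le_rfl)) le_rfl
  have huW : ∀ j < t, Measurable[sig w φ (pastW t)] (u j) := fun j hj =>
    ((ih j hj).2 (by omega)).mono (sig_mono (pastW_mono hj.le)) le_rfl
  rcases Nat.lt_or_ge t (warm T) with hw | hw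
  · have : u t = fun ω => p.Cinit (x t ω) + φ t ω / Real.log T := funext (h.warm_up t hw)
    rw [this]
    have h3 : Measurable[sig w φ (pastW t)] (φ t) := measurable_sig_inr (by simp [pastW])
    exact (p.Cinit_meas.comp (hxW t le_rfl)).add (h3.div_const _)
  · have hr := roundOf_lt hs hw ht
    have hst := start_roundOf_le hs.warm_pos hw
    set s := roundOf T t
    have : u t = fun ω => max (min (p.ctrl (θhat s ω) (p.Kopt (θhat s ω) (start T s)) (x t ω))
        (p.ctrlU x u s t ω)) (p.ctrlL x u s t ω) :=
      funext (h.exploit s hr t hst (lt_two_start_roundOf hs.warm_pos))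
    rw [this]
    have hx' : ∀ j ≤ start T s, Measurable[sig w φ (pastW t)] (x j) := fun j hj =>
      hxW j (hj.trans hst)
    have hu' : ∀ j < start T s, Measurable[sig w φ (pastW t)] (u j) := fun j hj =>
      huW j (hj.trans_le hst)
    have hθ : Measurable[sig w φ (pastW t)] (θhat s) :=
      (h.θhat_meas s hr).mono (sigmaH_le hx' hu') le_rfl
    have he := measurable_thetaPre (S := S) hx' hu'
    have hrad := measurable_radius (S := S) (T := T) (fun j hj => hx' j (le_of_lt hj)) hu'
    exact Measurable.max (Measurable.min (measurable_ctrl p _ hθ (hxW t le_rfl))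
      (measurable_safeU p.DU he hrad (hxW t le_rfl) fun ω => radius_nonneg _ _ _ _ _))
      (measurable_safeL p.DL he hrad (hxW t le_rfl) fun ω => radius_nonneg _ _ _ _ _)

theorem x_adapted (h : IsRun p P w φ x u θhat) (hs : Scale T E l) {j t : ℕ} (hj : j ≤ T)
    (hjt : j ≤ t) : Measurable[sig w φ (pastS t)] (x j) :=
  ((h.adapted_aux hs j).1 hj).mono (sig_mono (pastS_mono hjt)) le_rfl

theorem u_adapted (h : IsRun p P w φ x u θhat) (hs : Scale T E l) {j t : ℕ} (hj : j < T)
    (hjt : j ≤ t) : Measurable[sig w φ (pastW t)] (u j) :=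
  ((h.adapted_aux hs j).2 hj).mono (sig_mono (pastW_mono hjt)) le_rfl

theorem x_adapted' (h : IsRun p P w φ x u θhat) (hs : Scale T E l) {j t : ℕ} (hj : j ≤ T)
    (hjt : j ≤ t) : Measurable[sig w φ (pastW t)] (x j) :=
  (h.x_adapted hs hj hjt).mono (sig_mono (pastS_subset_pastW le_rfl)) le_rfl

theorem x_meas (h : IsRun p P w φ x u θhat) (hs : Scale T E l) {j : ℕ} (hj : j ≤ T) :
    Measurable (x j) := (h.x_adapted hs hj le_rfl).mono (h.sig_le _) le_rfl

theorem u_meas (h : IsRun p P w φ x u θhat) (hs : Scale T E l) {j : ℕ} (hj : j < T) :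
    Measurable (u j) := (h.u_adapted hs hj le_rfl).mono (h.sig_le _) le_rfl

/-- G_{i+1} contains u_i but not x_{i+1}, hence nothing of w_i: given G_{i+1}, the position x_{i+1}
still carries fresh noise. -/
theorem sigmaG_le_sig (h : IsRun p P w φ x u θhat) (hs : Scale T E l) {i : ℕ} (hi : i < T) :
    sigmaG x u (i + 1) ≤ sig w φ (pastW i) :=
  sigmaG_le (fun j hj => h.x_adapted' hs (by omega) (by omega))
    (fun j hj => h.u_adapted hs (by omega) (by omega))

theorem sigmaG_le_top (h : IsRun p P w φ x u θhat) (hs : Scale T E l) {i : ℕ} (hi : i ≤ T) :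
    sigmaG x u i ≤ mΩ :=
  sigmaG_le (fun j hj => h.x_meas hs (by omega)) (fun j hj => h.u_meas hs (by omega))

theorem measurableSet_evE (h : IsRun p P w φ x u θhat) (hs : Scale T E l) (c : ℝ) :
    MeasurableSet (p.evE w x u c) := by
  have hx := fun j (hj : j ≤ T) => h.x_meas hs hj
  have hu := fun j (hj : j < T) => h.u_meas hs hj
  have hrad : ∀ s < rounds T, Measurable (fun ω => eps S T x u s ω) := fun s hr =>
    measurable_radius (fun j hj => hx j (by have := hs.start_lt hr; omega))
      (fun j hj => hu j (by have := hs.start_lt hr; omega))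
  have hest : ∀ s < rounds T, Measurable (fun ω => est S T x u s ω) := fun s hr =>
    measurable_thetaPre (fun j hj => hx j (by have := hs.start_lt hr; omega))
      (fun j hj => hu j (by have := hs.start_lt hr; omega))
  refine MeasurableSet.inter (MeasurableSet.inter ?_ ?_) (MeasurableSet.inter ?_ ?_)
  · have e : p.evSafe x u = ⋂ t, ⋂ (_ : t < T),
        {ω | p.DL ≤ p.thetaStar.1 * x t ω + p.thetaStar.2 * u t ω ∧
          p.thetaStar.1 * x t ω + p.thetaStar.2 * u t ω ≤ p.DU} := by
      ext ω; simp [Problem.evSafe]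
    rw [e]
    refine MeasurableSet.iInter fun t => MeasurableSet.iInter fun ht => ?_
    have := ((hx t ht.le).const_mul p.thetaStar.1).add ((hu t ht).const_mul p.thetaStar.2)
    exact (measurableSet_le measurable_const this).inter (measurableSet_le this measurable_const)
  · have e : evNoise T w = ⋂ t, ⋂ (_ : t < T), {ω | |w t ω| ≤ Real.log T ^ 2} := by
      ext ω; simp [evNoise]
    rw [e]
    exact MeasurableSet.iInter fun t => MeasurableSet.iInter fun _ =>
      measurableSet_le (h.w_meas t).abs measurable_const
  · have e : p.evEst x u = ⋂ s, ⋂ (_ : s < rounds T),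
        {ω | ‖p.thetaStar - est S T x u s ω‖ ≤ eps S T x u s ω} := by
      ext ω; simp [Problem.evEst]
    rw [e]
    exact MeasurableSet.iInter fun s => MeasurableSet.iInter fun hr =>
      measurableSet_le (measurable_const.sub (hest s hr)).norm (hrad s hr)
  · have e : evEps S T x u c = ⋂ s, ⋂ (_ : s < rounds T), {ω | eps S T x u s ω ≤ c * nu T} := by
      ext ω; simp [evEps]
    rw [e]
    exact MeasurableSet.iInter fun s => MeasurableSet.iInter fun hr =>
      measurableSet_le (hrad s hr) measurable_const

end IsRun

/-! ### Tails and quantiles of the noise -/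

theorem Spec.integrable_sq (S : Spec) : Integrable (fun x => x ^ 2) S.noise := by
  by_contra h
  have := S.var_one
  rw [integral_undef h] at this
  norm_num at this

theorem Spec.integrable_id (S : Spec) : Integrable (fun x => x) S.noise := by
  have := S.prob
  refine Integrable.mono' ((integrable_const (1 : ℝ)).add S.integrable_sq)
    measurable_id.aestronglyMeasurable (Eventually.of_forall fun x => ?_)
  simp only [Real.norm_eq_abs, Pi.add_apply]
  nlinarith [sq_abs x, sq_nonneg (|x| - 1), abs_nonneg x]

/-- Noise that is positive almost surely cannot have mean zero. Together with `Spec.cdf_zero_lt_one`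
this places 0 between the extreme quantiles for large T, so that the start x₀ = 0 lies in the range
of `Cinit_safe`. -/
theorem Spec.cdf_zero_pos (S : Spec) : 0 < cdf S.noise 0 := by
  have := S.prob
  refine lt_of_le_of_ne (cdf_nonneg _ _) fun h => ?_
  rw [cdf_eq_real, eq_comm, measureReal_eq_zero_iff] at h
  have hpos : ∀ᵐ x ∂S.noise, 0 < x := by
    rw [ae_iff]; simpa [Set.Iic] using h
  have h0 := (integral_eq_zero_iff_of_nonneg_ae (hpos.mono fun x hx => hx.le)
    S.integrable_id).1 S.mean_zero
  have hF : ∀ᵐ x ∂S.noise, False := by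
    filter_upwards [hpos, h0] with x h1 h2
    simp only [Pi.zero_apply] at h2
    linarith
  rw [ae_iff] at hF
  simp at hF

/-- Nonpositive noise with mean zero vanishes almost surely, contradicting variance 1. -/
theorem Spec.cdf_zero_lt_one (S : Spec) : cdf S.noise 0 < 1 := by
  have := S.prob
  refine lt_of_le_of_ne (cdf_le_one _ _) fun h => ?_
  have hneg : ∀ᵐ x ∂S.noise, x ≤ 0 := by
    rw [cdf_eq_real] at h
    have := (prob_compl_eq_zero_iff (μ := S.noise) (measurableSet_Iic (a := (0 : ℝ)))).2 (by
      rw [← ofReal_measureReal, h]; simp)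
    rw [ae_iff]; simpa [Set.Iic, Set.compl_ofPred] using this
  have hi : ∫ x, -x ∂S.noise = 0 := by rw [integral_neg, S.mean_zero, neg_zero]
  have h0 := (integral_eq_zero_iff_of_nonneg_ae (hneg.mono fun x hx => by
    simpa using hx) S.integrable_id.neg).1 hi
  have h2 : ∫ x, x ^ 2 ∂S.noise = ∫ x, (0 : ℝ) ∂S.noise := by
    refine integral_congr_ae (h0.mono fun x hx => ?_)
    have hx' : -x = 0 := hx
    simp [neg_eq_zero.1 hx']
  rw [S.var_one] at h2
  simp at h2

theorem bddBelow_quantile_set (μ : Measure ℝ) [IsProbabilityMeasure μ] {q : ℝ} (hq : 0 < q) :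
    BddBelow {x : ℝ | q ≤ cdf μ x} := by
  obtain ⟨b, hb⟩ := ((tendsto_order.1 (tendsto_cdf_atBot μ)).2 q hq).exists
  refine ⟨b, fun x hx => ?_⟩
  by_contra hlt
  push Not at hlt
  have := monotone_cdf μ hlt.le
  have hx' : q ≤ cdf μ x := hx
  linarith

theorem measureReal_lt_quantile_le (μ : Measure ℝ) [IsProbabilityMeasure μ] {q : ℝ} (hq : 0 < q) :
    μ.real {x | x < quantile μ q} ≤ q := by
  set a := quantile μ q with ha
  have hU : {x | x < a} = ⋃ n : ℕ, Set.Iic (a - 1 / ((n : ℝ) + 1)) := by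
    ext x
    simp only [Set.mem_ofPred_eq, Set.mem_iUnion, Set.mem_Iic]
    constructor
    · intro h
      obtain ⟨n, hn⟩ := exists_nat_one_div_lt (sub_pos.2 h)
      exact ⟨n, by linarith⟩
    · rintro ⟨n, hn⟩
      have : (0 : ℝ) < 1 / ((n : ℝ) + 1) := by positivity
      linarith
  have hmono : Monotone fun n : ℕ => Set.Iic (a - 1 / ((n : ℝ) + 1)) := by
    intro m n hmn
    refine Set.Iic_subset_Iic.2 (sub_le_sub_left ?_ _)
    exact Nat.one_div_le_one_div hmn
  have h1 : μ {x | x < a} ≤ ENNReal.ofReal q := by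
    rw [hU, hmono.measure_iUnion]
    refine iSup_le fun n => ?_
    rw [← ofReal_cdf]
    refine ENNReal.ofReal_le_ofReal (le_of_not_ge fun hle => ?_)
    have h2 : a ≤ a - 1 / ((n : ℝ) + 1) := csInf_le (bddBelow_quantile_set μ hq) hle
    have : (0 : ℝ) < 1 / ((n : ℝ) + 1) := by positivity
    linarith
  exact ENNReal.toReal_le_of_le_ofReal hq.le h1

theorem measureReal_quantile_lt_le (μ : Measure ℝ) [IsProbabilityMeasure μ] {q : ℝ} (hq : q < 1) :
    μ.real {x | quantile μ q < x} ≤ 1 - q := by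
  set a := quantile μ q with ha
  have hU : {x | a < x} = ⋃ n : ℕ, Set.Ioi (a + 1 / ((n : ℝ) + 1)) := by
    ext x
    simp only [Set.mem_ofPred_eq, Set.mem_iUnion, Set.mem_Ioi]
    constructor
    · intro h
      obtain ⟨n, hn⟩ := exists_nat_one_div_lt (sub_pos.2 h)
      exact ⟨n, by linarith⟩
    · rintro ⟨n, hn⟩
      have : (0 : ℝ) < 1 / ((n : ℝ) + 1) := by positivity
      linarith
  have hmono : Monotone fun n : ℕ => Set.Ioi (a + 1 / ((n : ℝ) + 1)) := by
    intro m n hmn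
    refine Set.Ioi_subset_Ioi (add_le_add_right ?_ _)
    exact Nat.one_div_le_one_div hmn
  have hne : {x : ℝ | q ≤ cdf μ x}.Nonempty := by
    obtain ⟨b, hb⟩ := ((tendsto_order.1 (tendsto_cdf_atTop μ)).1 q hq).exists
    exact ⟨b, hb.le⟩
  have h1 : μ {x | a < x} ≤ ENNReal.ofReal (1 - q) := by
    rw [hU, hmono.measure_iUnion]
    refine iSup_le fun n => ?_
    have hpos : (0 : ℝ) < 1 / ((n : ℝ) + 1) := by positivity
    obtain ⟨y, hy, hya⟩ := exists_lt_of_csInf_lt hne (show sInf _ < a + 1 / ((n : ℝ) + 1) by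
      change quantile μ q < _; linarith)
    have h2 : q ≤ cdf μ (a + 1 / ((n : ℝ) + 1)) := le_trans hy (monotone_cdf μ hya.le)
    rw [← Set.compl_Iic, ← ofReal_measureReal, probReal_compl_eq_one_sub measurableSet_Iic,
      ← cdf_eq_real]
    exact ENNReal.ofReal_le_ofReal (by linarith)
  exact ENNReal.toReal_le_of_le_ofReal (by linarith) h1

/-- Chernoff's bound on both sides with the optimal exponent a/α². -/
theorem Spec.tail_le (S : Spec) {a : ℝ} (ha : 0 ≤ a) :
    S.noise.real {x | a < |x|} ≤ 2 * Real.exp (-(a ^ 2 / (2 * S.alpha ^ 2))) := by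
  have := S.prob
  have hα := S.alpha_pos
  have hm : ∀ g : ℝ, mgf (fun x : ℝ => x) S.noise g ≤ Real.exp (g ^ 2 * S.alpha ^ 2 / 2) := fun g =>
    (S.subgaussian g).2
  have h1 := measure_ge_le_exp_mul_mgf (μ := S.noise) (X := fun x : ℝ => x) a
    (t := a / S.alpha ^ 2) (by positivity) (S.subgaussian _).1
  have h2 := measure_le_le_exp_mul_mgf (μ := S.noise) (X := fun x : ℝ => x) (-a)
    (t := -(a / S.alpha ^ 2)) (by rw [neg_nonpos]; positivity) (S.subgaussian _).1
  have e : ∀ y, y = -(a / S.alpha ^ 2 * a) → ∀ M, M ≤ Real.exp ((a / S.alpha ^ 2) ^ 2 * S.alpha ^ 2 / 2) →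
      Real.exp y * M ≤ Real.exp (-(a ^ 2 / (2 * S.alpha ^ 2))) := by
    intro y hy M hM
    calc Real.exp y * M ≤ Real.exp y * Real.exp ((a / S.alpha ^ 2) ^ 2 * S.alpha ^ 2 / 2) := by gcongr
      _ = _ := by
        rw [← Real.exp_add, hy]; congr 1; field_simp; ring
  have h1' := h1.trans (e _ (by ring) _ (hm _))
  have h2' := h2.trans (e _ (by ring) _ (by have := hm (-(a / S.alpha ^ 2)); rwa [neg_sq] at this))
  have hsub : {x : ℝ | a < |x|} ⊆ {x | a ≤ x} ∪ {x | x ≤ -a} := by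
    intro x hx
    rcases lt_abs.1 (show a < |x| from hx) with h | h
    · exact Or.inl h.le
    · exact Or.inr (show x ≤ -a by linarith)
  have := (measureReal_mono hsub (by finiteness)).trans (measureReal_union_le (μ := S.noise) _ _)
  linarith

/-! ### Probabilities of the exceptional events -/

namespace IsRun

variable {Ω : Type*} [mΩ : MeasurableSpace Ω] {S : Spec} {T : ℕ} {p : Problem S T} {P : Measure Ω}
  [IsProbabilityMeasure P]
  {w φ x u : ℕ → Ω → ℝ} {θhat : ℕ → Ω → ℝ × ℝ} {E l : ℝ}

theorem prob_not_noiseOk (h : IsRun p P w φ x u θhat) (hs : Scale T E l)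
    (h0 : 1 / (T : ℝ) ^ 4 ≤ cdf S.noise 0) (h1 : cdf S.noise 0 < 1 - 1 / (T : ℝ) ^ 4) :
    P.real {ω | ¬ NoiseOk S T (fun t => w t ω) (fun t => φ t ω)} ≤
      T * (2 * Real.exp (-(l ^ 4 / (2 * S.alpha ^ 2))) + 2 / (T : ℝ) ^ 4) := by
  have := S.prob
  have hT : (0 : ℝ) < T := by rw [hs.T_eq]; have := hs.E_pos; positivity
  have hT4 : 0 < 1 / (T : ℝ) ^ 4 := by positivity
  set q₁ := quantile S.noise (1 / (T : ℝ) ^ 4) with hq₁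
  set q₂ := quantile S.noise (1 - 1 / (T : ℝ) ^ 4) with hq₂
  have z1 : q₁ ≤ 0 := csInf_le (bddBelow_quantile_set _ hT4) h0
  have z2 : 0 ≤ q₂ := by
    refine Real.sInf_nonneg fun x hx => ?_
    by_contra hneg
    push Not at hneg
    have := monotone_cdf S.noise hneg.le
    have hx' : 1 - 1 / (T : ℝ) ^ 4 ≤ cdf S.noise x := hx
    linarith
  set B : Set ℝ := ({y | l ^ 2 < |y|} ∪ {y | y < q₁}) ∪ {y | q₂ < y} with hB
  have hBm : MeasurableSet B := ((measurableSet_lt measurable_const measurable_abs).union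
    (measurableSet_lt measurable_id measurable_const)).union
    (measurableSet_lt measurable_const measurable_id)
  have hBP : S.noise.real B ≤ 2 * Real.exp (-(l ^ 4 / (2 * S.alpha ^ 2))) + 2 / (T : ℝ) ^ 4 := by
    have k1 := S.tail_le (sq_nonneg l)
    have k2 := measureReal_lt_quantile_le S.noise hT4
    have k3 := measureReal_quantile_lt_le S.noise (q := 1 - 1 / (T : ℝ) ^ 4) (by linarith)
    have k4 := measureReal_union_le (μ := S.noise) ({y | l ^ 2 < |y|} ∪ {y | y < q₁}) {y | q₂ < y}
    have k5 := measureReal_union_le (μ := S.noise) {y | l ^ 2 < |y|} {y | y < q₁}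
    rw [← pow_mul] at k1
    have e : 2 / (T : ℝ) ^ 4 = 1 / (T : ℝ) ^ 4 + 1 / (T : ℝ) ^ 4 := by ring
    rw [e]
    linarith
  have hφ : ∀ t, P {ω | ¬ (φ t ω = 1 ∨ φ t ω = -1)} = 0 := by
    intro t
    have hms : MeasurableSet {y : ℝ | ¬ (y = 1 ∨ y = -1)} :=
      ((measurableSet_eq_fun measurable_id measurable_const).union
        (measurableSet_eq_fun measurable_id measurable_const)).compl
    have := Measure.map_apply (μ := P) (h.φ_meas t) hms
    rw [h.φ_law t] at this
    rw [show {ω | ¬ (φ t ω = 1 ∨ φ t ω = -1)} = φ t ⁻¹' {y : ℝ | ¬ (y = 1 ∨ y = -1)} from rfl, ← this]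
    simp
  have hsub : {ω | ¬ NoiseOk S T (fun t => w t ω) (fun t => φ t ω)} ⊆
      {ω | ∃ t ∈ Finset.range T, w t ω ∈ B} ∪
        {ω | ∃ t ∈ Finset.range (warm T), ¬ (φ t ω = 1 ∨ φ t ω = -1)} := by
    intro ω hω
    by_contra hcon
    simp only [Set.mem_union, Set.mem_ofPred_eq, not_or, not_exists, not_and, Finset.mem_range,
      hB, not_lt] at hcon
    obtain ⟨c1, c2⟩ := hcon
    refine hω ⟨fun t ht => ?_, fun t ht => (c1 t ht).1.2, fun t ht => (c1 t ht).2, z1, z2,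
      fun t ht => ?_⟩
    · rw [hs.log_eq]; exact (c1 t ht).1.1
    · by_contra hc
      push Not at hc
      exact c2 t ht hc.1 hc.2
  have u1 := measureReal_exists_finset_le (P := P) (Finset.range T) (Q := fun t ω => w t ω ∈ B)
    (c := 2 * Real.exp (-(l ^ 4 / (2 * S.alpha ^ 2))) + 2 / (T : ℝ) ^ 4) (fun t _ => by
      have := map_measureReal_apply (μ := P) (h.w_meas t) hBm
      rw [h.w_law t] at this
      change P.real (w t ⁻¹' B) ≤ _
      rw [← this]; exact hBP)
  have u2 := measureReal_exists_finset_le (P := P) (Finset.range (warm T))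
    (Q := fun t ω => ¬ (φ t ω = 1 ∨ φ t ω = -1)) (c := 0) (fun t _ => by
      rw [measureReal_def, hφ t]; simp)
  rw [Finset.card_range] at u1
  have := (measureReal_mono hsub (by finiteness)).trans (measureReal_union_le (μ := P) _ _)
  linarith

theorem prob_sign_gt (h : IsRun p P w φ x u θhat) {n : ℕ} {g : ℕ → Ω → ℝ}
    (hg : ∀ i < n, Measurable[sig w φ (pastS i)] (g i)) (s L : ℝ) :
    P.real {ω | L < ∑ t ∈ Finset.range n, (s * g t ω * φ t ω - s ^ 2 * g t ω ^ 2 / 2)} ≤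
      Real.exp (-L) := by
  have hξ : ∀ j < n, Measurable[sig w φ (pastW j)]
      (fun ω => s * g j ω * φ j ω - s ^ 2 * g j ω ^ 2 / 2) := by
    intro j hj
    have h1 := (hg j hj).mono (sig_mono (pastS_subset_pastW le_rfl)) le_rfl
    have h2 : Measurable[sig w φ (pastW j)] (φ j) := measurable_sig_inr (by simp [pastW])
    exact ((h1.const_mul s).mul h2).sub (((h1.pow_const 2).const_mul (s ^ 2)).div_const 2)
  refine measureReal_exp_sum_gt_le n (m := fun i => sig w φ (pastS i)) (fun i _ => h.sig_le _)
    (fun i hi j hj => (hξ j (by omega)).mono (sig_mono (pastW_subset_pastS hj)) le_rfl)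
    (fun i hi => (hξ i hi).mono (h.sig_le _) le_rfl) (fun i hi t ht => ?_) L
  have hf : Measurable fun z : ℝ × ℝ => ENNReal.ofReal (Real.exp (z.1 * z.2 - z.1 ^ 2 / 2)) := by
    fun_prop
  have := setLIntegral_indep_le (P := P) (h.sig_le (pastS i)) ((hg i hi).const_mul s) (h.φ_meas i)
    (h.indep_φ i) hf (fun b => by rw [h.φ_law i]; exact lintegral_sign_le b) ht
  simpa only [mul_pow] using this

/-- The compensator α²g²/2 is exactly the subgaussian exponent, so every predictable g gives a
supermartingale, without any bound on g. -/
theorem prob_grid_gt (h : IsRun p P w φ x u θhat) {n : ℕ} {g : ℕ → Ω → ℝ}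
    (hg : ∀ i < n, Measurable[sig w φ (pastW i)] (g i)) (L : ℝ) :
    P.real {ω | L < ∑ t ∈ Finset.range n, (g t ω * w t ω - S.alpha ^ 2 / 2 * g t ω ^ 2)} ≤
      Real.exp (-L) := by
  have hξ : ∀ j < n, Measurable[sig w φ (pastS (j + 1))]
      (fun ω => g j ω * w j ω - S.alpha ^ 2 / 2 * g j ω ^ 2) := by
    intro j hj
    have h1 := (hg j hj).mono (sig_mono (pastW_subset_pastS (Nat.lt_succ_self j))) le_rfl
    have h2 : Measurable[sig w φ (pastS (j + 1))] (w j) := measurable_sig_inl (by simp [pastS])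
    exact (h1.mul h2).sub ((h1.pow_const 2).const_mul _)
  refine measureReal_exp_sum_gt_le n (m := fun i => sig w φ (pastW i)) (fun i _ => h.sig_le _)
    (fun i hi j hj => (hξ j (by omega)).mono (sig_mono (pastS_subset_pastW hj)) le_rfl)
    (fun i hi => (hξ i hi).mono (h.sig_le _) le_rfl) (fun i hi t ht => ?_) L
  have hf : Measurable fun z : ℝ × ℝ =>
      ENNReal.ofReal (Real.exp (z.1 * z.2 - S.alpha ^ 2 / 2 * z.1 ^ 2)) := by fun_prop
  exact setLIntegral_indep_le (P := P) (h.sig_le (pastW i)) (hg i hi) (h.w_meas i)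
    (h.indep_w i) hf (fun b => by rw [h.w_law i]; exact lintegral_subgaussian_le S b) ht

open Classical in
theorem prob_count_gt (h : IsRun p P w φ x u θhat) {n : ℕ} {J a b : ℕ → Ω → ℝ}
    (hJ : ∀ i < n, Measurable[sig w φ (pastW i)] (J i))
    (ha : ∀ i < n, Measurable[sig w φ (pastW i)] (a i))
    (hb : ∀ i < n, Measurable[sig w φ (pastW i)] (b i)) {η k ρ : ℝ} (hη : 0 < η) (hk : 0 < k)
    (hρ : 2 * S.BP * k / η ≤ ρ) (L : ℝ) :
    P.real {ω | L < ∑ t ∈ Finset.range n, (if J t ω = 1 then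
      ((if η ≤ |a t ω| ∧ |a t ω * w t ω + b t ω| < k then (1 : ℝ) else 0) - 2 * ρ) else 0)} ≤
      Real.exp (-L) := by
  have hF : Measurable fun z : (ℝ × ℝ × ℝ) × ℝ => (if z.1.1 = 1 then
      ((if η ≤ |z.1.2.1| ∧ |z.1.2.1 * z.2 + z.1.2.2| < k then (1 : ℝ) else 0) - 2 * ρ) else 0) := by
    have m1 : Measurable fun z : (ℝ × ℝ × ℝ) × ℝ => z.1.1 := by fun_prop
    have m2 : Measurable fun z : (ℝ × ℝ × ℝ) × ℝ => |z.1.2.1| := by fun_prop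
    have m3 : Measurable fun z : (ℝ × ℝ × ℝ) × ℝ => |z.1.2.1 * z.2 + z.1.2.2| := by fun_prop
    refine Measurable.ite (measurableSet_eq_fun m1 measurable_const) (Measurable.sub
      (Measurable.ite ?_ measurable_const measurable_const) measurable_const) measurable_const
    exact (measurableSet_le measurable_const m2).inter (measurableSet_lt m3 measurable_const)
  have hξ : ∀ j < n, Measurable[sig w φ (pastS (j + 1))] (fun ω => (if J j ω = 1 then
      ((if η ≤ |a j ω| ∧ |a j ω * w j ω + b j ω| < k then (1 : ℝ) else 0) - 2 * ρ) else 0)) := by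
    intro j hj
    have hle := sig_mono (w := w) (φ := φ) (pastW_subset_pastS (Nat.lt_succ_self j))
    have h2 : Measurable[sig w φ (pastS (j + 1))] (w j) := measurable_sig_inl (by simp [pastS])
    exact hF.comp ((((hJ j hj).mono hle le_rfl).prodMk
      (((ha j hj).mono hle le_rfl).prodMk ((hb j hj).mono hle le_rfl))).prodMk h2)
  refine measureReal_exp_sum_gt_le n (m := fun i => sig w φ (pastW i)) (fun i _ => h.sig_le _)
    (fun i hi j hj => (hξ j (by omega)).mono (sig_mono (pastS_subset_pastW hj)) le_rfl)
    (fun i hi => (hξ i hi).mono (h.sig_le _) le_rfl) (fun i hi t ht => ?_) L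
  exact setLIntegral_indep_le (P := P) (h.sig_le (pastW i))
    ((hJ i hi).prodMk ((ha i hi).prodMk (hb i hi))) (h.w_meas i)
    (h.indep_w i) (Real.measurable_exp.comp hF).ennreal_ofReal
    (fun b => by rw [h.w_law i]; exact lintegral_count_le S hη hk hρ b.1 b.2.1 b.2.2) ht

theorem prob_not_gridOk (h : IsRun p P w φ x u θhat) (hs : Scale T E l) {t : ℕ} (ht : t ≤ T) (y : ℝ) :
    P.real {ω | ¬ GridOk S E l y (fun t => x t ω) (fun t => u t ω) (fun t => w t ω) t} ≤
      (2 * E ^ 4 + 1) ^ 2 * Real.exp (-(S.alpha ^ 2 * y ^ 2 / 2)) := by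
  obtain ⟨n, hn⟩ := hs.E_nat
  set G : Finset (ℤ × ℤ) := Finset.Icc (-(n : ℤ) ^ 4) (n ^ 4) ×ˢ Finset.Icc (-(n : ℤ) ^ 4) (n ^ 4) with hG
  have hcard : (G.card : ℝ) = (2 * E ^ 4 + 1) ^ 2 := by
    have e : ((n : ℤ) ^ 4 + 1 - -(n : ℤ) ^ 4).toNat = 2 * n ^ 4 + 1 := by
      have : ((n : ℤ) ^ 4 + 1 - -(n : ℤ) ^ 4) = ((2 * n ^ 4 + 1 : ℕ) : ℤ) := by push_cast; ring
      rw [this, Int.toNat_natCast]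
    rw [hG, Finset.card_product, Int.card_Icc, e, hn]
    push_cast; ring
  set H := 1 / (E ^ 6 * l ^ 3)
  have hsub : {ω | ¬ GridOk S E l y (fun t => x t ω) (fun t => u t ω) (fun t => w t ω) t} ⊆
      {ω | ∃ ij ∈ G, S.alpha ^ 2 * y ^ 2 / 2 < ∑ k ∈ Finset.range t,
        (((ij.1 : ℝ) * H * x k ω + ij.2 * H * u k ω) * w k ω -
          S.alpha ^ 2 / 2 * (ij.1 * H * x k ω + ij.2 * H * u k ω) ^ 2)} := by
    intro ω hω
    by_contra hcon
    simp only [Set.mem_ofPred_eq, not_exists, not_and, not_lt] at hcon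
    refine hω fun i j hi hj => hcon (i, j) ?_
    have key : ∀ i : ℤ, |(i : ℝ)| ≤ E ^ 4 → i ∈ Finset.Icc (-(n : ℤ) ^ 4) (n ^ 4) := fun i hi => by
      rw [hn] at hi
      have : |i| ≤ (n : ℤ) ^ 4 := by exact_mod_cast hi
      exact Finset.mem_Icc.2 (abs_le.1 this)
    exact Finset.mem_product.2 ⟨key i hi, key j hj⟩
  refine (measureReal_mono hsub (by finiteness)).trans ?_
  rw [← hcard]
  refine measureReal_exists_finset_le G fun ij _ => ?_
  refine h.prob_grid_gt (g := fun k ω => (ij.1 : ℝ) * H * x k ω + ij.2 * H * u k ω) (fun k hk => ?_) _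
  exact ((h.x_adapted' hs (by omega) le_rfl).const_mul _).add
    ((h.u_adapted hs (by omega) le_rfl).const_mul _)

theorem prob_not_warmOk (h : IsRun p P w φ x u θhat) (hs : Scale T E l) (hl : 0 ≤ l) :
    P.real {ω | ¬ WarmOk p (fun t => x t ω) (fun t => φ t ω) E l} ≤ 5 * Real.exp (-(3 * l)) := by
  have hwT : warm T ≤ T := by
    have := hs.warm_mul; have := hs.warm_pos; nlinarith
  have hx : ∀ i < warm T, Measurable[sig w φ (pastS i)] (x i) := fun i hi =>
    h.x_adapted hs (by omega) le_rfl
  have hc : ∀ i < warm T, Measurable[sig w φ (pastS i)] (fun ω => p.Cinit (x i ω)) := fun i hi =>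
    p.Cinit_meas.comp (hx i hi)
  have hexp : Real.exp (-(5 * l)) ≤ Real.exp (-(3 * l)) := Real.exp_le_exp.2 (by linarith)
  have b1 := (h.prob_sign_gt hx (1 / E ^ 3) (5 * l)).trans hexp
  have b2 := (h.prob_sign_gt hx (-(1 / E ^ 3)) (5 * l)).trans hexp
  have b3 := (h.prob_sign_gt hc (1 / E ^ 3) (5 * l)).trans hexp
  have b4 := (h.prob_sign_gt hc (-(1 / E ^ 3)) (5 * l)).trans hexp
  have b5 := h.prob_count_gt (n := warm T) (J := fun _ _ => 1) (a := fun _ _ => 1)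
    (b := fun i ω => p.thetaStar.1 * x i ω + p.thetaStar.2 * u i ω) (fun _ _ => measurable_const)
    -- By the choice of `xthr`, 2·BP·xthr = 1/8, so the count is compared with 2ρ = 1/4 per step.
    (fun _ _ => measurable_const) (fun i hi => ((h.x_adapted' hs (by omega) le_rfl).const_mul _).add
      ((h.u_adapted hs (by omega) le_rfl).const_mul _)) (η := 1) (k := S.xthr) (ρ := 1 / 8)
    one_pos S.xthr_pos (by
      have := S.BP_pos
      unfold Spec.xthr; apply le_of_eq; field_simp; norm_num) (3 * l)
  set B1 := {ω | 5 * l < ∑ t ∈ Finset.range (warm T),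
    (1 / E ^ 3 * x t ω * φ t ω - (1 / E ^ 3) ^ 2 * x t ω ^ 2 / 2)}
  set B2 := {ω | 5 * l < ∑ t ∈ Finset.range (warm T),
    (-(1 / E ^ 3) * x t ω * φ t ω - (-(1 / E ^ 3)) ^ 2 * x t ω ^ 2 / 2)}
  set B3 := {ω | 5 * l < ∑ t ∈ Finset.range (warm T),
    (1 / E ^ 3 * p.Cinit (x t ω) * φ t ω - (1 / E ^ 3) ^ 2 * p.Cinit (x t ω) ^ 2 / 2)}
  set B4 := {ω | 5 * l < ∑ t ∈ Finset.range (warm T),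
    (-(1 / E ^ 3) * p.Cinit (x t ω) * φ t ω - (-(1 / E ^ 3)) ^ 2 * p.Cinit (x t ω) ^ 2 / 2)}
  set B5 := {ω | 3 * l < ∑ t ∈ Finset.range (warm T), (if (1 : ℝ) = 1 then
      ((if (1 : ℝ) ≤ |(1 : ℝ)| ∧ |1 * w t ω + (p.thetaStar.1 * x t ω + p.thetaStar.2 * u t ω)| <
        S.xthr then (1 : ℝ) else 0) - 2 * (1 / 8)) else 0)}
  have hsub : {ω | ¬ WarmOk p (fun t => x t ω) (fun t => φ t ω) E l} ⊆
      (((B1 ∪ B2) ∪ B3) ∪ B4) ∪ B5 := by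
    intro ω hω
    by_contra hcon
    simp only [Set.mem_union, not_or] at hcon
    obtain ⟨⟨⟨⟨c1, c2⟩, c3⟩, c4⟩, c5⟩ := hcon
    refine hω ⟨?_, ?_, ?_⟩
    · rintro s (rfl | rfl)
      · exact not_lt.1 c1
      · exact not_lt.1 c2
    · rintro s (rfl | rfl)
      · exact not_lt.1 c3
      · exact not_lt.1 c4
    · refine le_trans (le_of_eq (Finset.sum_congr rfl fun t ht => ?_)) (not_lt.1 c5)
      have hxt := h.x_succ t (by have := Finset.mem_range.1 ht; omega) ω
      rw [if_pos rfl, hxt, abs_one, one_mul, add_comm (w t ω)]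
      simp only [le_refl, true_and]
      norm_num
  have u0 := measureReal_mono (μ := P) hsub (by finiteness)
  have u1 := measureReal_union_le (μ := P) (((B1 ∪ B2) ∪ B3) ∪ B4) B5
  have u2 := measureReal_union_le (μ := P) ((B1 ∪ B2) ∪ B3) B4
  have u3 := measureReal_union_le (μ := P) (B1 ∪ B2) B3
  have u4 := measureReal_union_le (μ := P) B1 B2
  linarith

/-- The good event for the grid parameter `y`. -/
def _root_.SafeLQR.goodEvent (p : Problem S T) (w φ x u : ℕ → Ω → ℝ) (E l y : ℝ) : Set Ω :=
  {ω | NoiseOk S T (fun t => w t ω) (fun t => φ t ω) ∧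
    WarmOk p (fun t => x t ω) (fun t => φ t ω) E l ∧ ∀ s < rounds T,
      GridOk S E l y (fun t => x t ω) (fun t => u t ω) (fun t => w t ω) (start T s)}

theorem prob_not_goodEvent (h : IsRun p P w φ x u θhat) (hs : Scale T E l) (hl : 0 ≤ l)
    (h0 : 1 / (T : ℝ) ^ 4 ≤ cdf S.noise 0) (h1 : cdf S.noise 0 < 1 - 1 / (T : ℝ) ^ 4) (y : ℝ) :
    P.real (goodEvent p w φ x u E l y)ᶜ ≤
      T * (2 * Real.exp (-(l ^ 4 / (2 * S.alpha ^ 2))) + 2 / (T : ℝ) ^ 4) +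
        5 * Real.exp (-(3 * l)) +
        l * ((2 * E ^ 4 + 1) ^ 2 * Real.exp (-(S.alpha ^ 2 * y ^ 2 / 2))) := by
  have hsub : (goodEvent p w φ x u E l y)ᶜ ⊆
      ({ω | ¬ NoiseOk S T (fun t => w t ω) (fun t => φ t ω)} ∪
      {ω | ¬ WarmOk p (fun t => x t ω) (fun t => φ t ω) E l}) ∪
      {ω | ∃ s ∈ Finset.range (rounds T), ¬ GridOk S E l y (fun t => x t ω) (fun t => u t ω)
        (fun t => w t ω) (start T s)} := by
    intro ω hω
    by_contra hcon
    simp only [Set.mem_union, Set.mem_ofPred_eq, not_or, not_exists, not_and, not_not,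
      Finset.mem_range] at hcon
    exact hω ⟨hcon.1.1, hcon.1.2, hcon.2⟩
  have u0 := measureReal_mono (μ := P) hsub (by finiteness)
  have u1 := measureReal_union_le (μ := P) ({ω | ¬ NoiseOk S T (fun t => w t ω) (fun t => φ t ω)} ∪
      {ω | ¬ WarmOk p (fun t => x t ω) (fun t => φ t ω) E l}) {ω | ∃ s ∈ Finset.range (rounds T),
        ¬ GridOk S E l y (fun t => x t ω) (fun t => u t ω) (fun t => w t ω) (start T s)}
  have u2 := measureReal_union_le (μ := P) {ω | ¬ NoiseOk S T (fun t => w t ω) (fun t => φ t ω)}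
      {ω | ¬ WarmOk p (fun t => x t ω) (fun t => φ t ω) E l}
  have u3 := measureReal_exists_finset_le (P := P) (Finset.range (rounds T)) (Q := fun s ω =>
    ¬ GridOk S E l y (fun t => x t ω) (fun t => u t ω) (fun t => w t ω) (start T s))
    (fun s hsr => h.prob_not_gridOk hs (hs.start_lt (Finset.mem_range.1 hsr)).le y)
  have u4 : ((Finset.range (rounds T)).card : ℝ) * ((2 * E ^ 4 + 1) ^ 2 *
      Real.exp (-(S.alpha ^ 2 * y ^ 2 / 2))) ≤
      l * ((2 * E ^ 4 + 1) ^ 2 * Real.exp (-(S.alpha ^ 2 * y ^ 2 / 2))) := by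
    rw [Finset.card_range]
    exact mul_le_mul_of_nonneg_right hs.rounds_le (by positivity)
  have u5 := h.prob_not_noiseOk hs h0 h1
  have u6 := h.prob_not_warmOk hs hl
  linarith

end IsRun

/-! ### Large horizons -/

theorem Scale.E_eq {T : ℕ} {E l : ℝ} (hs : Scale T E l) : E = Real.exp (l / 12) := by
  have h : E ^ 12 = Real.exp (l / 12) ^ 12 := by
    rw [← hs.exp_eq, ← Real.exp_nat_mul]; congr 1; push_cast; ring
  exact (pow_left_inj₀ hs.E_pos.le (Real.exp_pos _).le (by norm_num)).1 h

theorem Scale.exp_neg_mul {T : ℕ} {E l : ℝ} (hs : Scale T E l) (k : ℕ) :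
    Real.exp (-(k / 12 * l)) = 1 / E ^ k := by
  rw [hs.E_eq, ← Real.exp_nat_mul, Real.exp_neg, one_div]
  congr 2; ring

theorem exists_scale (A : ℝ) (K : ℕ) : ∃ T₁ : ℕ, ∀ T : ℕ, T₁ ≤ T → Admissible T →
    ∃ E : ℝ, Scale T E (Real.log T) ∧ A ≤ Real.log T ∧ Real.log T ^ K ≤ E := by
  have h1 : ∀ᶠ l : ℝ in atTop, l ^ K ≤ Real.exp (1 / 12 * l) := by
    have := (isLittleO_pow_exp_pos_mul_atTop K (show (0 : ℝ) < 1 / 12 by norm_num)).bound one_pos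
    filter_upwards [this, eventually_ge_atTop 0] with l hl h0
    rw [one_mul, Real.norm_of_nonneg (by positivity), Real.norm_of_nonneg (Real.exp_pos _).le] at hl
    exact hl
  have h2 : Tendsto (fun T : ℕ => Real.log T) atTop atTop :=
    Real.tendsto_log_atTop.comp tendsto_natCast_atTop_atTop
  obtain ⟨T₁, hT₁⟩ := eventually_atTop.1 (h2.eventually (h1.and (eventually_ge_atTop A)))
  refine ⟨T₁, fun T hT hadm => ?_⟩
  obtain ⟨m, rfl⟩ := hadm
  have hs := scale_of_pow m
  obtain ⟨k1, k2⟩ := hT₁ _ hT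
  refine ⟨2 ^ m, hs, k2, k1.trans (le_of_eq ?_)⟩
  rw [hs.E_eq]; congr 1; ring

theorem tendsto_pow_mul_exp_log (k j : ℕ) (hkj : 12 * k < j) :
    Tendsto (fun T : ℕ => (T : ℝ) ^ k * Real.exp (-(j / 12 * Real.log T))) atTop (𝓝 0) := by
  have h2 : Tendsto (fun T : ℕ => Real.log T) atTop atTop :=
    Real.tendsto_log_atTop.comp tendsto_natCast_atTop_atTop
  have hpos : (0 : ℝ) < j / 12 - k := by
    have : (12 * k : ℝ) < j := by exact_mod_cast hkj
    linarith
  have h3 : Tendsto (fun T : ℕ => Real.exp (-((j / 12 - k) * Real.log T))) atTop (𝓝 0) :=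
    Real.tendsto_exp_atBot.comp (tendsto_neg_atTop_atBot.comp (h2.const_mul_atTop hpos))
  refine h3.congr' ?_
  filter_upwards [eventually_gt_atTop 0] with T hT
  have hT' : (0 : ℝ) < T := by exact_mod_cast hT
  have : (T : ℝ) ^ k = Real.exp (k * Real.log T) := by
    rw [Real.exp_nat_mul, Real.exp_log hT']
  rw [this, ← Real.exp_add]
  congr 1; ring

/-- The noise and warm-up errors are of order T⁻³, and the grid of about E⁸ directions over at most
l ≤ E rounds costs a factor 9E⁹ on the single-direction failure probability q. -/
theorem total_prob_le (S : Spec) {T : ℕ} {E l q : ℝ} (hs : Scale T E l) (h1 : 1 ≤ l)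
    (hα : 8 * S.alpha ^ 2 ≤ l) (hlE : l ≤ E) (hq : 0 ≤ q) :
    T * (2 * Real.exp (-(l ^ 4 / (2 * S.alpha ^ 2))) + 2 / (T : ℝ) ^ 4) +
        5 * Real.exp (-(3 * l)) + l * ((2 * E ^ 4 + 1) ^ 2 * q) ≤ 9 / E ^ 36 + 9 * E ^ 9 * q := by
  have hE := hs.E_pos
  have ha := S.alpha_pos
  have e1 : Real.exp (-(l ^ 4 / (2 * S.alpha ^ 2))) ≤ 1 / E ^ 48 := by
    have := hs.exp_neg_mul 48
    push_cast at this
    rw [← this]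
    refine Real.exp_le_exp.2 (neg_le_neg ?_)
    rw [le_div_iff₀ (by positivity)]
    have : l * l ≤ l ^ 4 := by
      have := pow_le_pow_right₀ h1 (show 2 ≤ 4 by norm_num)
      nlinarith
    nlinarith
  have e2 : Real.exp (-(3 * l)) = 1 / E ^ 36 := by
    rw [← hs.exp_neg_mul 36]; congr 1; push_cast; ring
  have e3 : T * (2 * Real.exp (-(l ^ 4 / (2 * S.alpha ^ 2))) + 2 / (T : ℝ) ^ 4) ≤ 4 / E ^ 36 := by
    rw [hs.T_eq]
    calc E ^ 12 * (2 * Real.exp (-(l ^ 4 / (2 * S.alpha ^ 2))) + 2 / (E ^ 12) ^ 4) ≤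
          E ^ 12 * (2 * (1 / E ^ 48) + 2 / (E ^ 12) ^ 4) := by gcongr
      _ = 4 / E ^ 36 := by field_simp; norm_num
  have e4 : (2 * E ^ 4 + 1) ^ 2 ≤ 9 * E ^ 8 := by
    have : 1 ≤ E ^ 4 := one_le_pow₀ hs.one_le
    calc (2 * E ^ 4 + 1) ^ 2 ≤ (3 * E ^ 4) ^ 2 := by gcongr; linarith
      _ = 9 * E ^ 8 := by ring
  have e5 : l * ((2 * E ^ 4 + 1) ^ 2 * q) ≤ E * (9 * E ^ 8 * q) := by gcongr
  rw [e2]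
  calc _ ≤ 4 / E ^ 36 + 5 * (1 / E ^ 36) + E * (9 * E ^ 8 * q) := by linarith
    _ = _ := by ring

/-! ### The probability of the good events -/

/-- Two grid levels are needed. The larger one fails with probability exp(-3l) = E⁻³⁶ per direction,
which leaves E⁻²⁵ = o(T⁻²) after the union bound. The smaller one fails with probability exp(-2l) =
E⁻²⁴, leaving E⁻¹⁴ = o(T⁻¹). -/
theorem prob_good (S : Spec) : ∃ A : ℝ, ∀ {T : ℕ} {p : Problem S T} {Ω : Type v}
    [MeasurableSpace Ω] {P : Measure Ω} [IsProbabilityMeasure P] {w φ x u : ℕ → Ω → ℝ}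
    {θhat : ℕ → Ω → ℝ × ℝ} {E l : ℝ},
    IsRun p P w φ x u θhat → Scale T E l → A ≤ l → l ^ 30 ≤ E →
    P.real (goodEvent p w φ x u E l (Real.sqrt (6 * l) / S.alpha))ᶜ ≤ 1 / E ^ 25 ∧
    P.real (goodEvent p w φ x u E l (2 * Real.sqrt l / S.alpha))ᶜ ≤ 1 / E ^ 14 := by
  have c0 := S.cdf_zero_pos
  have c1 := S.cdf_zero_lt_one
  refine ⟨max 18 (max (8 * S.alpha ^ 2) (max (1 / cdf S.noise 0) (2 / (1 - cdf S.noise 0)))),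
    fun {T p Ω _ P _ w φ x u θhat E l} h hs hA hE => ?_⟩
  simp only [max_le_iff] at hA
  obtain ⟨h1, h2, h3, h4⟩ := hA
  have hl : 0 < l := by linarith
  have hE0 := hs.E_pos
  have ha := S.alpha_pos
  have hlE : l ≤ E := (le_self_pow₀ (by linarith) (by norm_num)).trans hE
  have hlT : 1 / (T : ℝ) ^ 4 ≤ 1 / l := by
    refine one_div_le_one_div_of_le hl ?_
    rw [hs.T_eq, ← pow_mul]
    exact hlE.trans (le_self_pow₀ hs.one_le (by norm_num))
  have z0 : 1 / (T : ℝ) ^ 4 ≤ cdf S.noise 0 := by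
    refine hlT.trans ?_
    rw [div_le_iff₀ c0] at h3
    rw [div_le_iff₀ hl]; linarith
  have z1 : cdf S.noise 0 < 1 - 1 / (T : ℝ) ^ 4 := by
    have : 1 / l < 1 - cdf S.noise 0 := by
      rw [div_le_iff₀ (by linarith)] at h4
      rw [div_lt_iff₀ hl]; linarith
    linarith
  have key := fun y => h.prob_not_goodEvent hs hl.le z0 z1 y
  have tot := fun q (hq : 0 ≤ q) => total_prob_le S hs (by linarith) h2 hlE hq
  have hE18 : 18 ≤ E := h1.trans hlE
  constructor
  · have e : Real.exp (-(S.alpha ^ 2 * (Real.sqrt (6 * l) / S.alpha) ^ 2 / 2)) = 1 / E ^ 36 := by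
      rw [← hs.exp_neg_mul 36, div_pow, Real.sq_sqrt (by positivity)]
      congr 1; push_cast; field_simp; ring
    refine (key _).trans ((tot _ (Real.exp_pos _).le).trans ?_)
    rw [e]
    have e1 : 9 / E ^ 36 + 9 * E ^ 9 * (1 / E ^ 36) = (9 / E ^ 11 + 9 / E ^ 2) * (1 / E ^ 25) := by
      field_simp
    rw [e1]
    refine mul_le_of_le_one_left (by positivity) ?_
    have e2 : 9 / E ^ 11 ≤ 9 / E := div_le_div_of_nonneg_left (by norm_num) hE0
      (le_self_pow₀ hs.one_le (by norm_num))
    have e3 : 9 / E ^ 2 ≤ 9 / E := div_le_div_of_nonneg_left (by norm_num) hE0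
      (le_self_pow₀ hs.one_le (by norm_num))
    have e4 : 9 / E ≤ 1 / 2 := by rw [div_le_div_iff₀ hE0 (by norm_num)]; linarith
    linarith
  · have e : Real.exp (-(S.alpha ^ 2 * (2 * Real.sqrt l / S.alpha) ^ 2 / 2)) = 1 / E ^ 24 := by
      rw [← hs.exp_neg_mul 24, div_pow, mul_pow, Real.sq_sqrt hl.le]
      congr 1; push_cast; field_simp; ring
    refine (key _).trans ((tot _ (Real.exp_pos _).le).trans ?_)
    rw [e]
    have e1 : 9 / E ^ 36 + 9 * E ^ 9 * (1 / E ^ 24) = (9 / E ^ 22 + 9 / E) * (1 / E ^ 14) := by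
      field_simp
    rw [e1]
    refine mul_le_of_le_one_left (by positivity) ?_
    have e2 : 9 / E ^ 22 ≤ 9 / E := div_le_div_of_nonneg_left (by norm_num) hE0
      (le_self_pow₀ hs.one_le (by norm_num))
    have e4 : 9 / E ≤ 1 / 2 := by rw [div_le_div_iff₀ hE0 (by norm_num)]; linarith
    linarith

/-- Both levels bound the radii. Only the smaller level makes the error at most the prescribed
radius, which is needed for the full event E. -/
theorem core_of_good (S : Spec) : ∃ A : ℝ, ∀ {T : ℕ} {p : Problem S T} {Ω : Type v}
    [MeasurableSpace Ω] {P : Measure Ω} {w φ x u : ℕ → Ω → ℝ}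
    {θhat : ℕ → Ω → ℝ × ℝ} {E l : ℝ},
    IsRun p P w φ x u θhat → Scale T E l → A ≤ l → l ^ 30 ≤ E → ∀ {c : ℝ} {ω : Ω},
    S.radC * l ^ 4 ≤ c →
    (ω ∈ goodEvent p w φ x u E l (Real.sqrt (6 * l) / S.alpha) → ω ∈ evEps S T x u c) ∧
    (ω ∈ goodEvent p w φ x u E l (2 * Real.sqrt l / S.alpha) →
      CoreOk p (fun t => x t ω) (fun t => u t ω) E l ∧ ω ∈ p.evE w x u c) := by
  obtain ⟨A₀, hA₀⟩ := traj_core S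
  obtain ⟨A₁, hA₁⟩ := CoreOk.est_mem S
  have ha := S.alpha_pos
  refine ⟨max A₀ (max A₁ (max 1 (max (S.alpha ^ 2) (max (6 / S.alpha ^ 2) (24 * S.alpha ^ 2))))),
    fun {T p Ω _ P w φ x u θhat E l} h hs hA hE c ω hc => ?_⟩
  simp only [max_le_iff] at hA
  obtain ⟨a0, a1, h1, h2, h3, h4⟩ := hA
  have hl : 0 < l := by linarith
  have hE0 := hs.E_pos
  have hyy : ∀ b : ℝ, 4 ≤ b → b ≤ 6 → 2 ≤ Real.sqrt (b * l) / S.alpha ∧ Real.sqrt (b * l) / S.alpha ≤ l ∧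
      S.alpha ^ 2 * (Real.sqrt (b * l) / S.alpha) ≤ l / 2 := by
    intro b hb1 hb2
    rw [div_le_iff₀ (by positivity)] at h3
    refine ⟨?_, ?_, ?_⟩
    · rw [le_div_iff₀ ha]
      refine Real.le_sqrt_of_sq_le ?_
      nlinarith
    · rw [div_le_iff₀ ha, Real.sqrt_le_left (by positivity)]
      nlinarith
    · have e : S.alpha ^ 2 * (Real.sqrt (b * l) / S.alpha) = S.alpha * Real.sqrt (b * l) := by
        field_simp
      rw [e]
      have e2 : Real.sqrt (b * l) * Real.sqrt (b * l) = b * l := Real.mul_self_sqrt (by positivity)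
      refine le_of_sq_le_sq ?_ (by positivity)
      rw [mul_pow, pow_two (Real.sqrt _), e2]
      nlinarith [sq_nonneg S.alpha, mul_pos ha ha]
  have heps : CoreOk p (fun t => x t ω) (fun t => u t ω) E l → ω ∈ evEps S T x u c := by
    intro hC s hsr
    refine (hC.rad_le s hsr).trans ?_
    rw [hs.nu_eq, div_eq_mul_inv]
    exact mul_le_mul_of_nonneg_right hc (by positivity)
  constructor
  · rintro ⟨g1, g2, g3⟩
    obtain ⟨y1, y2, y3⟩ := hyy 6 (by norm_num) le_rfl
    exact heps (hA₀ (h.traj ω) g1 hs g2 a0 hE y1 y2 y3 g3)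
  · rintro ⟨g1, g2, g3⟩
    have e4 : 2 * Real.sqrt l / S.alpha = Real.sqrt (4 * l) / S.alpha := by
      rw [Real.sqrt_mul (by norm_num), show (4 : ℝ) = 2 ^ 2 by norm_num,
        Real.sqrt_sq (by norm_num)]
    obtain ⟨y1, y2, y3⟩ := hyy 4 le_rfl (by norm_num)
    rw [← e4] at y1 y2 y3
    have hC := hA₀ (h.traj ω) g1 hs g2 a0 hE y1 y2 y3 g3
    have hest := hA₁ (h.traj ω) hC hs a1 hE g3
    refine ⟨hC, ⟨fun t ht => hC.safe (h.traj ω) g1 hs hl hest ht, fun t ht => g1.noise_le t ht⟩,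
      fun s hsr => hest s hsr, heps hC⟩

/-! ### The lines on which the safety controls lie -/

/-- The slope of `x ↦ v₁ x + v₂ u` along a branch `(c₁ ± e) x + (c₂ ± e) u = D`. -/
def slope (c : ℝ × ℝ) (e : ℝ) (σ τ : Bool) (v : ℝ × ℝ) : ℝ :=
  v.1 - v.2 * ((c.1 + (if σ then e else -e)) / (c.2 + (if τ then e else -e)))

/-- The intercept of `x ↦ v₁ x + v₂ u` along a branch `(c₁ ± e) x + (c₂ ± e) u = D`. -/
def intercept (D : ℝ) (c : ℝ × ℝ) (e : ℝ) (τ : Bool) (v : ℝ × ℝ) : ℝ :=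
  v.2 * (D / (c.2 + (if τ then e else -e)))

theorem abs_sign_le {e : ℝ} (he : 0 ≤ e) (σ : Bool) : |if σ then e else -e| ≤ e := by
  cases σ <;> simp [abs_of_nonneg he]

theorem exists_branch {S : Spec} {c : ℝ × ℝ} {e l : ℝ} (hn : NiceBox S c e l) (D x : ℝ) :
    ∃ σ τ : Bool, ∀ v : ℝ × ℝ, v.1 * x + v.2 * safeU D c e x =
      slope c e σ τ v * x + intercept D c e τ v := by
  obtain ⟨σ, τ, h⟩ := safeU_branch hn.nonneg hn.lt D x
  refine ⟨σ, τ, fun v => ?_⟩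
  have hpos : 0 < c.2 + (if τ then e else -e) := by
    have := (abs_le.1 (abs_sign_le hn.nonneg τ)).1
    linarith [hn.lt]
  have hu : safeU D c e x = (D - (c.1 + (if σ then e else -e)) * x) /
      (c.2 + (if τ then e else -e)) := by
    rw [eq_div_iff hpos.ne']; linarith
  rw [hu, slope, intercept]
  field_simp
  ring

/-- The constant in the lower bound for intercepts. -/
def Spec.zc (S : Spec) : ℝ := min 1 (S.bLo / (4 * (S.aHi + 1))) / (S.bHi + 1)

theorem Spec.zc_pos (S : Spec) : 0 < S.zc := by
  have := S.aHi_pos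
  have := S.bHi_pos
  have := S.bLo_pos
  unfold Spec.zc; positivity

/-- If the slope is small and v₁ = 1, then v₂ must nearly cancel v₁ against a bounded ratio and so
cannot be small; otherwise v₂ = 1. In both cases the intercept is comparable to D. -/
theorem intercept_ge {S : Spec} {c : ℝ × ℝ} {e l D : ℝ} (hn : NiceBox S c e l) (hD : 0 ≤ D)
    {σ τ : Bool} {v : ℝ × ℝ} (hv : v.1 = 1 ∨ v.2 = 1) (hs : |slope c e σ τ v| < 1 / 2) :
    S.zc * D ≤ |intercept D c e τ v| := by
  have haH := S.aHi_pos
  have hbH := S.bHi_pos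
  have hb := S.bLo_pos
  have e1 := abs_le.1 (abs_sign_le hn.nonneg σ)
  have e2 := abs_le.1 (abs_sign_le hn.nonneg τ)
  unfold slope at hs
  unfold intercept
  set α := c.1 + (if σ then e else -e) with hα
  set β := c.2 + (if τ then e else -e) with hβ
  have hβ1 : S.bLo / 2 ≤ β := by linarith [hn.b_ge, hn.le_b]
  have hβ2 : β ≤ S.bHi + 1 := by linarith [hn.b_le, hn.le_half]
  have hβ0 : 0 < β := by linarith
  have hα1 : |α| ≤ S.aHi + 1 := by
    have := abs_le.1 hn.a_le
    exact abs_le.2 ⟨by linarith [hn.le_half], by linarith [hn.le_half]⟩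
  have hv2 : min 1 (S.bLo / (4 * (S.aHi + 1))) ≤ |v.2| := by
    rcases hv with hv | hv
    · refine (min_le_right _ _).trans ?_
      rw [hv] at hs
      have h1 : 1 / 2 ≤ |v.2 * (α / β)| := by
        have := abs_sub_abs_le_abs_sub 1 (v.2 * (α / β))
        rw [abs_one] at this
        linarith
      rw [abs_mul, abs_div, abs_of_pos hβ0, ← mul_div_assoc, le_div_iff₀ hβ0] at h1
      have h2 : |v.2| * |α| ≤ |v.2| * (S.aHi + 1) := by gcongr
      rw [div_le_iff₀ (by positivity)]
      linarith
    · rw [hv, abs_one]; exact min_le_left _ _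
  rw [abs_mul, abs_of_nonneg (by positivity : 0 ≤ D / β), Spec.zc, div_mul_eq_mul_div]
  calc min 1 (S.bLo / (4 * (S.aHi + 1))) * D / (S.bHi + 1)
      = min 1 (S.bLo / (4 * (S.aHi + 1))) * (D / (S.bHi + 1)) := by ring
    _ ≤ |v.2| * (D / β) := by gcongr

/-- The dichotomy behind the count: with a noticeable slope, only the bad event makes the value
small; with a tiny slope, the intercept dominates the term in x. -/
theorem safeU_large {S : Spec} {c : ℝ × ℝ} {e l D x η k X : ℝ} (hn : NiceBox S c e l) (hD : 0 ≤ D)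
    (hη : η ≤ 1 / 2) (hη0 : 0 ≤ η) (hx : |x| ≤ X) (hk : k + η * X ≤ S.zc * D) :
    ∃ σ τ : Bool, ∀ v : ℝ × ℝ, (v.1 = 1 ∨ v.2 = 1) →
      ¬ (η ≤ |slope c e σ τ v| ∧ |slope c e σ τ v * x + intercept D c e τ v| < k) →
      k ≤ |v.1 * x + v.2 * safeU D c e x| := by
  obtain ⟨σ, τ, h⟩ := exists_branch hn D x
  refine ⟨σ, τ, fun v hv hnb => ?_⟩
  rw [h v]
  by_cases hs : η ≤ |slope c e σ τ v|
  · by_contra hlt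
    exact hnb ⟨hs, not_le.1 hlt⟩
  · push Not at hs
    have h1 := intercept_ge hn hD hv (hs.trans_le hη)
    have h2 : |slope c e σ τ v * x| ≤ η * X := by
      rw [abs_mul]
      exact mul_le_mul hs.le hx (abs_nonneg _) hη0
    have h3 := abs_sub_abs_le_abs_sub (intercept D c e τ v) (-(slope c e σ τ v * x))
    rw [abs_neg, sub_neg_eq_add, add_comm (intercept D c e τ v)] at h3
    linarith

-- Let N be the number of likely times and G the number of uses among them. The four branches are
-- bad at most γN/16 + 4K times in total, and γN/4 ≤ G + K, so at least 3G/4 - 5K uses are good. Bad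
-- times are counted over all likely times, not only over uses, because the use of the safety
-- control depends on the fresh noise and conditioning on it would destroy the density bound.
open Classical in
theorem qf_ge_of_counts {n : ℕ} {x u : ℕ → ℝ} {J A : ℕ → Prop} {bad : Bool → Bool → ℕ → Prop}
    {h K γ a b : ℝ} (hh : 0 ≤ h) (hK : 0 ≤ K)
    (hgood : ∀ t < n, J t → A t → (∀ σ τ, ¬ bad σ τ t) → h ≤ |a * x (t + 1) + b * u (t + 1)|)
    (hL : ∑ t ∈ Finset.range n, (if J t then (γ / 4 - if A t then (1 : ℝ) else 0) else 0) ≤ K)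
    (hD : ∀ σ τ, ∑ t ∈ Finset.range n,
      (if J t then ((if bad σ τ t then (1 : ℝ) else 0) - 2 * (γ / 128)) else 0) ≤ K) :
    h ^ 2 * (3 / 4 * (∑ t ∈ Finset.range n, if J t ∧ A t then (1 : ℝ) else 0) - 5 * K) ≤
      qf x u (n + 1) a b := by
  set N := ∑ t ∈ Finset.range n, (if J t then (1 : ℝ) else 0) with hN
  set G := ∑ t ∈ Finset.range n, (if J t ∧ A t then (1 : ℝ) else 0) with hG
  set B : Bool → Bool → ℝ := fun σ τ => ∑ t ∈ Finset.range n,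
    (if J t ∧ bad σ τ t then (1 : ℝ) else 0) with hB
  have e1 : ∑ t ∈ Finset.range n, (if J t then (γ / 4 - if A t then (1 : ℝ) else 0) else 0) =
      γ / 4 * N - G := by
    rw [hN, hG, Finset.mul_sum, ← Finset.sum_sub_distrib]
    refine Finset.sum_congr rfl fun t _ => ?_
    by_cases h1 : J t <;> by_cases h2 : A t <;> simp [h1, h2]
  have e2 : ∀ σ τ, ∑ t ∈ Finset.range n,
      (if J t then ((if bad σ τ t then (1 : ℝ) else 0) - 2 * (γ / 128)) else 0) =
      B σ τ - γ / 64 * N := by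
    intro σ τ
    simp only [hN, hB]
    rw [Finset.mul_sum, ← Finset.sum_sub_distrib]
    refine Finset.sum_congr rfl fun t _ => ?_
    by_cases h1 : J t <;> by_cases h2 : bad σ τ t <;> simp [h1, h2] <;> ring
  rw [e1] at hL
  have hBs : ∀ σ τ, B σ τ ≤ γ / 64 * N + K := fun σ τ => by
    have := hD σ τ; rw [e2] at this; linarith
  have h1 : h ^ 2 * (G - (B true true + B true false + B false true + B false false)) ≤
      ∑ t ∈ Finset.range n, (a * x (t + 1) + b * u (t + 1)) ^ 2 := by
    simp only [hG, hB]
    rw [← Finset.sum_add_distrib, ← Finset.sum_add_distrib, ← Finset.sum_add_distrib,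
      ← Finset.sum_sub_distrib, Finset.mul_sum]
    refine Finset.sum_le_sum fun t ht => ?_
    have hsq := sq_nonneg (a * x (t + 1) + b * u (t + 1))
    have hh2 := sq_nonneg h
    have hnn : ∀ σ τ, (0 : ℝ) ≤ if J t ∧ bad σ τ t then (1 : ℝ) else 0 := fun σ τ => by
      split_ifs <;> norm_num
    by_cases hJA : J t ∧ A t
    · by_cases hb : ∃ σ τ, bad σ τ t
      · obtain ⟨σ, τ, hb⟩ := hb
        refine le_trans (mul_nonpos_of_nonneg_of_nonpos hh2 ?_) hsq
        have h3 : (if J t ∧ bad σ τ t then (1 : ℝ) else 0) = 1 := if_pos ⟨hJA.1, hb⟩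
        have := hnn true true
        have := hnn true false
        have := hnn false true
        have := hnn false false
        rw [if_pos hJA]
        cases σ <;> cases τ <;> linarith
      · push Not at hb
        have := hgood t (Finset.mem_range.1 ht) hJA.1 hJA.2 hb
        simp only [hb, hJA, and_false, and_self, if_true, if_false, add_zero, sub_zero, mul_one]
        rw [← sq_abs (a * x (t + 1) + b * u (t + 1))]
        exact pow_le_pow_left₀ hh this 2
    · refine le_trans (mul_nonpos_of_nonneg_of_nonpos hh2 ?_) hsq
      rw [if_neg hJA]
      have := hnn true true
      have := hnn true false
      have := hnn false true
      have := hnn false false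
      linarith
  have h2 : ∑ t ∈ Finset.range n, (a * x (t + 1) + b * u (t + 1)) ^ 2 ≤ qf x u (n + 1) a b := by
    rw [qf, Finset.sum_range_succ']
    linarith [sq_nonneg (a * x 0 + b * u 0)]
  refine le_trans (mul_le_mul_of_nonneg_left ?_ (sq_nonneg h)) (h1.trans h2)
  have := hBs true true
  have := hBs true false
  have := hBs false true
  have := hBs false false
  linarith

/-! ### Counting uses of the safety control -/

section Count

variable {Ω : Type*} {S : Spec} {T : ℕ}

/-- The event that the safety control is used at time `i`. -/
def Problem.useU (p : Problem S T) (x u : ℕ → Ω → ℝ) (i : ℕ) : Set Ω :=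
  {ω | u i ω = p.ctrlU x u (roundOf T i) i ω}

/-- The slope at time `i` in the direction `v`. -/
def slopeAt (S : Spec) (T : ℕ) (x u : ℕ → Ω → ℝ) (σ τ : Bool) (v : ℝ × ℝ) (i : ℕ) (ω : Ω) : ℝ :=
  slope (est S T x u (roundOf T i) ω) (eps S T x u (roundOf T i) ω) σ τ v

/-- The intercept at time `i` in the direction `v`. -/
def Problem.interceptAt (p : Problem S T) (x u : ℕ → Ω → ℝ) (τ : Bool) (v : ℝ × ℝ) (i : ℕ)
    (ω : Ω) : ℝ :=
  intercept p.DU (est S T x u (roundOf T i) ω) (eps S T x u (roundOf T i) ω) τ v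

variable {p : Problem S T} {x u : ℕ → Ω → ℝ}

theorem measurableSet_useU (i : ℕ) (hw : 0 < warm T) (hi : warm T ≤ i) :
    MeasurableSet[sigmaG x u (i + 1)] (p.useU x u i) := by
  have hst := start_roundOf_le hw hi
  have hx : ∀ j ≤ start T (roundOf T i), Measurable[sigmaG x u (i + 1)] (x j) := fun j hj =>
    measurable_sigmaG_x (by omega)
  have hu : ∀ j < start T (roundOf T i), Measurable[sigmaG x u (i + 1)] (u j) := fun j hj =>
    measurable_sigmaG_u (by omega)
  exact measurableSet_eq_fun (measurable_sigmaG_u (Nat.lt_succ_self i))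
    (measurable_safeU p.DU (measurable_thetaPre hx hu)
      (measurable_radius (fun j hj => hx j (le_of_lt hj)) hu)
      (measurable_sigmaG_x (Nat.lt_succ_self i)) fun ω => radius_nonneg _ _ _ _ _)

theorem measurable_slopeAt (σ τ : Bool) (v : ℝ × ℝ) (i : ℕ) (hi : start T (roundOf T i) < i) :
    Measurable[sigmaG x u i] (slopeAt S T x u σ τ v i) ∧
      Measurable[sigmaG x u i] (p.interceptAt x u τ v i) := by
  have hx : ∀ j ≤ start T (roundOf T i), Measurable[sigmaG x u i] (x j) := fun j hj =>
    measurable_sigmaG_x (by omega)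
  have hu : ∀ j < start T (roundOf T i), Measurable[sigmaG x u i] (u j) := fun j hj =>
    measurable_sigmaG_u (by omega)
  have h1 := measurable_thetaPre (S := S) hx hu
  have h2 := measurable_radius (S := S) (T := T) (fun j hj => hx j (le_of_lt hj)) hu
  have h3 : ∀ σ : Bool, Measurable[sigmaG x u i] fun ω =>
      if σ then eps S T x u (roundOf T i) ω else -eps S T x u (roundOf T i) ω := fun σ => by
    cases σ
    · simp only [Bool.false_eq_true, if_false]; exact h2.neg
    · simp only [if_true]; exact h2
  have h4 := (measurable_snd.comp h1).add (h3 τ)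
  have h5 := (measurable_fst.comp h1).add (h3 σ)
  exact ⟨measurable_const.sub (measurable_const.mul (h5.div h4)),
    measurable_const.mul (measurable_const.div h4)⟩

variable [mΩ : MeasurableSpace Ω] {P : Measure Ω} {w φ : ℕ → Ω → ℝ} {θhat : ℕ → Ω → ℝ × ℝ} {E l : ℝ}

/-- The event that time `i` is not the beginning of a round, and that the safety control was likely
to be used. -/
def Problem.cand (p : Problem S T) (P : Measure Ω) (x u : ℕ → Ω → ℝ) (Ev : Set Ω) (γ : ℝ) (i : ℕ) :
    Set Ω :=
  {ω | (warm T ≤ i ∧ start T (roundOf T i) < i) ∧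
    ω ∈ likely P (sigmaG x u i) Ev (p.useU x u i) γ}

theorem measurableSet_cand (Ev : Set Ω) (γ : ℝ) (i : ℕ) :
    MeasurableSet[sigmaG x u i] (p.cand P x u Ev γ i) :=
  MeasurableSet.inter (MeasurableSet.const _) (measurableSet_likely _ _ _)

namespace IsRun

variable [IsProbabilityMeasure P]

-- The candidate set is known from G_i, and on it the safety control is used with conditional
-- probability at least γ/2, so the lower-tail supermartingale applies with p = γ/2.
open Classical in
theorem prob_cand_lower (h : IsRun p P w φ x u θhat) (hs : Scale T E l) {Ev : Set Ω}
    (hEv : MeasurableSet Ev) {γ : ℝ} (hγ : 0 < γ) {n : ℕ} (hn : n < T) (L : ℝ) :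
    P.real {ω | L < ∑ t ∈ Finset.range n, (if ω ∈ p.cand P x u Ev γ (t + 1) then
      (γ / 4 - if ω ∈ p.useU x u (t + 1) then (1 : ℝ) else 0) else 0)} ≤ Real.exp (-L) := by
  have hξ : ∀ j, Measurable[sigmaG x u (j + 2)]
      (fun ω => (if ω ∈ p.cand P x u Ev γ (j + 1) then
        (γ / 4 - if ω ∈ p.useU x u (j + 1) then (1 : ℝ) else 0) else 0)) := by
    intro j
    by_cases hj : warm T ≤ j + 1
    · have m1 : MeasurableSet[sigmaG x u (j + 2)] (p.cand P x u Ev γ (j + 1)) :=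
        sigmaG_mono (Nat.le_succ _) _ (measurableSet_cand Ev γ (j + 1))
      have m2 : MeasurableSet[sigmaG x u (j + 2)] (p.useU x u (j + 1)) :=
        measurableSet_useU _ hs.warm_pos hj
      exact Measurable.ite m1 (measurable_const.sub (Measurable.ite m2 measurable_const
        measurable_const)) measurable_const
    · have : (fun ω => (if ω ∈ p.cand P x u Ev γ (j + 1) then
        (γ / 4 - if ω ∈ p.useU x u (j + 1) then (1 : ℝ) else 0) else 0)) = fun _ => (0 : ℝ) := by
        funext ω
        exact if_neg fun hc => hj hc.1.1
      rw [this]; exact measurable_const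
  refine measureReal_exp_sum_gt_le n (m := fun i => sigmaG x u (i + 1))
    (fun i hi => h.sigmaG_le_top hs (by omega))
    (fun i hi j hj => (hξ j).mono (sigmaG_mono (by omega)) le_rfl)
    (fun i hi => (hξ i).mono (h.sigmaG_le_top hs (by omega)) le_rfl) (fun i hi t ht => ?_) L
  have hle := h.sigmaG_le_top hs (i := i + 1) (by omega)
  by_cases hw : warm T ≤ i + 1 ∧ start T (roundOf T (i + 1)) < i + 1
  · have hA : MeasurableSet (p.useU x u (i + 1)) := by
      exact h.sigmaG_le_top hs (i := i + 2) (by omega) _ (measurableSet_useU _ hs.warm_pos hw.1)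
    have hI : p.cand P x u Ev γ (i + 1) = likely P (sigmaG x u (i + 1)) Ev (p.useU x u (i + 1)) γ := by
      ext ω
      exact ⟨fun hc => hc.2, fun hc => ⟨hw, hc⟩⟩
    have := setLIntegral_lower_le (P := P) hle (measurableSet_cand (p := p) (P := P) Ev γ (i + 1)) hA
      (p := γ / 2) (fun s hs' => by rw [hI]; exact likely_spec hle hEv hA hγ s hs') ht
    rw [show γ / 2 / 2 = γ / 4 by ring] at this
    exact this
  · have : ∀ ω, (if ω ∈ p.cand P x u Ev γ (i + 1) then
        (γ / 4 - if ω ∈ p.useU x u (i + 1) then (1 : ℝ) else 0) else 0) = (0 : ℝ) := fun ω =>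
      if_neg fun hc => hw hc.1
    simp [this]

-- At a candidate time the box is determined by G_{t+1}, whereas x_{t+1} contains w_t; the affine
-- form is therefore evaluated at independent noise.
open Classical in
theorem prob_cand_upper (h : IsRun p P w φ x u θhat) (hs : Scale T E l) (Ev : Set Ω) (γ : ℝ)
    {n : ℕ} (hn : n < T) (σ τ : Bool) (v : ℝ × ℝ) {η k ρ : ℝ} (hη : 0 < η) (hk : 0 < k)
    (hρ : 2 * S.BP * k / η ≤ ρ) (L : ℝ) :
    P.real {ω | L < ∑ t ∈ Finset.range n, (if ω ∈ p.cand P x u Ev γ (t + 1) then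
      ((if η ≤ |slopeAt S T x u σ τ v (t + 1) ω| ∧ |slopeAt S T x u σ τ v (t + 1) ω * x (t + 1) ω +
        p.interceptAt x u τ v (t + 1) ω| < k then (1 : ℝ) else 0) - 2 * ρ) else 0)} ≤
      Real.exp (-L) := by
  set J : ℕ → Ω → ℝ := fun t ω => if ω ∈ p.cand P x u Ev γ (t + 1) then 1 else 0 with hJ
  -- At the beginning of a round the box itself depends on x_{t+1}, hence on w_t. Slope and
  -- intercept are replaced by 0 there to stay predictable; candidates exclude these times.
  set a : ℕ → Ω → ℝ := fun t ω => if start T (roundOf T (t + 1)) < t + 1 then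
    slopeAt S T x u σ τ v (t + 1) ω else 0 with ha
  set b : ℕ → Ω → ℝ := fun t ω => if start T (roundOf T (t + 1)) < t + 1 then
    slopeAt S T x u σ τ v (t + 1) ω * (p.thetaStar.1 * x t ω + p.thetaStar.2 * u t ω) +
      p.interceptAt x u τ v (t + 1) ω else 0 with hb
  have hle : ∀ i < n, sigmaG x u (i + 1) ≤ sig w φ (pastW i) := fun i hi =>
    h.sigmaG_le_sig hs (by omega)
  have mJ : ∀ i < n, Measurable[sig w φ (pastW i)] (J i) := fun i hi =>
    Measurable.ite (hle i hi _ (measurableSet_cand Ev γ (i + 1))) measurable_const measurable_const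
  have ma : ∀ i < n, Measurable[sig w φ (pastW i)] (a i) := fun i hi => by
    by_cases hst : start T (roundOf T (i + 1)) < i + 1
    · simp only [ha, hst, if_true]
      exact (measurable_slopeAt (p := p) σ τ v (i + 1) hst).1.mono (hle i hi) le_rfl
    · simp only [ha, hst, if_false]; exact measurable_const
  have mb : ∀ i < n, Measurable[sig w φ (pastW i)] (b i) := fun i hi => by
    by_cases hst : start T (roundOf T (i + 1)) < i + 1
    · simp only [hb, hst, if_true]
      obtain ⟨k1, k2⟩ := measurable_slopeAt (p := p) (x := x) (u := u) σ τ v (i + 1) hst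
      have k3 : Measurable[sigmaG x u (i + 1)] (x i) := measurable_sigmaG_x (Nat.lt_succ_self i)
      have k4 : Measurable[sigmaG x u (i + 1)] (u i) := measurable_sigmaG_u (Nat.lt_succ_self i)
      exact ((k1.mul ((k3.const_mul _).add (k4.const_mul _))).add k2).mono (hle i hi) le_rfl
    · simp only [hb, hst, if_false]; exact measurable_const
  refine le_trans (measureReal_mono (fun ω hω => ?_) (by finiteness))
    (h.prob_count_gt mJ ma mb hη hk hρ L)
  refine lt_of_lt_of_eq (show L < _ from hω) (Finset.sum_congr rfl fun t ht => ?_)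
  by_cases hc : ω ∈ p.cand P x u Ev γ (t + 1)
  · have e1 : J t ω = 1 := if_pos hc
    have e2 : a t ω = slopeAt S T x u σ τ v (t + 1) ω := if_pos hc.1.2
    have e3 : b t ω = slopeAt S T x u σ τ v (t + 1) ω *
      (p.thetaStar.1 * x t ω + p.thetaStar.2 * u t ω) + p.interceptAt x u τ v (t + 1) ω :=
      if_pos hc.1.2
    have e4 := h.x_succ t (by have := Finset.mem_range.1 ht; omega) ω
    rw [if_pos hc, if_pos e1, e2, e3, e4]
    have e5 : slopeAt S T x u σ τ v (t + 1) ω *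
        (p.thetaStar.1 * x t ω + p.thetaStar.2 * u t ω + w t ω) + p.interceptAt x u τ v (t + 1) ω =
        slopeAt S T x u σ τ v (t + 1) ω * w t ω + (slopeAt S T x u σ τ v (t + 1) ω *
        (p.thetaStar.1 * x t ω + p.thetaStar.2 * u t ω) + p.interceptAt x u τ v (t + 1) ω) := by
      ring
    rw [e5]
  · have e1 : J t ω = 0 := if_neg hc
    rw [if_neg hc, e1, if_neg (by norm_num)]

end IsRun

end Count

/-! ### A finite net of directions -/

/-- The directions `(1, j / E)` and `(j / E, 1)`. -/
def netDir (E : ℝ) (f : Bool) (j : ℤ) : ℝ × ℝ := if f then (1, j / E) else (j / E, 1)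

theorem netDir_eq_one (E : ℝ) (f : Bool) (j : ℤ) : (netDir E f j).1 = 1 ∨ (netDir E f j).2 = 1 := by
  cases f <;> simp [netDir]

theorem exists_net_point {E : ℝ} {n : ℕ} (hE : E = n) (h1 : 1 ≤ E) {c : ℝ} (hc : |c| ≤ 1) :
    ∃ j ∈ Finset.Icc (-(n : ℤ)) n, |(j : ℝ) / E - c| ≤ 1 / E := by
  have hE0 : 0 < E := by linarith
  obtain ⟨c1, c2⟩ := abs_le.1 hc
  refine ⟨⌊c * E⌋, Finset.mem_Icc.2 ⟨?_, ?_⟩, ?_⟩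
  · rw [Int.le_floor]; push_cast; rw [← hE]; nlinarith
  · have : (⌊c * E⌋ : ℝ) ≤ ((n : ℤ) : ℝ) := by
      refine (Int.floor_le _).trans ?_
      push_cast; rw [← hE]; nlinarith
    exact_mod_cast this
  · have e : (⌊c * E⌋ : ℝ) / E - c = (⌊c * E⌋ - c * E) / E := by field_simp
    rw [e, abs_div, abs_of_pos hE0]
    gcongr
    exact abs_le.2 ⟨by linarith [Int.lt_floor_add_one (c * E)], by linarith [Int.floor_le (c * E)]⟩

section Final

variable {Ω : Type*} {S : Spec} {T : ℕ} {p : Problem S T} {x u : ℕ → Ω → ℝ}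
  [mΩ : MeasurableSpace Ω] {P : Measure Ω} {w φ : ℕ → Ω → ℝ} {θhat : ℕ → Ω → ℝ × ℝ} {E l : ℝ}

open Classical in
/-- The events counted by `S'` are typical: the conditional probability of `Ev` is bounded below,
the safety controls are used about as often as predicted, and they are rarely small. -/
structure CountOk (p : Problem S T) (P : Measure Ω) (x u : ℕ → Ω → ℝ) (Ev : Set Ω) (γ E K η k : ℝ)
    (ω : Ω) : Prop where
  cond : ∀ i < T, 1 / 2 ≤ (P[Ev.indicator (fun _ => (1 : ℝ)) | sigmaG x u i]) ω
  lower : ∀ s < rounds T, ∑ t ∈ Finset.range (start T s - 1),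
    (if ω ∈ p.cand P x u Ev γ (t + 1) then
      (γ / 4 - if ω ∈ p.useU x u (t + 1) then (1 : ℝ) else 0) else 0) ≤ K
  upper : ∀ s < rounds T, ∀ σ τ f : Bool, ∀ j : ℤ, |(j : ℝ)| ≤ E →
    ∑ t ∈ Finset.range (start T s - 1), (if ω ∈ p.cand P x u Ev γ (t + 1) then
      ((if η ≤ |slopeAt S T x u σ τ (netDir E f j) (t + 1) ω| ∧
        |slopeAt S T x u σ τ (netDir E f j) (t + 1) ω * x (t + 1) ω +
          p.interceptAt x u τ (netDir E f j) (t + 1) ω| < k then (1 : ℝ) else 0) -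
        2 * (γ / 128)) else 0) ≤ K

open Classical in
theorem IsRun.prob_not_countOk [IsProbabilityMeasure P] (h : IsRun p P w φ x u θhat)
    (hs : Scale T E l) {Ev : Set Ω} (hEv : MeasurableSet Ev) {γ K η k : ℝ} (hγ : 0 < γ) (hη : 0 < η)
    (hk : 0 < k) (hρ : 2 * S.BP * k / η ≤ γ / 128) :
    P.real {ω | ¬ CountOk p P x u Ev γ E K η k ω} ≤
      2 * P.real Evᶜ + l * Real.exp (-K) + l * (8 * (2 * E + 1)) * Real.exp (-K) := by
  obtain ⟨n, hn⟩ := hs.E_nat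
  have hst : ∀ s < rounds T, start T s - 1 < T := fun s hsr => by
    have := hs.start_lt hsr
    omega
  have b1 := measureReal_exists_condExp_lt (P := P) (n := T) (m := sigmaG x u)
    (fun i hi => h.sigmaG_le_top hs hi.le) sigmaG_mono hEv
  have b2 := measureReal_exists_finset_le (P := P) (Finset.range (rounds T))
    (fun s hsr => h.prob_cand_lower hs hEv hγ (hst s (Finset.mem_range.1 hsr)) K)
  have b3 := measureReal_exists_finset_le (P := P)
    (Finset.range (rounds T) ×ˢ (Finset.univ : Finset (Bool × Bool × Bool)) ×ˢ
      Finset.Icc (-(n : ℤ)) n)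
    (fun q hq => h.prob_cand_upper hs Ev γ (hst q.1 (Finset.mem_range.1 (Finset.mem_product.1 hq).1))
      q.2.1.1 q.2.1.2.1 (netDir E q.2.1.2.2 q.2.2) hη hk hρ K)
  -- Eight is the number of triples of two branch signs and a side of the square; each side carries
  -- 2E + 1 net points.
  have c3 : (((Finset.range (rounds T) ×ˢ (Finset.univ : Finset (Bool × Bool × Bool)) ×ˢ
      Finset.Icc (-(n : ℤ)) n).card : ℕ) : ℝ) = rounds T * (8 * (2 * E + 1)) := by
    rw [Finset.card_product, Finset.card_product, Int.card_Icc, Finset.card_range, hn,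
      show ((n : ℤ) + 1 - -(n : ℤ)).toNat = 2 * n + 1 by omega,
      show (Finset.univ : Finset (Bool × Bool × Bool)).card = 8 from rfl]
    push_cast; ring
  rw [c3] at b3
  rw [Finset.card_range] at b2
  have hr := hs.rounds_le
  have hE := hs.E_pos
  have b2' := b2.trans (mul_le_mul_of_nonneg_right hr (Real.exp_pos _).le)
  have b3' := b3.trans (mul_le_mul_of_nonneg_right (mul_le_mul_of_nonneg_right hr
    (by positivity : 0 ≤ 8 * (2 * E + 1))) (Real.exp_pos _).le)
  refine le_trans (measureReal_mono (fun ω hω => ?_) (by finiteness))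
    ((measureReal_union_le _ _).trans (add_le_add
      ((measureReal_union_le _ _).trans (add_le_add b1 b2')) b3'))
  by_contra hno
  rw [Set.mem_union, Set.mem_union, not_or, not_or] at hno
  obtain ⟨⟨n1, n2⟩, n3⟩ := hno
  have n1 : ¬ ∃ i < T, (P[Ev.indicator (fun _ => (1 : ℝ)) | sigmaG x u i]) ω < 1 / 2 := n1
  simp only [Set.mem_ofPred_eq] at n2 n3
  push Not at n1 n2 n3
  refine hω ⟨n1, fun s hsr => n2 s (Finset.mem_range.2 hsr), fun s hsr σ τ f j hj => ?_⟩
  refine n3 (s, (σ, τ, f), j) (Finset.mem_product.2 ⟨Finset.mem_range.2 hsr,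
    Finset.mem_product.2 ⟨Finset.mem_univ _, Finset.mem_Icc.2 ?_⟩⟩)
  obtain ⟨j1, j2⟩ := abs_le.1 hj
  rw [hn] at j1 j2
  exact ⟨by exact_mod_cast j1, by exact_mod_cast j2⟩

open Classical in
/-- The number of likely uses of the safety control before round `s` (not counting the beginnings
of rounds). -/
def Problem.numUse (p : Problem S T) (P : Measure Ω) (x u : ℕ → Ω → ℝ) (Ev : Set Ω) (γ : ℝ) (s : ℕ)
    (ω : Ω) : ℝ :=
  ∑ t ∈ Finset.range (start T s - 1),
    if ω ∈ p.cand P x u Ev γ (t + 1) ∧ ω ∈ p.useU x u (t + 1) then (1 : ℝ) else 0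

/-- Every point of the square boundary, up to sign, is within 1/E of a net direction. Rounding
changes v·z by at most (3 + Cu)l²/E ≤ k/2 on the bounded trajectory, so the threshold k becomes k/2.
-/
theorem CoreOk.excited_numUse {ω : Ω} (hC : CoreOk p (fun t => x t ω) (fun t => u t ω) E l)
    (hs : Scale T E l) {Ev : Set Ω} {γ K η k : ℝ} (hη0 : 0 ≤ η) (hη : η ≤ 1 / 2) (hk : 0 < k)
    (hK : 0 ≤ K) (hkη : k + η * (3 * l ^ 2) ≤ S.zc * p.DU) (hEk : (3 + S.Cu) * l ^ 2 / E ≤ k / 2)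
    (hok : CountOk p P x u Ev γ E K η k ω) {s : ℕ} (hsr : s < rounds T) :
    Excited (fun t => x t ω) (fun t => u t ω) (start T s)
      ((k / 2) ^ 2 * (3 / 4 * p.numUse P x u Ev γ s ω - 5 * K)) := by
  classical
  obtain ⟨n, hn⟩ := hs.E_nat
  have hE := hs.E_pos
  have hCu := S.Cu_pos
  have hwp := hs.warm_pos
  have hst := hs.start_pos s
  have hst2 := hs.start_lt hsr
  have main : ∀ (f : Bool) (j : ℤ), |(j : ℝ)| ≤ E → ∀ v : ℝ × ℝ,
      (∀ y z : ℝ, |y| ≤ 3 * l ^ 2 → |z| ≤ S.Cu * l ^ 2 →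
        |(netDir E f j).1 * y + (netDir E f j).2 * z| ≤ |v.1 * y + v.2 * z| + k / 2) →
      (k / 2) ^ 2 * (3 / 4 * p.numUse P x u Ev γ s ω - 5 * K) ≤
        qf (fun t => x t ω) (fun t => u t ω) (start T s) v.1 v.2 := by
    intro f j hj v hv
    have key := qf_ge_of_counts (n := start T s - 1) (x := fun t => x t ω) (u := fun t => u t ω)
      (J := fun t => ω ∈ p.cand P x u Ev γ (t + 1)) (A := fun t => ω ∈ p.useU x u (t + 1))
      (bad := fun σ τ t => η ≤ |slopeAt S T x u σ τ (netDir E f j) (t + 1) ω| ∧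
        |slopeAt S T x u σ τ (netDir E f j) (t + 1) ω * x (t + 1) ω +
          p.interceptAt x u τ (netDir E f j) (t + 1) ω| < k)
      (h := k / 2) (K := K) (γ := γ) (a := v.1) (b := v.2) (by positivity) hK ?_
      -- The range stops at T_s - 1 because the summand t concerns time t + 1; time 0 belongs to the
      -- warm-up and is never counted.
      (hok.lower s hsr) (fun σ τ => by convert hok.upper s hsr σ τ f j hj)
    · rw [Nat.sub_add_cancel hst] at key
      exact key
    · intro t ht hJ hA hb
      have hi : t + 1 < T := by omega
      have hr := roundOf_lt hs hJ.1.1 hi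
      have hB := hC.bdd _ hr
      have hlt := lt_two_start_roundOf (t := t + 1) hwp
      have hx := hB.1 (t + 1) hlt.le
      have hu := hB.2 (t + 1) hlt
      obtain ⟨σ, τ, hl⟩ := safeU_large (hC.nice _ hr) p.DU_pos.le hη hη0 hx hkη
      have h1 := hl (netDir E f j) (netDir_eq_one E f j) (hb σ τ)
      have hA' : u (t + 1) ω = safeU p.DU (thetaPre S (fun t => x t ω) (fun t => u t ω)
        (start T (roundOf T (t + 1)))) (radius S T (fun t => x t ω) (fun t => u t ω)
        (start T (roundOf T (t + 1)))) (x (t + 1) ω) := hA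
      rw [← hA'] at h1
      have h2 := hv _ _ hx hu
      linarith
  intro c hc
  obtain ⟨j, hj, hjc⟩ := exists_net_point hn hs.one_le hc
  have hj' : |(j : ℝ)| ≤ E := by
    obtain ⟨j1, j2⟩ := Finset.mem_Icc.1 hj
    rw [hn]
    exact abs_le.2 ⟨by exact_mod_cast j1, by exact_mod_cast j2⟩
  have err : ∀ (y z a : ℝ), |z| ≤ (3 + S.Cu) * l ^ 2 → a = |((j : ℝ) / E - c) * z| → a ≤ k / 2 := by
    intro y z a hz ha
    rw [ha, abs_mul]
    calc |(j : ℝ) / E - c| * |z| ≤ 1 / E * ((3 + S.Cu) * l ^ 2) := by gcongr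
      _ = (3 + S.Cu) * l ^ 2 / E := by ring
      _ ≤ k / 2 := hEk
  have hl2 := sq_nonneg l
  constructor
  · refine main true j hj' (1, c) fun y z hy hz => ?_
    have h1 := err y z _ (hz.trans (by nlinarith)) rfl
    have h2 : (netDir E true j).1 * y + (netDir E true j).2 * z =
        (1 * y + c * z) + ((j : ℝ) / E - c) * z := by simp only [netDir, if_true]; ring
    rw [h2]
    exact (abs_add_le _ _).trans (by linarith)
  · refine main false j hj' (c, 1) fun y z hy hz => ?_
    have h1 := err z y _ (hy.trans (by nlinarith [mul_nonneg hCu.le hl2])) rfl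
    have h2 : (netDir E false j).1 * y + (netDir E false j).2 * z =
        (c * y + 1 * z) + ((j : ℝ) / E - c) * y := by
      simp only [netDir, Bool.false_eq_true, if_false]; ring
    rw [h2]
    exact (abs_add_le _ _).trans (by linarith)

/-- An element of S' either begins a round, which happens at most `rounds T` ≤ l times, or is a
likely use, since `cond` supplies the second requirement in `likely`. -/
theorem CountOk.ncard_sPrime_le {ω : Ω} {c γ K η k : ℝ}
    (hok : CountOk p P x u (p.evE w x u c) γ E K η k ω) (hs : Scale T E l) {s : ℕ}
    (hsr : s < rounds T) :
    ((p.sPrime P w x u c γ (start T s) ω).ncard : ℝ) ≤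
      p.numUse P x u (p.evE w x u c) γ s ω + l := by
  classical
  have hwp := hs.warm_pos
  have hst2 := hs.start_lt hsr
  set A := (Finset.range (start T s - 1)).filter fun t =>
    ω ∈ p.cand P x u (p.evE w x u c) γ (t + 1) ∧ ω ∈ p.useU x u (t + 1) with hA
  have hsub : p.sPrime P w x u c γ (start T s) ω ⊆
      ((A.image (· + 1) ∪ (Finset.range (rounds T)).image (start T) : Finset ℕ) : Set ℕ) := by
    rintro i ⟨hi, s', hs', h1, h2, h3, h4⟩
    have hr : roundOf T i = s' := roundOf_eq hwp h1 h2
    rw [Finset.mem_coe, Finset.mem_union]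
    by_cases he : start T s' = i
    · exact Or.inr (Finset.mem_image.2 ⟨s', Finset.mem_range.2 hs', he⟩)
    · refine Or.inl (Finset.mem_image.2 ⟨i - 1, ?_, by omega⟩)
      have hi1 : i - 1 + 1 = i := by omega
      rw [hA, Finset.mem_filter, Finset.mem_range, hi1]
      subst hr
      exact ⟨by omega, ⟨⟨(Scale.warm_le_start T _).trans h1, lt_of_le_of_ne h1 he⟩, h4,
        hok.cond i (by omega)⟩, h3⟩
  have h1 := Set.ncard_le_ncard hsub (Finset.finite_toSet _)
  rw [Set.ncard_coe_finset] at h1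
  have h2 := (Finset.card_union_le _ _).trans (add_le_add
    (Finset.card_image_le (s := A) (f := (· + 1)))
    (Finset.card_image_le (s := Finset.range (rounds T)) (f := start T)))
  rw [Finset.card_range] at h2
  have h3 : ((p.sPrime P w x u c γ (start T s) ω).ncard : ℝ) ≤ (A.card : ℝ) + rounds T := by
    exact_mod_cast h1.trans h2
  have h4 : p.numUse P x u (p.evE w x u c) γ s ω = A.card := by
    rw [Problem.numUse, Finset.sum_boole]
  rw [h4]
  linarith [hs.rounds_le]

end Final

/-! ### Comparison of radius and count, and the final probability bounds -/

theorem eps_mul_sqrt_le (S : Spec) : ∃ A : ℝ, ∀ {T : ℕ} {p : Problem S T} {Ω : Type v}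
    [MeasurableSpace Ω] {P : Measure Ω} {x u w : ℕ → Ω → ℝ}
    {E l η k c γ : ℝ} {ω : Ω}, Scale T E l → A ≤ l → l ^ 30 ≤ E →
    CoreOk p (fun t => x t ω) (fun t => u t ω) E l →
    CountOk p P x u (p.evE w x u c) γ E (3 * l) η k ω → 0 ≤ η → η ≤ 1 / 2 → 0 < k →
    k + η * (3 * l ^ 2) ≤ S.zc * p.DU → (3 + S.Cu) * l ^ 2 / E ≤ k / 2 → ∀ s < rounds T,
    eps S T x u s ω * Real.sqrt ((p.sPrime P w x u c γ (start T s) ω).ncard : ℝ) ≤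
      max (4 * l / k) l := by
  obtain ⟨A₀, hA₀⟩ := Bconf_bounds S
  have hrc := S.radC_pos
  refine ⟨max A₀ (max 61 S.radC), fun {T p Ω _ P x u w E l η k c γ ω} hs hA hE hC hok hη0 hη hk hkη hEk
    s hsr => ?_⟩
  simp only [max_le_iff] at hA
  obtain ⟨a0, a1, a2⟩ := hA
  have hl : 0 < l := by linarith
  have hE0 := hs.E_pos
  have hN := hok.ncard_sPrime_le hs hsr
  have hex := hC.excited_numUse hs hη0 hη hk (by positivity) hkη hEk hok hsr
  set G := p.numUse P x u (p.evE w x u c) γ s ω with hG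
  set N : ℝ := ((p.sPrime P w x u c γ (start T s) ω).ncard : ℝ) with hNdef
  have heps0 : 0 ≤ eps S T x u s ω := radius_nonneg _ _ _ _ _
  -- For G ≥ 60l one has 3G/4 - 15l ≥ G/2 and N ≤ 2G, and the excitation by safety controls decides.
  -- Otherwise N ≤ 61l ≤ l², and the warm-up bound on the radius is enough.
  by_cases hc : 60 * l ≤ G
  · refine le_trans ?_ (le_max_left _ _)
    have hG0 : 0 < G := by linarith
    have hκ : k ^ 2 * G / 8 ≤ (k / 2) ^ 2 * (3 / 4 * G - 5 * (3 * l)) := by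
      have := sq_nonneg k
      nlinarith
    have hr := ((hex.sqBound S).mono hκ).ratio_le (by positivity)
    have hB : Bconf S T (fun t => x t ω) (fun t => u t ω) (start T s) ≤ l :=
      (hA₀ hs a0 hE (hC.excited.mono (Scale.warm_le_start T s))).1 (hs.start_lt hsr).le
        ((hC.bdd s hsr).mono (by omega))
    have h1 : eps S T x u s ω ≤ l * Real.sqrt (1 / (k ^ 2 * G / 8)) := by
      unfold eps radius
      exact mul_le_mul hB (Real.sqrt_le_sqrt hr) (Real.sqrt_nonneg _) hl.le
    have h2 : Real.sqrt N ≤ Real.sqrt (2 * G) := Real.sqrt_le_sqrt (by linarith)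
    calc _ ≤ l * Real.sqrt (1 / (k ^ 2 * G / 8)) * Real.sqrt (2 * G) := by gcongr
      _ = l * Real.sqrt ((4 / k) ^ 2) := by
        rw [mul_assoc, ← Real.sqrt_mul (by positivity)]
        congr 2; field_simp; norm_num
      _ = 4 * l / k := by rw [Real.sqrt_sq (by positivity)]; ring
  · refine le_trans ?_ (le_max_right _ _)
    push Not at hc
    have h1 : eps S T x u s ω ≤ 1 := by
      refine (hC.rad_le s hsr).trans ?_
      rw [div_le_one (by positivity)]
      calc S.radC * l ^ 4 ≤ l * l ^ 4 := by gcongr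
        _ = l ^ 5 := by ring
        _ ≤ l ^ 30 := pow_le_pow_right₀ (by linarith) (by norm_num)
        _ ≤ E := hE
        _ ≤ E ^ 3 := le_self_pow₀ hs.one_le (by norm_num)
    have h2 : Real.sqrt N ≤ l := by
      rw [Real.sqrt_le_left hl.le]
      nlinarith
    calc _ ≤ 1 * l := mul_le_mul h1 h2 (Real.sqrt_nonneg _) zero_le_one
      _ = l := one_mul l

theorem prob_evEps_compl_le (S : Spec) : ∃ T₁ : ℕ, ∀ T : ℕ, T₁ ≤ T → Admissible T →
    ∀ p : Problem S T, ∀ (Ω : Type v) [MeasurableSpace Ω] (P : Measure Ω) [IsProbabilityMeasure P]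
    (w φ x u : ℕ → Ω → ℝ) (θhat : ℕ → Ω → ℝ × ℝ), IsRun p P w φ x u θhat →
    P.real (evEps S T x u (S.radC * Real.log T ^ 4))ᶜ ≤ Real.exp (-(25 / 12 * Real.log T)) := by
  obtain ⟨A₀, hA₀⟩ := prob_good.{v} S
  obtain ⟨A₁, hA₁⟩ := core_of_good.{v} S
  obtain ⟨T₁, hT₁⟩ := exists_scale (max A₀ A₁) 30
  refine ⟨T₁, fun T hT hadm p Ω _ P _ w φ x u θhat h => ?_⟩
  obtain ⟨E, hs, hA, hE⟩ := hT₁ T hT hadm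
  have h1 := (hA₀ h hs ((le_max_left _ _).trans hA) hE).1
  have e := hs.exp_neg_mul 25
  push_cast at e
  rw [e]
  refine (measureReal_mono (Set.compl_subset_compl.2 fun ω hω => ?_) (by finiteness)).trans h1
  exact (hA₁ h hs ((le_max_right _ _).trans hA) hE le_rfl).1 hω

/-- The constant in the threshold below which a safety control is small. -/
def Spec.thrC (S : Spec) (c₀ γ : ℝ) : ℝ := γ * S.zc * c₀ / (1536 * S.BP)

theorem Spec.thrC_pos (S : Spec) {c₀ γ : ℝ} (hc₀ : 0 < c₀) (hγ : 0 < γ) : 0 < S.thrC c₀ γ := by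
  have := S.zc_pos
  have := S.BP_pos
  unfold Spec.thrC; positivity

theorem prob_eps_mul_sqrt_gt_le (S : Spec) {c₀ : ℝ} (hc₀ : 0 < c₀) (k₀ : ℕ) {M₂ : ℝ}
    (hM₂ : S.radC ≤ M₂) {k₂ : ℕ} (hk₂ : 4 ≤ k₂) {γ : ℝ} (hγ : 0 < γ) :
    ∃ T₁ : ℕ, ∀ T : ℕ, T₁ ≤ T → Admissible T →
    ∀ p : Problem S T, c₀ / Real.log T ^ k₀ ≤ p.DU →
    ∀ (Ω : Type v) [MeasurableSpace Ω] (P : Measure Ω) [IsProbabilityMeasure P]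
    (w φ x u : ℕ → Ω → ℝ) (θhat : ℕ → Ω → ℝ × ℝ), IsRun p P w φ x u θhat →
    P.real {ω | ¬ ∀ s < rounds T, eps S T x u s ω *
      Real.sqrt ((p.sPrime P w x u (M₂ * Real.log T ^ k₂) γ (start T s) ω).ncard : ℝ) ≤
        (4 / S.thrC c₀ γ + 1) * Real.log T ^ (k₀ + 3)} ≤ Real.exp (-(13 / 12 * Real.log T)) := by
  have hz := S.zc_pos
  have hBP := S.BP_pos
  have hCu := S.Cu_pos
  have hrc := S.radC_pos
  have hH := S.thrC_pos hc₀ hγ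
  obtain ⟨A₀, hA₀⟩ := prob_good.{v} S
  obtain ⟨A₁, hA₁⟩ := core_of_good.{v} S
  obtain ⟨A₂, hA₂⟩ := eps_mul_sqrt_le.{v} S
  obtain ⟨T₁, hT₁⟩ := exists_scale (max A₀ (max A₁ (max A₂ (max 28 (max (S.zc * c₀)
    (max (2 * S.thrC c₀ γ / (S.zc * c₀)) (2 * (3 + S.Cu) / S.thrC c₀ γ))))))) (k₀ + 30)
  refine ⟨T₁, fun T hT hadm p hDU Ω _ P _ w φ x u θhat h => ?_⟩
  obtain ⟨E, hs, hA, hE'⟩ := hT₁ T hT hadm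
  set l := Real.log T with hl_def
  simp only [max_le_iff] at hA
  obtain ⟨a0, a1, a2, a3, a4, a5, a6⟩ := hA
  have hl1 : 1 ≤ l := by linarith
  have hl : 0 < l := by linarith
  have hE : l ^ 30 ≤ E := (pow_le_pow_right₀ hl1 (by omega)).trans hE'
  have hE0 := hs.E_pos
  have hlE : l ≤ E := (le_self_pow₀ hl1 (by norm_num)).trans hE
  set c := M₂ * l ^ k₂ with hc_def
  have hc : S.radC * l ^ 4 ≤ c := mul_le_mul hM₂ (pow_le_pow_right₀ hl1 hk₂) (by positivity)
    (hrc.le.trans hM₂)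
  -- With this η the tiny-slope error 3ηl² is half of the lower bound for zc·D_U, leaving the other
  -- half for k. The constant `thrC` in k then makes 2·BP·k/η equal to γ/128.
  set η := S.zc * c₀ / (6 * l ^ (k₀ + 2)) with hη_def
  set k := S.thrC c₀ γ / l ^ (k₀ + 2) with hk_def
  have hη : 0 < η := by positivity
  have hk : 0 < k := by positivity
  have hη2 : η ≤ 1 / 2 := by
    rw [hη_def, div_le_div_iff₀ (by positivity) (by norm_num)]
    have : l ≤ l ^ (k₀ + 2) := le_self_pow₀ hl1 (by omega)
    linarith
  have hρ : 2 * S.BP * k / η ≤ γ / 128 := by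
    refine le_of_eq ?_
    rw [hk_def, hη_def, Spec.thrC]
    field_simp
    norm_num
  have hkη : k + η * (3 * l ^ 2) ≤ S.zc * p.DU := by
    have e1 : k ≤ S.zc * c₀ / (2 * l ^ k₀) := by
      rw [div_le_iff₀ (by positivity)] at a5
      rw [hk_def, div_le_div_iff₀ (by positivity) (by positivity), pow_add]
      have : l * (S.zc * c₀) ≤ l ^ 2 * (S.zc * c₀) := by
        gcongr; exact le_self_pow₀ hl1 (by norm_num)
      have := mul_le_mul_of_nonneg_right (a5.trans this) (by positivity : 0 ≤ l ^ k₀)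
      linarith
    have e2 : η * (3 * l ^ 2) = S.zc * c₀ / (2 * l ^ k₀) := by
      rw [hη_def, pow_add]; field_simp; norm_num
    calc k + η * (3 * l ^ 2) ≤ S.zc * c₀ / (2 * l ^ k₀) + S.zc * c₀ / (2 * l ^ k₀) := by
          rw [e2]; gcongr
      _ = S.zc * (c₀ / l ^ k₀) := by field_simp; norm_num
      _ ≤ S.zc * p.DU := by gcongr
  have hEk : (3 + S.Cu) * l ^ 2 / E ≤ k / 2 := by
    rw [div_le_iff₀ hH] at a6
    rw [hk_def, div_div, div_le_div_iff₀ hE0 (by positivity)]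
    calc (3 + S.Cu) * l ^ 2 * (l ^ (k₀ + 2) * 2) = 2 * (3 + S.Cu) * l ^ (k₀ + 4) := by ring
      _ ≤ l * S.thrC c₀ γ * l ^ (k₀ + 4) := by gcongr
      _ = S.thrC c₀ γ * l ^ (k₀ + 5) := by ring
      _ ≤ S.thrC c₀ γ * l ^ (k₀ + 30) := by
        gcongr
        norm_num
      _ ≤ S.thrC c₀ γ * E := by gcongr
  have p1 := (hA₀ h hs a0 hE).2
  have core := fun ω => (hA₁ h hs a1 hE hc (ω := ω)).2
  have p2 : P.real (p.evE w x u c)ᶜ ≤ 1 / E ^ 14 :=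
    (measureReal_mono (Set.compl_subset_compl.2 fun ω hω => (core ω hω).2) (by finiteness)).trans p1
  have p3 := h.prob_not_countOk hs (h.measurableSet_evE hs c) (K := 3 * l) hγ hη hk hρ
  have e13 := hs.exp_neg_mul 13
  have e36 := hs.exp_neg_mul 36
  push_cast at e13 e36
  rw [show (36 : ℝ) / 12 = 3 by norm_num] at e36
  rw [e13]
  rw [e36] at p3
  refine le_trans (measureReal_mono (fun ω hω => ?_) (by finiteness))
    ((measureReal_union_le _ _).trans ((add_le_add p1 p3).trans ?_))
  · by_contra hno
    rw [Set.mem_union, not_or] at hno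
    obtain ⟨n1, n2⟩ := hno
    have n1 := not_not.1 n1
    have n2 := not_not.1 n2
    refine hω fun s hsr => (hA₂ hs a2 hE (core ω n1).1 n2 hη.le hη2 hk hkη hEk s hsr).trans ?_
    have e1 : 4 * l / k = 4 / S.thrC c₀ γ * l ^ (k₀ + 3) := by
      rw [hk_def]; field_simp; ring
    have e2 : l ≤ l ^ (k₀ + 3) := le_self_pow₀ hl1 (by omega)
    rw [e1, add_mul, one_mul]
    have : 0 ≤ 4 / S.thrC c₀ γ * l ^ (k₀ + 3) := by positivity
    exact max_le (by linarith) (by linarith)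
  -- The failure probabilities add up to (1 + 2 + 1 + 24)E⁻¹⁴, and E ≥ 28 absorbs the factor.
  · have f1 : l * (1 / E ^ 36) ≤ 1 / E ^ 14 := by
      calc l * (1 / E ^ 36) ≤ E ^ 22 * (1 / E ^ 36) := by
            gcongr; exact hlE.trans (le_self_pow₀ hs.one_le (by norm_num))
        _ = 1 / E ^ 14 := by field_simp
    have f2 : l * (8 * (2 * E + 1)) * (1 / E ^ 36) ≤ 24 * (1 / E ^ 14) := by
      calc l * (8 * (2 * E + 1)) * (1 / E ^ 36) ≤ E ^ 21 * (8 * (2 * E + E)) * (1 / E ^ 36) := by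
            gcongr
            · exact hlE.trans (le_self_pow₀ hs.one_le (by norm_num))
            · exact hs.one_le
        _ = 24 * (1 / E ^ 14) := by field_simp; norm_num
    have f3 : 28 * (1 / E ^ 14) ≤ 1 / E ^ 13 := by
      calc 28 * (1 / E ^ 14) ≤ E * (1 / E ^ 14) := by gcongr; linarith
        _ = 1 / E ^ 13 := by field_simp
    linarith

end

end SafeLQR

theorem mainTheorem3 (S : SafeLQR.Spec) (c₀ : ℝ) (hc₀ : 0 < c₀) (k₀ : ℕ) :
    ∃ (M₁ : ℝ) (k₁ : ℕ),
      (∃ (δ : ℕ → ℝ) (T₁ : ℕ), Tendsto (fun T : ℕ => (T : ℝ) ^ 2 * δ T) atTop (𝓝 0) ∧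
        ∀ T : ℕ, T₁ ≤ T → SafeLQR.Admissible T →
        ∀ p : SafeLQR.Problem S T, c₀ / (Real.log T) ^ k₀ ≤ p.DU →
        ∀ (Ω : Type v) [MeasurableSpace Ω] (Pr : Measure Ω) [IsProbabilityMeasure Pr]
          (w φ x u : ℕ → Ω → ℝ) (θhat : ℕ → Ω → ℝ × ℝ),
          SafeLQR.IsRun p Pr w φ x u θhat →
          Pr.real (SafeLQR.evEps S T x u (M₁ * (Real.log T) ^ k₁))ᶜ ≤ δ T) ∧
      ∀ M₂ : ℝ, M₁ ≤ M₂ → ∀ k₂ : ℕ, k₁ ≤ k₂ → ∀ γ : ℝ, 0 < γ →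
      ∃ (M : ℝ) (k : ℕ) (δ : ℕ → ℝ) (T₂ : ℕ),
        Tendsto (fun T : ℕ => (T : ℝ) * δ T) atTop (𝓝 0) ∧
        ∀ T : ℕ, T₂ ≤ T → SafeLQR.Admissible T →
        ∀ p : SafeLQR.Problem S T, c₀ / (Real.log T) ^ k₀ ≤ p.DU →
        ∀ (Ω : Type v) [MeasurableSpace Ω] (Pr : Measure Ω) [IsProbabilityMeasure Pr]
          (w φ x u : ℕ → Ω → ℝ) (θhat : ℕ → Ω → ℝ × ℝ),
          SafeLQR.IsRun p Pr w φ x u θhat →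
          Pr.real {ω | ¬ ∀ s < SafeLQR.rounds T,
            SafeLQR.eps S T x u s ω *
              Real.sqrt ((p.sPrime Pr w x u (M₂ * (Real.log T) ^ k₂) γ
                (SafeLQR.start T s) ω).ncard : ℝ) ≤ M * (Real.log T) ^ k} ≤ δ T := by
  obtain ⟨T₁, hT₁⟩ := SafeLQR.prob_evEps_compl_le.{v} S
  -- The rates are T^(-25/12) and T^(-13/12), which beat T⁻² and T⁻¹. The exponent 4 comes from l
  -- for the confidence factor times l³ for the inverse root of the excitation.
  refine ⟨S.radC, 4, ⟨fun T => Real.exp (-(25 / 12 * Real.log T)), T₁, ?_,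
    fun T hT hadm p _ => hT₁ T hT hadm p⟩, fun M₂ hM₂ k₂ hk₂ γ hγ => ?_⟩
  · exact_mod_cast SafeLQR.tendsto_pow_mul_exp_log 2 25 (by norm_num)
  · obtain ⟨T₂, hT₂⟩ := SafeLQR.prob_eps_mul_sqrt_gt_le.{v} S hc₀ k₀ hM₂ hk₂ hγ
    refine ⟨4 / S.thrC c₀ γ + 1, k₀ + 3, fun T => Real.exp (-(13 / 12 * Real.log T)), T₂, ?_, hT₂⟩
    simpa using SafeLQR.tendsto_pow_mul_exp_log 1 13 (by norm_num)
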